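/- Let $\mathfrak g$ be a Lie algebra over a field $F$ (of any characteristic and dimension), $I\subset\mathfrak g$ an ideal, $\mathfrak k\subset\mathfrak g$ a subalgebra that is reductive in $\mathfrak g$ (if $U\subset V$ are $\mathfrak k$-submodules of $\mathfrak g$, then $U$ has a $\mathfrak k$-invariant complement in $V$), and $I_{\mathfrak k}=I\cap\mathfrak k$. *Cochains.* For a Lie algebra $L$ with a subalgebra $K$ and an $L$-module $V$, let $C^n(L;V)$ be the space of alternating $n$-linear maps $L^n\to V$, with the Lie algebra cohomology differential $d$ and the operators $(\theta_xf)(v_1,\dots,v_n)=x\cdot f(v_1,\dots,v_n)-\sum_i f(\dots,[x,v_i],\dots)$. Let $C^n(L,K;V)$ be the subspace of those $f$ that vanish when an argument is in $K$ and satisfy $\theta_xf=0$ for $x\in K$. Let $Z^n(L,K;V)$, $B^n(L,K;V)$ and $H^n(L,K;V)$ be the cocycles, coboundaries and cohomology of this complex. A pairing $V\otimes W\to U$ gives the cup product of cochains $$(a\cup b)(x_1,\dots,x_{p+q})=\sum_{\sigma}\operatorname{sgn}(\sigma)\,a(x_{\sigma(1)},\dots,x_{\sigma(p)})\cdot b(x_{\sigma(p+1)},\dots,x_{\sigma(p+q)}),$$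 summed over the $(p,q)$-shuffles. *The action of $\mathfrak g/I$.* Fix a $\mathfrak k$-submodule $J$ of $\mathfrak g$ with $\mathfrak g=I\oplus J$ and $\mathfrak k=I_{\mathfrak k}\oplus(J\cap\mathfrak k)$ (such a $J$ exists), and let $x\mapsto x^+$ be the projection onto $J$ along $I$. For a $\mathfrak g$-module $X$, $\mathfrak g/I$ acts on $H^q(I,I_{\mathfrak k};X)$ by $x\cdot[c]=[\theta_{x^+}c]$. Put $H^p(H^q(X))=H^p(\mathfrak g/I,\mathfrak k/I_{\mathfrak k};H^q(I,I_{\mathfrak k};X))$. *The spectral sequence.* Let $F_pC^n(X)$ be the space of those $f\in C^n(\mathfrak g,\mathfrak k;X)$ that vanish when $n-p+1$ of the arguments are in $I$, and $F_pC^n(r)=\{c\in F_pC^n(X): dc\in F_{p+r}C^{n+1}(X)\}$. For $r\ge 0$ let $$E_r^{pq}(X)=\frac{F_pC^{p+q}(r)}{F_{p+1}C^{p+q}(r-1)+d\,F_{p-r+1}C^{p+q-1}(r-1)},\qquad d_r:E_r^{pq}(X)\to E_r^{p+r,q-r+1}(X),\quad d_r[c]=[dc],$$ be the relative Hochschild–Serre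 spectral sequence. Let $M,N,P$ be $\mathfrak g$-modules and $M\otimes N\to P$ a $\mathfrak g$-module map. Then: 1. For all $r\ge 0$ there are pairings $E_r^{p_1q_1}(M)\otimes E_r^{p_2q_2}(N)\to E_r^{p_1+p_2,\,q_1+q_2}(P)$, $[a]\otimes[b]\mapsto[a\cup b]$, and $$d_r(e\cup e')=(d_re)\cup e'+(-1)^{p_1+q_1}\,e\cup(d_re').$$ 2. The cup product of cochains induces pairings $H^{q_1}(I,I_{\mathfrak k};M)\otimes H^{q_2}(I,I_{\mathfrak k};N)\to H^{q_1+q_2}(I,I_{\mathfrak k};P)$, and the cup product with respect to these induces pairings $$H^{p_1}(H^{q_1}(M))\otimes H^{p_2}(H^{q_2}(N))\xrightarrow{\ \cup\ }H^{p_1+p_2}(H^{q_1+q_2}(P)).$$ 3. For $X=M,N,P$ and $p,q\ge 0$ there is a well-defined linear map $\psi_X:E_2^{pq}(X)\to H^p(H^q(X))$ that sends the class of $c\in F_pC^{p+q}(2)$ to the class of the cocycle $z$, where $z(x_1,\dots,x_p)\in H^q(I,I_{\mathfrak k};X)$ is the class of $(y_1,\dots,y_q)\mapsto c(x_1,\dots,x_p,y_1,\dots,y_q)$.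 If the $\mathfrak k$-modules $C^q(I,I_{\mathfrak k};X)$ are semisimple for all $q$, then $\psi_X$ is an isomorphism for all $p,q\geq 0$. 4. For $p_1,q_1,p_2,q_2\ge 0$, $e\in E_2^{p_1q_1}(M)$ and $e'\in E_2^{p_2q_2}(N)$, $$\psi_P(e\cup e')=(-1)^{p_2q_1}\,\psi_M(e)\cup\psi_N(e').$$ -/

import Mathlib

open scoped TensorProduct

namespace RelLie

section Cochains

variable {F : Type*} [Field F] {L : Type*} [LieRing L] [LieAlgebra F L]
  {V : Type*} [AddCommGroup V] [Module F V]

/-- For endomorphisms `D` of `L` and `A` of `V`, the operator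
`f ↦ A ∘ f - ∑ i, f (…, D xᵢ, …)` on alternating `n`-linear maps `L × ⋯ × L → V`. -/
def twist (D : L →ₗ[F] L) (A : V →ₗ[F] V) {n : ℕ} :
    (L [⋀^Fin n]→ₗ[F] V) →ₗ[F] (L [⋀^Fin n]→ₗ[F] V) where
  toFun f :=
    { A.compMultilinearMap f.toMultilinearMap -
        ∑ i, f.toMultilinearMap.compLinearMap
          (Function.update (fun _ => LinearMap.id) i D) with
      map_eq_zero_of_eq' := by
        intro v i j hv hij
        have key : ∀ k, (fun l => (Function.update (fun _ => (LinearMap.id : L →ₗ[F] L)) k D) l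
            (v l)) = Function.update v k (D (v k)) := by
          intro k; ext l; by_cases h : l = k
          · subst h; simp
          · simp [h]
        simp only [MultilinearMap.toFun_eq_coe, sub_apply,
          LinearMap.compMultilinearMap_apply, sum_apply,
          MultilinearMap.compLinearMap_apply, key, AlternatingMap.coe_multilinearMap]
        rw [f.map_eq_zero_of_eq v hv hij, map_zero, zero_sub, neg_eq_zero,
          Finset.sum_eq_add_of_mem i j (Finset.mem_univ _) (Finset.mem_univ _) hij]
        · have : Function.update v j (D (v j)) =
              Function.update v i (D (v i)) ∘ Equiv.swap i j := by
            ext l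
            by_cases h1 : l = i
            · subst h1; simp [hij, hij.symm, hv]
            · by_cases h2 : l = j
              · subst h2; simp [hv]
              · simp [h1, h2, Equiv.swap_apply_of_ne_of_ne h1 h2]
          rw [this, f.map_swap _ hij, add_neg_cancel]
        · intro k _ hk
          exact f.map_eq_zero_of_eq _ (by simp [hk.1.symm, hk.2.symm, hv]) hij }
  map_add' f g := by
    ext v
    simp [Finset.sum_add_distrib]
    abel
  map_smul' c f := by
    ext v
    simp [Finset.smul_sum, smul_sub]

theorem twist_apply (D : L →ₗ[F] L) (A : V →ₗ[F] V) {n : ℕ} (f : L [⋀^Fin n]→ₗ[F] V)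
    (v : Fin n → L) :
    twist D A f v = A (f v) - ∑ i, f (Function.update v i (D (v i))) := by
  have key : ∀ k, (fun l => (Function.update (fun _ => (LinearMap.id : L →ₗ[F] L)) k D) l
      (v l)) = Function.update v k (D (v k)) := by
    intro k; ext l; by_cases h : l = k
    · subst h; simp
    · simp [h]
  change (A.compMultilinearMap f.toMultilinearMap -
        ∑ i, f.toMultilinearMap.compLinearMap
          (Function.update (fun _ => LinearMap.id) i D)) v = _
  simp only [sub_apply,
          LinearMap.compMultilinearMap_apply, sum_apply,
          MultilinearMap.compLinearMap_apply, key, AlternatingMap.coe_multilinearMap]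

theorem twist_cons (D : L →ₗ[F] L) (A : V →ₗ[F] V) {n : ℕ} (f : L [⋀^Fin (n + 1)]→ₗ[F] V)
    (y : L) : (twist D A f).curryLeft y = twist D A (f.curryLeft y) - f.curryLeft (D y) := by
  ext v
  simp only [AlternatingMap.curryLeft_apply_apply, twist_apply, AlternatingMap.sub_apply,
    Fin.sum_univ_succ]
  simp only [Matrix.vecCons, Fin.cons_zero, Fin.cons_succ, Fin.update_cons_zero,
    ← Fin.cons_update]
  abel

/-- The operator `(θ_x f)(v) = x • f(v) - ∑ i, f(…, [x, vᵢ], …)` on `C^n(L; V)`, where `L` acts on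
`V` through `ρ`. -/
def theta (ρ : L →ₗ[F] Module.End F V) (x : L) {n : ℕ} :
    (L [⋀^Fin n]→ₗ[F] V) →ₗ[F] (L [⋀^Fin n]→ₗ[F] V) :=
  twist (LieAlgebra.ad F L x : L →ₗ[F] L) (ρ x)

theorem theta_apply (ρ : L →ₗ[F] Module.End F V) (x : L) {n : ℕ} (f : L [⋀^Fin n]→ₗ[F] V)
    (v : Fin n → L) :
    theta ρ x f v = ρ x (f v) - ∑ i, f (Function.update v i ⁅x, v i⁆) := by
  simp [theta, twist_apply]

/-- `θ_x f` as a linear function of `x`. -/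
def thetaLin (ρ : L →ₗ[F] Module.End F V) {n : ℕ} (f : L [⋀^Fin n]→ₗ[F] V) :
    L →ₗ[F] (L [⋀^Fin n]→ₗ[F] V) where
  toFun x := theta ρ x f
  map_add' x y := by
    ext v
    simp [theta_apply, AlternatingMap.map_update_add, Finset.sum_add_distrib]
    abel
  map_smul' c x := by
    ext v
    simp [theta_apply, AlternatingMap.map_update_smul, Finset.smul_sum, smul_sub]

/-- The alternating map `(x₀, x₁, …, xₙ) ↦ Φ(x₀)(x₁, …, xₙ)`, if `Φ x` vanishes whenever one of its
arguments is `x`. -/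
def uncurryAlt {n : ℕ} (Φ : L →ₗ[F] (L [⋀^Fin n]→ₗ[F] V))
    (h : ∀ x v i, v i = x → Φ x v = 0) : L [⋀^Fin (n + 1)]→ₗ[F] V :=
  { LinearMap.uncurryLeft (AlternatingMap.toMultilinearMapLM (S := F) ∘ₗ Φ) with
    map_eq_zero_of_eq' := by
      intro v i j hv hij
      change Φ (v 0) (Fin.tail v) = 0
      induction i using Fin.cases with
      | zero =>
        induction j using Fin.cases with
        | zero => exact absurd rfl hij
        | succ j => exact h _ _ j hv.symm
      | succ i =>
        induction j using Fin.cases with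
        | zero => exact h _ _ i hv
        | succ j => exact (Φ (v 0)).map_eq_zero_of_eq _ hv (fun e => hij (by rw [e])) }

theorem uncurryAlt_apply {n : ℕ} (Φ : L →ₗ[F] (L [⋀^Fin n]→ₗ[F] V))
    (h : ∀ x v i, v i = x → Φ x v = 0) (v : Fin (n + 1) → L) :
    uncurryAlt Φ h v = Φ (v 0) (Fin.tail v) := rfl


/-- The differential of Lie algebra cohomology, by recursion on the degree through
`i_x (d f) = θ_x f - d (i_x f)`; the property carried along makes `d f` alternating.
The usual explicit formula is `d_apply` (and `d_apply_zero` in degree `0`). -/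
def dAux (ρ : L →ₗ[F] Module.End F V) : (n : ℕ) →
    {T : (L [⋀^Fin n]→ₗ[F] V) →ₗ[F] (L [⋀^Fin (n + 1)]→ₗ[F] V) //
      ∀ g x, (∀ v i, v i = x → g v = 0) → ∀ w, T g (Matrix.vecCons x w) = theta ρ x g w}
  | 0 =>
    ⟨{ toFun := fun f => uncurryAlt (thetaLin ρ f) (fun _ _ i => i.elim0)
       map_add' := fun f g => by
        ext v; simp [uncurryAlt_apply, thetaLin]
       map_smul' := fun c f => by
        ext v; simp [uncurryAlt_apply, thetaLin] }, fun g x _ w => by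
        simp [uncurryAlt_apply, thetaLin, Matrix.vecCons]⟩
  | n + 1 =>
    ⟨{ toFun := fun f => uncurryAlt (thetaLin ρ f - (dAux ρ n).1 ∘ₗ f.curryLeft) (by
        intro x v i hv
        have hσ : ∃ w, v ∘ Equiv.swap 0 i = Matrix.vecCons x w :=
          ⟨Fin.tail (v ∘ Equiv.swap 0 i), by
            rw [← hv]
            have : v i = (v ∘ Equiv.swap 0 i) 0 := by simp
            rw [this]
            exact (Fin.cons_self_tail _).symm⟩
        obtain ⟨w, hw⟩ := hσ
        have h1 : (thetaLin ρ f - (dAux ρ n).1 ∘ₗ f.curryLeft) x (v ∘ Equiv.swap 0 i) = 0 := by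
          rw [hw]
          have e1 := congrArg (fun g => g w)
            (twist_cons (LieAlgebra.ad F L x : L →ₗ[F] L) (ρ x) f x)
          have e2 := (dAux ρ n).2 (f.curryLeft x) x (by
            intro u j hu
            exact f.map_eq_zero_of_eq (Matrix.vecCons x u) (i := 0) (j := j.succ)
              (by simp [hu]) (Fin.succ_ne_zero j).symm) w
          simp only [AlternatingMap.curryLeft_apply_apply, AlternatingMap.sub_apply] at e1
          change theta ρ x f (Matrix.vecCons x w) - (dAux ρ n).1 (f.curryLeft x)
            (Matrix.vecCons x w) = 0
          rw [e2]
          simp only [theta] at e1 ⊢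
          rw [e1]
          simpa using f.map_coord_zero (m := Matrix.vecCons 0 w) 0 rfl
        rw [AlternatingMap.map_perm] at h1
        rcases Int.units_eq_one_or (Equiv.Perm.sign (Equiv.swap 0 i)) with h | h
        · rwa [h, one_smul] at h1
        · rwa [h, Units.neg_smul, one_smul, neg_eq_zero] at h1)
       map_add' := fun f g => by
        ext v; simp [uncurryAlt_apply, thetaLin]; abel
       map_smul' := fun c f => by
        ext v; simp [uncurryAlt_apply, thetaLin, smul_sub] }, fun g x hg w => by
        have : g.curryLeft x = 0 := by
          ext u
          exact hg _ 0 (by simp)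
        simp [uncurryAlt_apply, thetaLin, Matrix.vecCons, Fin.tail_cons]
        simp only [this, map_zero, AlternatingMap.zero_apply]⟩

/-- The Lie algebra cohomology differential `d : C^n(L; V) → C^{n+1}(L; V)`; see `d_apply_zero` and
`d_apply` for the explicit formula. -/
def d (ρ : L →ₗ[F] Module.End F V) {n : ℕ} :
    (L [⋀^Fin n]→ₗ[F] V) →ₗ[F] (L [⋀^Fin (n + 1)]→ₗ[F] V) :=
  (dAux ρ n).1

theorem d_zero_cons (ρ : L →ₗ[F] Module.End F V) (f : L [⋀^Fin 0]→ₗ[F] V) (x : L) :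
    (d ρ f).curryLeft x = theta ρ x f := rfl

theorem d_cons (ρ : L →ₗ[F] Module.End F V) {n : ℕ} (f : L [⋀^Fin (n + 1)]→ₗ[F] V) (x : L) :
    (d ρ f).curryLeft x = theta ρ x f - d ρ (f.curryLeft x) := rfl

theorem map_update_eq {n : ℕ} (f : L [⋀^Fin (n + 1)]→ₗ[F] V) (w : Fin (n + 1) → L)
    (k : Fin (n + 1)) (y : L) :
    f (Function.update w k y) = (-1 : ℤ) ^ (k : ℕ) • f (Matrix.vecCons y (w ∘ k.succAbove)) := by
  rw [← Fin.insertNth_removeNth, AlternatingMap.map_insertNth]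
  rfl

/-- The differential in degree `0`. -/
theorem d_apply_zero (ρ : L →ₗ[F] Module.End F V) (f : L [⋀^Fin 0]→ₗ[F] V) (v : Fin 1 → L) :
    d ρ f v = ρ (v 0) (f ![]) := by
  have := congrArg (fun g => g (Fin.tail v)) (d_zero_cons ρ f (v 0))
  simp only [AlternatingMap.curryLeft_apply_apply, theta_apply, Matrix.vecCons,
    Fin.cons_self_tail] at this
  rw [this]
  simp
  congr!

/-- The explicit formula
`(d f)(v₀, …, v_m) = ∑ i, (-1)^i vᵢ • f(…, v̂ᵢ, …)
  + ∑_{i < j} (-1)^{i+j} f([vᵢ, vⱼ], …, v̂ᵢ, …, v̂ⱼ, …)`. -/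
theorem d_apply (ρ : L →ₗ[F] Module.End F V) {n : ℕ} (f : L [⋀^Fin (n + 1)]→ₗ[F] V)
    (v : Fin (n + 2) → L) :
    d ρ f v =
      ∑ i : Fin (n + 2), (-1 : ℤ) ^ (i : ℕ) • ρ (v i) (f (v ∘ i.succAbove)) +
      ∑ j : Fin (n + 2), ∑ i : Fin (n + 1), if i.castSucc < j then
        (-1 : ℤ) ^ ((i : ℕ) + j) •
          f (Matrix.vecCons ⁅v i.castSucc, v j⁆ (v ∘ j.succAbove ∘ i.succAbove)) else 0 := by
  induction n with
  | zero =>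
    have := congrArg (fun g => g (Fin.tail v)) (d_cons ρ f (v 0))
    simp only [AlternatingMap.curryLeft_apply_apply, AlternatingMap.sub_apply, d_apply_zero,
      theta_apply, Matrix.vecCons, Fin.cons_self_tail, map_update_eq] at this
    rw [this]
    have e1 : (Fin.tail v ∘ Fin.succ : Fin 0 → L) = v ∘ Fin.succAbove 1 ∘ Fin.succ := by
      ext l; exact l.elim0
    have e2 : (![v 0] : Fin 1 → L) = v ∘ Fin.succAbove 1 := by
      ext l; fin_cases l; rfl
    have e3 : (Fin.tail v : Fin 1 → L) = v ∘ Fin.succ := rfl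
    simp [Fin.sum_univ_succ, e1, e2]
    simp only [e3, Matrix.vecCons]
    simp only [Function.comp_apply, Fin.succ_zero_eq_one]
    abel
  | succ n ih =>
    obtain ⟨x, w, rfl⟩ : ∃ x w, v = Matrix.vecCons x w :=
      ⟨v 0, Fin.tail v, (Fin.cons_self_tail v).symm⟩
    have := congrArg (fun g => g w) (d_cons ρ f x)
    simp only [AlternatingMap.curryLeft_apply_apply, AlternatingMap.sub_apply, ih,
      theta_apply, map_update_eq] at this
    rw [this, Fin.sum_univ_succ (n := n + 2), Fin.sum_univ_succ (n := n + 2) (f := fun j => ∑ i : Fin (n + 2), _)]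
    simp only [Fin.sum_univ_succ (n := n + 1) (f := fun i => ite _ _ _)]
    have h1 : ∀ i : Fin (n + 2), Matrix.vecCons x w ∘ (Fin.succ i).succAbove =
      Matrix.vecCons x (w ∘ i.succAbove) := by
      intro i; ext l
      induction l using Fin.cases <;> simp
    have h2 : ∀ i : Fin (n + 2), Matrix.vecCons x w ∘ (Fin.succ i).succAbove ∘ Fin.succ =
      w ∘ i.succAbove := by
      intro i; ext l; simp
    have h3 : ∀ (j : Fin (n + 2)) (i : Fin (n + 1)),
        Matrix.vecCons x w ∘ (Fin.succ j).succAbove ∘ (Fin.succ i).succAbove =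
        Matrix.vecCons x (w ∘ j.succAbove ∘ i.succAbove) := by
      intro j i; ext l
      induction l using Fin.cases <;> simp
    have h4 : ∀ (y : L) (u : Fin n → L), f (Matrix.vecCons y (Matrix.vecCons x u)) =
        - f (Matrix.vecCons x (Matrix.vecCons y u)) := by
      intro y u
      rw [← f.map_swap (Matrix.vecCons x (Matrix.vecCons y u)) (i := 0) (j := 1) (by simp)]
      congr 1
      ext l
      induction l using Fin.cases with
      | zero => simp
      | succ l =>
        induction l using Fin.cases with
        | zero => simp
        | succ l =>
          rw [Function.comp_apply, Equiv.swap_apply_of_ne_of_ne (by simp)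
            (by simp [Fin.ext_iff])]
          simp
    simp only [h1, h2, h3, h4, Matrix.cons_val_zero, Matrix.cons_val_succ,
      Fin.val_zero, pow_zero, one_smul, Fin.val_succ, Fin.castSucc_zero, Fin.succ_pos, if_true,
      Fin.succAbove_zero, zero_add, Fin.castSucc_succ, Fin.succ_lt_succ_iff,
      Finset.sum_add_distrib, Fin.not_lt_zero, if_false,
      Finset.sum_const_zero, smul_neg]
    have h5 : Matrix.vecCons x w ∘ Fin.succ = w := by ext l; simp
    have h6 : ∀ a b : ℕ, (-1 : ℤ) ^ (a + 1 + (b + 1)) = (-1) ^ (a + b) := fun a b => by ring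
    have h7 : ∀ (p : Prop) [Decidable p] (m : V), (if p then - m else 0) = - (if p then m else 0) :=
      fun p _ m => by split_ifs <;> simp
    simp only [h5, h6, h7, pow_succ, mul_neg, mul_one, neg_smul, Finset.sum_neg_distrib]
    abel

theorem curryLeft_ext {n : ℕ} {f g : L [⋀^Fin (n + 1)]→ₗ[F] V}
    (h : ∀ x, f.curryLeft x = g.curryLeft x) : f = g := by
  ext v
  have := congrArg (fun u => u (Fin.tail v)) (h (v 0))
  simpa [Matrix.vecCons] using this

/-- `D` is a derivation of `L`, and `A` is compatible with it along `ρ`. -/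
structure IsCompatible (ρ : L →ₗ[F] Module.End F V) (D : L →ₗ[F] L) (A : V →ₗ[F] V) :
    Prop where
  lie : ∀ x y, D ⁅x, y⁆ = ⁅D x, y⁆ + ⁅x, D y⁆
  act : ∀ x v, A (ρ x v) = ρ x (A v) + ρ (D x) v

theorem twist_theta {ρ : L →ₗ[F] Module.End F V} {D : L →ₗ[F] L} {A : V →ₗ[F] V}
    (h : IsCompatible ρ D A) (y : L) {n : ℕ} (f : L [⋀^Fin n]→ₗ[F] V) :
    twist D A (theta ρ y f) = theta ρ y (twist D A f) + theta ρ (D y) f := by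
  induction n with
  | zero => ext v; simp [twist_apply, theta_apply, h.act]
  | succ n ih =>
    have c : ∀ (u z : L) (g : L [⋀^Fin (n + 1)]→ₗ[F] V), (theta ρ u g).curryLeft z =
        theta ρ u (g.curryLeft z) - g.curryLeft ⁅u, z⁆ := fun u z g => twist_cons _ _ g z
    refine curryLeft_ext fun z => ?_
    rw [AlternatingMap.curryLeft_add, LinearMap.add_apply]
    simp only [twist_cons, c, map_sub, ih, h.lie, map_add]
    abel

theorem twist_d {ρ : L →ₗ[F] Module.End F V} {D : L →ₗ[F] L} {A : V →ₗ[F] V}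
    (h : IsCompatible ρ D A) {n : ℕ} (f : L [⋀^Fin n]→ₗ[F] V) :
    twist D A (d ρ f) = d ρ (twist D A f) := by
  induction n with
  | zero =>
    refine curryLeft_ext fun z => ?_
    simp only [twist_cons, d_zero_cons, twist_theta h]
    abel
  | succ n ih =>
    refine curryLeft_ext fun z => ?_
    simp only [twist_cons, d_cons, map_sub, twist_theta h, ih]
    abel

theorem d_d (ρ : L →ₗ[F] Module.End F V) (h : ∀ x y v, ρ ⁅x, y⁆ v = ρ x (ρ y v) - ρ y (ρ x v))
    {n : ℕ} (f : L [⋀^Fin n]→ₗ[F] V) : d ρ (d ρ f) = 0 := by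
  have hc : ∀ x, IsCompatible ρ (LieAlgebra.ad F L x : L →ₗ[F] L) (ρ x) := fun x =>
    ⟨fun y z => by simp, fun y v => by simp [h]⟩
  induction n with
  | zero =>
    refine curryLeft_ext fun z => ?_
    rw [d_cons, d_zero_cons]
    exact sub_eq_zero.2 (twist_d (hc z) f)
  | succ n ih =>
    refine curryLeft_ext fun z => ?_
    rw [d_cons, d_cons, map_sub, ih, sub_zero]
    exact sub_eq_zero.2 (twist_d (hc z) f)

/-- The relative cochains `C^n(L, K; V)`: the alternating maps that vanish as soon as one argument is
in `K`, and that are annihilated by `θ_x` for all `x` in `K`. -/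
def relCochains (K : LieSubalgebra F L) (ρ : L →ₗ[F] Module.End F V) (n : ℕ) :
    Submodule F (L [⋀^Fin n]→ₗ[F] V) where
  carrier := {f | (∀ v i, v i ∈ K → f v = 0) ∧ ∀ x ∈ K, theta ρ x f = 0}
  add_mem' {f g} hf hg := ⟨fun v i h => by simp [hf.1 v i h, hg.1 v i h],
    fun x h => by simp [hf.2 x h, hg.2 x h]⟩
  zero_mem' := ⟨fun _ _ _ => rfl, fun _ _ => map_zero _⟩
  smul_mem' c f hf := ⟨fun v i h => by simp [hf.1 v i h], fun x h => by simp [hf.2 x h]⟩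

/-- The relative cocycles `Z^n(L, K; V)`. -/
def cocycles (K : LieSubalgebra F L) (ρ : L →ₗ[F] Module.End F V) (n : ℕ) :
    Submodule F (L [⋀^Fin n]→ₗ[F] V) :=
  relCochains K ρ n ⊓ LinearMap.ker (d ρ)

/-- The relative coboundaries `B^n(L, K; V) = d C^{n-1}(L, K; V)`, with `B^0 = 0`. -/
def coboundaries (K : LieSubalgebra F L) (ρ : L →ₗ[F] Module.End F V) :
    (n : ℕ) → Submodule F (L [⋀^Fin n]→ₗ[F] V)
  | 0 => ⊥
  | n + 1 => (relCochains K ρ n).map (d ρ)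

/-- The relative cohomology `H^n(L, K; V) = Z^n(L, K; V) / B^n(L, K; V)`. -/
abbrev Cohomology (K : LieSubalgebra F L) (ρ : L →ₗ[F] Module.End F V) (n : ℕ) : Type _ :=
  cocycles K ρ n ⧸ (coboundaries K ρ n).submoduleOf (cocycles K ρ n)

/-- The cohomology class of a cocycle. -/
abbrev Cohomology.mk (K : LieSubalgebra F L) (ρ : L →ₗ[F] Module.End F V) {n : ℕ}
    (c : cocycles K ρ n) : Cohomology K ρ n :=
  Submodule.Quotient.mk c

/-- The cup product of alternating maps with respect to `τ : V ⊗ W → U`: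
`(a ∪ b)(x₁, …, xₙ) = ∑ σ, sgn σ • τ (a(x_{σ 1}, …, x_{σ p}) ⊗ b(x_{σ(p+1)}, …, x_{σ n}))`,
summed over the `(p, q)`-shuffles, where `n = p + q`. -/
noncomputable def cup {W U : Type*} [AddCommGroup W] [Module F W] [AddCommGroup U] [Module F U]
    (τ : V ⊗[F] W →ₗ[F] U) {p q n : ℕ} (h : p + q = n) (a : L [⋀^Fin p]→ₗ[F] V)
    (b : L [⋀^Fin q]→ₗ[F] W) : L [⋀^Fin n]→ₗ[F] U :=
  (τ.compAlternatingMap (a.domCoprod b)).domDomCongr (finSumFinEquiv.trans (finCongr h))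

/-- `β` is the cup product `H^p(L, K; V) ⊗ H^q(L, K; W) → H^{p+q}(L, K; U)` induced by `τ`: the cup
product of two relative cocycles is a relative cocycle, and `β` sends `[a] ⊗ [b]` to `[a ∪ b]`. -/
def IsCupProduct {W U : Type*} [AddCommGroup W] [Module F W] [AddCommGroup U] [Module F U]
    (K : LieSubalgebra F L) (ρV : L →ₗ[F] Module.End F V) (ρW : L →ₗ[F] Module.End F W)
    (ρU : L →ₗ[F] Module.End F U) (τ : V ⊗[F] W →ₗ[F] U)
    (β : ∀ p q, Cohomology K ρV p ⊗[F] Cohomology K ρW q →ₗ[F] Cohomology K ρU (p + q)) : Prop :=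
  ∀ p q (a : cocycles K ρV p) (b : cocycles K ρW q), ∃ c : cocycles K ρU (p + q),
    c.1 = cup τ rfl a.1 b.1 ∧
      β p q (Cohomology.mk K ρV a ⊗ₜ Cohomology.mk K ρW b) = Cohomology.mk K ρU c

end Cochains

section Triple

variable {F : Type*} [Field F] {g : Type*} [LieRing g] [LieAlgebra F g]

/-- `k` is reductive in `g`: if `U ⊆ V` are `k`-submodules of `g`, then `U` has a `k`-invariant
complement in `V`. -/
def IsReductiveIn (k : LieSubalgebra F g) : Prop :=
  ∀ U V : LieSubmodule F k g, U ≤ V → ∃ U' : LieSubmodule F k g, U ⊓ U' = ⊥ ∧ U ⊔ U' = V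

/-- A `k`-submodule `J` of `g` with `g = I ⊕ J` and `k = (I ∩ k) ⊕ (J ∩ k)`. -/
structure Splitting (I : LieIdeal F g) (k : LieSubalgebra F g) where
  J : LieSubmodule F k g
  isCompl : IsCompl I.toSubmodule J.toSubmodule
  le_sup : k.toSubmodule ≤ (I.toSubmodule ⊓ k.toSubmodule) ⊔ (J.toSubmodule ⊓ k.toSubmodule)

/-- If `k` is reductive in `g`, such a `J` exists for every ideal `I`. -/
theorem IsReductiveIn.nonempty_splitting {k : LieSubalgebra F g} (hk : IsReductiveIn k)
    (I : LieIdeal F g) : Nonempty (Splitting I k) := by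
  let I' : LieSubmodule F k g :=
    { I.toSubmodule with lie_mem := fun {x m} hm => lie_mem_right F g I (x : g) m hm }
  let k' : LieSubmodule F k g := k.toLieSubmodule
  obtain ⟨Jk, h1, h2⟩ := hk (I' ⊓ k') k' inf_le_right
  obtain ⟨JL, h3, h4⟩ := hk (I' ⊔ k') ⊤ le_top
  have hJk : Jk ≤ k' := h2 ▸ le_sup_right
  refine ⟨⟨Jk ⊔ JL, ?_, ?_⟩⟩
  · have hd : I' ⊓ (Jk ⊔ JL) = ⊥ := by
      rw [eq_bot_iff]
      intro x hx
      rw [LieSubmodule.mem_inf] at hx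
      obtain ⟨hxI, hx⟩ := hx
      obtain ⟨a, ha, b, hb, rfl⟩ := (LieSubmodule.mem_sup _ _ _).1 hx
      have hb0 : b ∈ (I' ⊔ k') ⊓ JL := by
        refine ⟨?_, hb⟩
        have : b = (a + b) - a := by abel
        rw [this]
        exact sub_mem ((le_sup_left : I' ≤ I' ⊔ k') hxI) ((le_sup_right : k' ≤ I' ⊔ k') (hJk ha))
      rw [h3] at hb0
      have hb0' : b = 0 := by simpa using hb0
      subst hb0'
      rw [add_zero] at hxI ⊢
      rw [← h1]
      exact ⟨⟨hxI, hJk ha⟩, ha⟩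
    have hs : I' ⊔ (Jk ⊔ JL) = ⊤ := by
      rw [eq_top_iff, ← h4]
      refine sup_le (sup_le le_sup_left ?_) (le_sup_right.trans le_sup_right)
      rw [← h2]
      exact sup_le (inf_le_left.trans le_sup_left) (le_sup_left.trans le_sup_right)
    refine ⟨?_, ?_⟩
    · rw [disjoint_iff]
      have := congrArg LieSubmodule.toSubmodule hd
      simpa using this
    · rw [codisjoint_iff]
      have := congrArg LieSubmodule.toSubmodule hs
      simpa using this
  · intro x hx
    have hx' : x ∈ (I' ⊓ k') ⊔ Jk := by rw [h2]; exact hx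
    obtain ⟨a, ha, b, hb, rfl⟩ := (LieSubmodule.mem_sup _ _ _).1 hx'
    exact Submodule.add_mem_sup ⟨ha.1, ha.2⟩
      ⟨(le_sup_left : Jk ≤ Jk ⊔ JL) hb, hJk hb⟩

variable (M : Type*) [AddCommGroup M] [Module F M] [LieRingModule g M] [LieModule F g M]

/-- The subalgebra `I_k = I ∩ k` of `I`. -/
abbrev subI (I : LieIdeal F g) (k : LieSubalgebra F g) : LieSubalgebra F I := k.comap I.incl

/-- The projection `g → g/I`. -/
def quotHom (I : LieIdeal F g) : g →ₗ⁅F⁆ g ⧸ I :=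
  { I.toSubmodule.mkQ with map_lie' := fun {_ _} => rfl }

/-- The subalgebra `k/I_k` of `g/I`, that is, the image of `k`. -/
abbrev subQuot (I : LieIdeal F g) (k : LieSubalgebra F g) : LieSubalgebra F (g ⧸ I) :=
  k.map (quotHom I)

/-- The action of `L` on an `L`-module, as a linear map. -/
abbrev rep (F : Type*) [Field F] (L : Type*) [LieRing L] [LieAlgebra F L] (M : Type*)
    [AddCommGroup M] [Module F M] [LieRingModule L M] [LieModule F L M] :
    L →ₗ[F] Module.End F M :=
  (LieModule.toEnd F L M : L →ₗ[F] Module.End F M)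

/-- The operator `θ_x` on `C^n(I; M)`, for `x` in `g`. -/
def thetaI (I : LieIdeal F g) (x : g) {n : ℕ} :
    (I [⋀^Fin n]→ₗ[F] M) →ₗ[F] (I [⋀^Fin n]→ₗ[F] M) :=
  twist (LieModule.toEnd F g I x : I →ₗ[F] I) (LieModule.toEnd F g M x)

theorem isCompatible_I (I : LieIdeal F g) (x : g) :
    IsCompatible (rep F I M) (LieModule.toEnd F g I x : I →ₗ[F] I) (LieModule.toEnd F g M x) where
  lie u v := by
    ext
    simp
  act u m := by
    simp

theorem thetaI_add (I : LieIdeal F g) (x y : g) {n : ℕ} (f : I [⋀^Fin n]→ₗ[F] M) :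
    thetaI M I (x + y) f = thetaI M I x f + thetaI M I y f := by
  ext v
  simp [thetaI, twist_apply, AlternatingMap.map_update_add, Finset.sum_add_distrib]
  abel

theorem thetaI_smul (I : LieIdeal F g) (c : F) (x : g) {n : ℕ} (f : I [⋀^Fin n]→ₗ[F] M) :
    thetaI M I (c • x) f = c • thetaI M I x f := by
  ext v
  simp [thetaI, twist_apply, AlternatingMap.map_update_smul, Finset.smul_sum, smul_sub]

variable {I : LieIdeal F g} {k : LieSubalgebra F g}

theorem Splitting.lie_eq_zero (S : Splitting I k) {x y : g} (hx : x ∈ S.J) (hyI : y ∈ I)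
    (hyk : y ∈ k) : ⁅x, y⁆ = 0 := by
  have h1 : ⁅x, y⁆ ∈ I := lie_mem_right F g I x y hyI
  have h2 : ⁅x, y⁆ ∈ S.J := by
    rw [← lie_skew]
    exact neg_mem (S.J.lie_mem (x := (⟨y, hyk⟩ : k)) hx)
  exact (Submodule.disjoint_def.1 S.isCompl.disjoint) _ h1 h2

theorem Splitting.thetaI_mem_relCochains (S : Splitting I k) {x : g} (hx : x ∈ S.J) {n : ℕ}
    {f : I [⋀^Fin n]→ₗ[F] M} (hf : f ∈ relCochains (subI I k) (rep F I M) n) :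
    thetaI M I x f ∈ relCochains (subI I k) (rep F I M) n := by
  have h0 : ∀ y : I, y ∈ subI I k → (LieModule.toEnd F g I x : I →ₗ[F] I) y = 0 := by
    intro y hy
    ext
    exact S.lie_eq_zero hx y.2 hy
  refine ⟨fun v i hi => ?_, fun y hy => ?_⟩
  · rw [thetaI, twist_apply, hf.1 v i hi, map_zero, zero_sub, neg_eq_zero]
    refine Finset.sum_eq_zero fun j _ => ?_
    by_cases h : j = i
    · subst h
      rw [h0 _ hi]
      exact f.map_update_zero v j
    · exact hf.1 _ i (by rwa [Function.update_of_ne (Ne.symm h)])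
  · have h := twist_theta (isCompatible_I M I x) y f
    rw [hf.2 y hy, map_zero, h0 y hy] at h
    have h' : theta (rep F I M) (0 : I) f = 0 := by
      ext v
      simp [theta_apply]
    rw [h', add_zero] at h
    exact h.symm

theorem Splitting.thetaI_mem_cocycles (S : Splitting I k) {x : g} (hx : x ∈ S.J) {n : ℕ}
    {f : I [⋀^Fin n]→ₗ[F] M} (hf : f ∈ cocycles (subI I k) (rep F I M) n) :
    thetaI M I x f ∈ cocycles (subI I k) (rep F I M) n := by
  refine ⟨S.thetaI_mem_relCochains M hx hf.1, ?_⟩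
  have h := twist_d (isCompatible_I M I x) f
  rw [LinearMap.mem_ker.1 hf.2, map_zero] at h
  exact h.symm

theorem Splitting.thetaI_mem_coboundaries (S : Splitting I k) {x : g} (hx : x ∈ S.J) {n : ℕ}
    {f : I [⋀^Fin n]→ₗ[F] M} (hf : f ∈ coboundaries (subI I k) (rep F I M) n) :
    thetaI M I x f ∈ coboundaries (subI I k) (rep F I M) n := by
  cases n with
  | zero =>
    rw [show f = 0 from hf, map_zero]
    exact Submodule.zero_mem _
  | succ n =>
    obtain ⟨e, he, rfl⟩ := hf
    exact ⟨thetaI M I x e, S.thetaI_mem_relCochains M hx he,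
      (twist_d (isCompatible_I M I x) e).symm⟩

/-- The projection `x ↦ x^+` of `g` onto `J` along `I`, as a map on `g/I`. -/
noncomputable def Splitting.plus (S : Splitting I k) : (g ⧸ I) →ₗ[F] S.J.toSubmodule :=
  (Submodule.quotientEquivOfIsCompl I.toSubmodule S.J.toSubmodule S.isCompl).toLinearMap

/-- The action of `g/I` on `H^q(I, I_k; M)`: `x • [c] = [θ_{x^+} c]`. -/
noncomputable def Splitting.action (S : Splitting I k) (q : ℕ) :
    (g ⧸ I) →ₗ[F] Module.End F (Cohomology (subI I k) (rep F I M) q) where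
  toFun x := Submodule.mapQ _ _
    ((thetaI M I (S.plus x : g)).restrict fun _ hf => S.thetaI_mem_cocycles M (S.plus x).2 hf)
    (fun _ hf => S.thetaI_mem_coboundaries M (S.plus x).2 hf)
  map_add' x y := by
    refine Submodule.linearMap_qext _ (LinearMap.ext fun c => ?_)
    refine congrArg (Submodule.Quotient.mk (p := (coboundaries (subI I k) (rep F I M) q).submoduleOf
      (cocycles (subI I k) (rep F I M) q))) (Subtype.ext ?_)
    simp [thetaI_add]
  map_smul' a x := by
    refine Submodule.linearMap_qext _ (LinearMap.ext fun c => ?_)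
    refine congrArg (Submodule.Quotient.mk (p := (coboundaries (subI I k) (rep F I M) q).submoduleOf
      (cocycles (subI I k) (rep F I M) q))) (Subtype.ext ?_)
    simp [thetaI_smul]

/-- The space `H^p(g/I, k/I_k; H^q(I, I_k; M))`. -/
abbrev Splitting.IterCohomology (S : Splitting I k) (p q : ℕ) : Type _ :=
  Cohomology (subQuot I k) (S.action M q) p

variable (I k)

/-- The filtration `F_p C^n(g; M)`: the cochains that vanish when `n - p + 1` of the arguments are in
`I`. It is everything if `p ≤ 0`, and zero if `p > n`. -/
def fil (p : ℤ) (n : ℕ) : Submodule F (g [⋀^Fin n]→ₗ[F] M) where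
  carrier := {f | ∀ (v : Fin n → g) (s : Finset (Fin n)), (∀ i ∈ s, v i ∈ I) →
    (n : ℤ) - p + 1 ≤ s.card → f v = 0}
  add_mem' {f f'} hf hf' v s hs hc := by simp [hf v s hs hc, hf' v s hs hc]
  zero_mem' _ _ _ _ := rfl
  smul_mem' c f hf v s hs hc := by simp [hf v s hs hc]

/-- The filtration `F_p C^n = C^n(g, k; M) ∩ F_p C^n(g; M)` of the relative cochains. -/
def filRel (p : ℤ) (n : ℕ) : Submodule F (g [⋀^Fin n]→ₗ[F] M) :=
  relCochains k (rep F g M) n ⊓ fil M I p n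

/-- `F_p C^n(r) = {c ∈ F_p C^n | d c ∈ F_{p+r} C^{n+1}}`. -/
def filRelD (r p : ℤ) (n : ℕ) : Submodule F (g [⋀^Fin n]→ₗ[F] M) :=
  filRel M I k p n ⊓ (filRel M I k (p + r) (n + 1)).comap (d (rep F g M))

/-- The subspace `d F_p C^{n-1}(r)` of `C^n`, which is zero if `n = 0`. -/
def filRelB (r p : ℤ) : (n : ℕ) → Submodule F (g [⋀^Fin n]→ₗ[F] M)
  | 0 => ⊥
  | n + 1 => (filRelD M I k r p n).map (d (rep F g M))

/-- `F_{p+1} C^n(r-1) + d F_{p-r+1} C^{n-1}(r-1)`. -/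
def pageDenom (r p : ℤ) (n : ℕ) : Submodule F (g [⋀^Fin n]→ₗ[F] M) :=
  filRelD M I k (r - 1) (p + 1) n ⊔ filRelB M I k (r - 1) (p - r + 1) n

/-- The page `E_r^{p, n-p}` of the relative Hochschild–Serre spectral sequence, as the quotient of
`F_p C^n(r)` by `F_{p+1} C^n(r-1) + d F_{p-r+1} C^{n-1}(r-1)`. It is indexed by the filtration degree
`p` and the total degree `n`. -/
abbrev Page (r : ℕ) (p : ℤ) (n : ℕ) : Type _ :=
  filRelD M I k r p n ⧸ (pageDenom M I k r p n).submoduleOf (filRelD M I k r p n)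

/-- The class in the page `E_r` of an element of `F_p C^n(r)`. -/
abbrev Page.mk {r : ℕ} {p : ℤ} {n : ℕ} (c : filRelD M I k r p n) : Page M I k r p n :=
  Submodule.Quotient.mk c

theorem rep_lie (x y : g) (m : M) :
    rep F g M ⁅x, y⁆ m = rep F g M x (rep F g M y m) - rep F g M y (rep F g M x m) := by
  simp

/-- The differential `d_r : E_r^{p, n-p} → E_r^{p+r, n+1-p-r}`, `[c] ↦ [d c]`. -/
def pageD (r : ℕ) (p : ℤ) (n : ℕ) : Page M I k r p n →ₗ[F] Page M I k r (p + r) (n + 1) :=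
  Submodule.mapQ _ _
    ((d (rep F g M)).restrict (p := filRelD M I k r p n) (q := filRelD M I k r (p + r) (n + 1))
      fun c hc => ⟨hc.2, by
        change d (rep F g M) (d (rep F g M) c) ∈ filRel M I k (p + r + r) (n + 1 + 1)
        rw [d_d _ (rep_lie M)]
        exact Submodule.zero_mem _⟩)
    (by
      intro c hc
      obtain ⟨a, ha, b, hb, hab⟩ := Submodule.mem_sup.1 (show c.1 ∈ pageDenom M I k r p n from hc)
      refine (show d (rep F g M) c.1 ∈ pageDenom M I k r (p + r) (n + 1) from ?_)
      have hb0 : d (rep F g M) b = 0 := by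
        cases n with
        | zero => rw [show b = 0 from hb, map_zero]
        | succ n =>
          obtain ⟨e, -, rfl⟩ := hb
          exact d_d _ (rep_lie M) e
      rw [← hab, map_add, hb0, add_zero]
      refine Submodule.mem_sup_right ⟨a, ?_, rfl⟩
      have : p + (r : ℤ) - r + 1 = p + 1 := by ring
      rwa [this])

/-- The type of a family of pairings `E_r^{p₁, n₁-p₁}(M) ⊗ E_r^{p₂, n₂-p₂}(N) → E_r^{p, n-p}(P)`, where
`p = p₁ + p₂` and `n = n₁ + n₂`. -/
abbrev PagePairing (N P : Type*) [AddCommGroup N] [Module F N] [LieRingModule g N]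
    [LieModule F g N] [AddCommGroup P] [Module F P] [LieRingModule g P] [LieModule F g P] : Type _ :=
  ∀ (r : ℕ) (p₁ : ℤ) (n₁ : ℕ) (p₂ : ℤ) (n₂ : ℕ) (p : ℤ) (n : ℕ), p₁ + p₂ = p → n₁ + n₂ = n →
    Page M I k r p₁ n₁ ⊗[F] Page N I k r p₂ n₂ →ₗ[F] Page P I k r p n

variable {M} in
/-- The pairings `β` of pages are induced by the cup product of cochains: `[a] ⊗ [b] ↦ [a ∪ b]`. -/
def IsPageCupProduct {N P : Type*} [AddCommGroup N] [Module F N] [LieRingModule g N]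
    [LieModule F g N] [AddCommGroup P] [Module F P] [LieRingModule g P] [LieModule F g P]
    (μ : M ⊗[F] N →ₗ⁅F,g⁆ P) (β : PagePairing M I k N P) : Prop :=
  ∀ (r : ℕ) (p₁ : ℤ) (n₁ : ℕ) (p₂ : ℤ) (n₂ : ℕ) (p : ℤ) (n : ℕ)
    (hp : p₁ + p₂ = p) (hn : n₁ + n₂ = n)
    (a : filRelD M I k r p₁ n₁) (b : filRelD N I k r p₂ n₂), ∃ c : filRelD P I k r p n,
      c.1 = cup (μ : M ⊗[F] N →ₗ[F] P) hn a.1 b.1 ∧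
        β r p₁ n₁ p₂ n₂ p n hp hn (Page.mk M I k a ⊗ₜ Page.mk N I k b) = Page.mk P I k c

variable {I k}

/-- `ψ` is the canonical map `E_2^{pq} → H^p(g/I, k/I_k; H^q(I, I_k; M))`: it sends the class of `c` to
the class of the cocycle `z` such that `z(x₁, …, x_p)` is the cohomology class of the cocycle
`(y₁, …, y_q) ↦ c(x₁, …, x_p, y₁, …, y_q)` on `I`. -/
def Splitting.IsPsi (S : Splitting I k)
    (ψ : ∀ p q : ℕ, Page M I k 2 p (p + q) →ₗ[F] S.IterCohomology M p q) : Prop :=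
  ∀ (p q : ℕ) (c : filRelD M I k (2 : ℕ) p (p + q)),
    ∃ z : cocycles (subQuot I k) (S.action M q) p,
      (∀ x : Fin p → g, ∃ u : cocycles (subI I k) (rep F I M) q,
        (∀ y : Fin q → I, u.1 y = c.1 (Fin.append x fun j => (y j : g))) ∧
          z.1 (fun i => quotHom I (x i)) = Cohomology.mk (subI I k) (rep F I M) u) ∧
      ψ p q (Page.mk M I k c) = Cohomology.mk (subQuot I k) (S.action M q) z

variable (I k) in
/-- For every `q`, the `k`-module `C^q(I, I_k; M)` is semisimple: every `k`-submodule has a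
`k`-invariant complement. -/
def CochainsSemisimple : Prop :=
  ∀ (q : ℕ) (U : Submodule F (I [⋀^Fin q]→ₗ[F] M)), U ≤ relCochains (subI I k) (rep F I M) q →
    (∀ x ∈ k, ∀ f ∈ U, thetaI M I x f ∈ U) →
    ∃ U' : Submodule F (I [⋀^Fin q]→ₗ[F] M), (∀ x ∈ k, ∀ f ∈ U', thetaI M I x f ∈ U') ∧
      U ⊓ U' = ⊥ ∧ U ⊔ U' = relCochains (subI I k) (rep F I M) q

end Triple
end RelLie

/-! Everything rests on the contraction i_x (`curryLeft`). An alternating map of positive degree is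
determined by its contractions (`curryLeft_ext`), the differential satisfies i_x d = θ_x - d i_x by
construction, and sorting the shuffles by the block that receives the first argument shows that i_x
is an antiderivation of the cup product (`cup_curryLeft`). Relative cochains and the filtration are
also described by contractions (`mem_relCochains_succ`, `mem_filt_succ`). So the Leibniz rule
(`d_cup`), F_i ∪ F_j ⊆ F_{i+j} (`cup_mem_filt`) and the stability of relative cochains under cup
products (`cup_mem_relCochains`) follow from contractions, the first two by induction on the degree.
The pairings of the pages, their Leibniz rule and the pairings on cohomology are then formal. Over
g/I the coefficients are H^q(I, I_k; X), on which g/I acts by derivations of the pairing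
(`IsCupProduct.action_cup`).

For ψ, a cochain of degree p + q is read as a p-form with values in the q-forms on I (`bicurry`);
restricting the first p arguments to J gives its component in C^p(g/I; C^q(I; X))
(`Splitting.comp`). On F_p this component is the leading term: its kernel is F_{p+1}. For c in F_p,
the component of dc of bidegree (p, q+1) is (-1)^p d_I of the leading term, and the one of bidegree
(p+1, q) is the differential over g/I of the leading term, up to values in the coboundaries of I. If
dc lies in F_{p+2}, the leading term therefore has cocycle values, and its class is a cocycle. The
summand F_{p+1} of the denominator has zero leading term, and the summand d F_{p-1}(1) contributes
coboundaries, so ψ is defined on E_2. The choice of J makes components of relative cochains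
relative: J is k-stable, [J, I_k] = 0, and x ↦ x^+ maps k into k.

Conversely, every relative form with values in relative cochains is the component of a relative
cochain (`Splitting.lift`). Semisimplicity gives k-equivariant sections of Z^q → H^q and of d : C^q
→ B^{q+1}, so relative forms can be lifted from classes to cocycles and from coboundaries to
cochains (`Splitting.exists_classOf_eq`, `Splitting.exists_comp_d_eq`). Bijectivity of ψ follows by
correcting a lifted cochain by lower-order terms.

The sign in the comparison of the products comes from `bicurry_cup`: in the leading term of a ∪ b
the p₂ outer arguments of b move past the q₁ inner arguments of a. -/

namespace RelLie

/-! ### Shuffles as cosets, and their recursion on the first argument -/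

section Shuffles

open Equiv

/-- A coset modulo permutations within the two blocks remembers only which points come from the left
block. This turns equality of shuffles into a pointwise check. -/
theorem modSumCongr_mk_eq_iff {α β : Type*} [Finite α] [Finite β] (σ τ : Perm (α ⊕ β)) :
    (Quotient.mk'' σ : Perm.ModSumCongr α β) = Quotient.mk'' τ ↔
      ∀ x, (σ⁻¹ x).isLeft = (τ⁻¹ x).isLeft := by
  rw [Quotient.eq'', QuotientGroup.leftRel_apply]
  constructor
  · rintro ⟨⟨s, t⟩, h⟩ x
    have : τ = σ * Perm.sumCongrHom α β (s, t) := by rw [h]; group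
    rw [this, mul_inv_rev, Perm.mul_apply, ← map_inv]
    cases σ⁻¹ x <;> simp
  · intro h
    refine Perm.mem_sumCongrHom_range_of_perm_mapsTo_inl ?_
    rintro _ ⟨a, rfl⟩
    have := h (τ (Sum.inl a))
    rw [← Perm.mul_apply τ⁻¹, inv_mul_cancel, Perm.one_apply, Sum.isLeft_inl] at this
    obtain ⟨b, hb⟩ := Sum.isLeft_iff.1 this
    exact ⟨b, by rw [Perm.mul_apply, hb]⟩

/-- The permutation of `γ ≃ Option δ` that fixes the image of `none` and restricts to `τ` on `δ`. -/
def extendPerm {δ γ : Type*} (e : Option δ ≃ γ) (τ : Perm δ) : Perm γ :=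
  e.permCongr τ.optionCongr

section extendPerm

variable {δ γ : Type*} (e : Option δ ≃ γ) (τ : Perm δ)

theorem extendPerm_none : extendPerm e τ (e none) = e none := by
  simp [extendPerm]

theorem extendPerm_some (x : δ) : extendPerm e τ (e (some x)) = e (some (τ x)) := by
  simp [extendPerm]

theorem extendPerm_inv : (extendPerm e τ)⁻¹ = extendPerm e τ⁻¹ := by
  rw [inv_eq_iff_mul_eq_one]
  ext x
  obtain ⟨y, rfl⟩ := e.surjective x
  cases y <;> simp [extendPerm_none, extendPerm_some]

theorem sign_extendPerm [DecidableEq δ] [DecidableEq γ] [Fintype δ] [Fintype γ] :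
    Perm.sign (extendPerm e τ) = Perm.sign τ := by
  simp [extendPerm]

theorem exists_extendPerm [DecidableEq δ] {σ : Perm γ} (h : σ (e none) = e none) :
    ∃ τ, extendPerm e τ = σ := by
  classical
  refine ⟨removeNone (e.symm.permCongr σ), ?_⟩
  have h' : e.symm.permCongr σ none = none := by simp [permCongr_apply, h]
  rw [extendPerm, map_equiv_removeNone, h', swap_self, ← Perm.one_def, one_mul]
  ext x
  simp

end extendPerm

variable (p q : ℕ)

/-- `Fin (p + 1) ⊕ Fin q` is `Fin p ⊕ Fin q` together with `inl 0`. -/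
def optionLeft : Option (Fin p ⊕ Fin q) ≃ Fin (p + 1) ⊕ Fin q where
  toFun x := x.elim (Sum.inl 0) (Sum.map Fin.succ id)
  invFun := Sum.elim (Fin.cases none fun i => some (Sum.inl i)) fun j => some (Sum.inr j)
  left_inv x := by rcases x with _ | (i | j) <;> simp
  right_inv x := by
    rcases x with i | j
    · induction i using Fin.cases <;> simp
    · simp

/-- `Fin p ⊕ Fin (q + 1)` is `Fin p ⊕ Fin q` together with `inr 0`. -/
def optionRight : Option (Fin p ⊕ Fin q) ≃ Fin p ⊕ Fin (q + 1) where
  toFun x := x.elim (Sum.inr 0) (Sum.map id Fin.succ)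
  invFun := Sum.elim (fun i => some (Sum.inl i)) (Fin.cases none fun j => some (Sum.inr j))
  left_inv x := by rcases x with _ | (i | j) <;> simp
  right_inv x := by
    rcases x with i | j
    · simp
    · induction j using Fin.cases <;> simp

@[simp] theorem optionLeft_none : optionLeft p q none = Sum.inl 0 := rfl
@[simp] theorem optionLeft_some (x) : optionLeft p q (some x) = Sum.map Fin.succ id x := rfl
@[simp] theorem optionRight_none : optionRight p q none = Sum.inr 0 := rfl
@[simp] theorem optionRight_some (x) : optionRight p q (some x) = Sum.map id Fin.succ x := rfl

theorem isLeft_map {α β α' β' : Type*} (f : α → α') (g : β → β') (x : α ⊕ β) :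
    (Sum.map f g x).isLeft = x.isLeft := by
  cases x <;> rfl

/-- The inclusion of the `(p, q + 1)`-shuffles into the `(p + 1, q + 1)`-shuffles, with image the
shuffles that put the first argument on the left. -/
def shuffleLeft : Perm.ModSumCongr (Fin p) (Fin (q + 1)) →
    Perm.ModSumCongr (Fin (p + 1)) (Fin (q + 1)) :=
  Quotient.map' (extendPerm (optionLeft p (q + 1))) fun σ τ h => by
    rw [← Quotient.eq'', modSumCongr_mk_eq_iff] at h
    rw [← Quotient.eq'', modSumCongr_mk_eq_iff]
    intro x
    obtain ⟨y, rfl⟩ := (optionLeft p (q + 1)).surjective x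
    cases y with
    | none => simp only [extendPerm_inv, extendPerm_none]
    | some y =>
      rw [extendPerm_inv, extendPerm_inv, extendPerm_some, extendPerm_some, optionLeft_some,
        optionLeft_some, isLeft_map, isLeft_map]
      exact h y

/-- The inclusion of the `(p + 1, q)`-shuffles into the `(p + 1, q + 1)`-shuffles, with image the
shuffles that put the first argument on the right. -/
def shuffleRight : Perm.ModSumCongr (Fin (p + 1)) (Fin q) →
    Perm.ModSumCongr (Fin (p + 1)) (Fin (q + 1)) :=
  Quotient.map' (fun τ => swap (Sum.inl 0) (Sum.inr 0) * extendPerm (optionRight (p + 1) q) τ)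
    fun σ τ h => by
    rw [← Quotient.eq'', modSumCongr_mk_eq_iff] at h
    rw [← Quotient.eq'', modSumCongr_mk_eq_iff]
    intro x
    obtain ⟨x, rfl⟩ := (swap (Sum.inl 0) (Sum.inr 0)).surjective x
    obtain ⟨y, rfl⟩ := (optionRight (p + 1) q).surjective x
    simp only [mul_inv_rev, Perm.mul_apply, swap_inv, swap_apply_self]
    cases y with
    | none => simp only [extendPerm_inv, extendPerm_none]
    | some y =>
      rw [extendPerm_inv, extendPerm_inv, extendPerm_some, extendPerm_some, optionRight_some,
        optionRight_some, isLeft_map, isLeft_map]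
      exact h y

/-- The block containing σ⁻¹(inl 0) depends only on the coset and decides between the two cases.
Within the coset, that preimage can be moved to index 0 of its block, after which σ, up to the fixed
swap in the second case, extends a permutation of the remaining points. -/
theorem shuffle_bijective :
    Function.Bijective (Sum.elim (shuffleLeft p q) (shuffleRight p q)) := by
  have key : ∀ (σ : Perm (Fin p ⊕ Fin (q + 1))) (τ : Perm (Fin (p + 1) ⊕ Fin q)),
      shuffleLeft p q (Quotient.mk'' σ) ≠ shuffleRight p q (Quotient.mk'' τ) := by
    intro σ τ h
    have := (modSumCongr_mk_eq_iff _ _).1 h (Sum.inl 0)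
    rw [mul_inv_rev, Perm.mul_apply, swap_inv, swap_apply_left, extendPerm_inv, extendPerm_inv,
      ← optionLeft_none p (q + 1), ← optionRight_none (p + 1) q, extendPerm_none,
      extendPerm_none] at this
    simp at this
  constructor
  · rintro (σ | σ) (τ | τ) h <;> induction σ using Quotient.inductionOn' <;>
      induction τ using Quotient.inductionOn' <;> simp only [Sum.elim_inl, Sum.elim_inr] at h
    · refine congrArg Sum.inl ((modSumCongr_mk_eq_iff _ _).2 fun x => ?_)
      have := (modSumCongr_mk_eq_iff _ _).1 h (optionLeft p (q + 1) (some x))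
      rwa [extendPerm_inv, extendPerm_inv, extendPerm_some, extendPerm_some, optionLeft_some,
        optionLeft_some, isLeft_map, isLeft_map] at this
    · exact absurd h (key _ _)
    · exact absurd h.symm (key _ _)
    · refine congrArg Sum.inr ((modSumCongr_mk_eq_iff _ _).2 fun x => ?_)
      have := (modSumCongr_mk_eq_iff _ _).1 h
        (swap (Sum.inl 0) (Sum.inr 0) (optionRight (p + 1) q (some x)))
      rwa [mul_inv_rev, Perm.mul_apply, mul_inv_rev, Perm.mul_apply, swap_inv, swap_apply_self,
        extendPerm_inv, extendPerm_inv, extendPerm_some, extendPerm_some, optionRight_some,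
        optionRight_some, isLeft_map, isLeft_map] at this
  · intro σ
    induction σ using Quotient.inductionOn' with | _ σ
    -- Right multiplication by a block permutation does not change the coset; below it moves the
    -- preimage of inl 0 to index 0 of its block.
    have hr : ∀ s t, (Quotient.mk'' σ : Perm.ModSumCongr (Fin (p + 1)) (Fin (q + 1))) =
        Quotient.mk'' (σ * Perm.sumCongrHom _ _ (s, t)) := fun s t =>
      Quotient.eq''.2 (QuotientGroup.leftRel_apply.2 ⟨(s, t), by group⟩)
    rcases h : σ⁻¹ (Sum.inl 0) with i | j
    · obtain ⟨τ, hτ⟩ := exists_extendPerm (optionLeft p (q + 1))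
        (σ := σ * Perm.sumCongrHom _ _ (swap 0 i, 1)) (by
          rw [Perm.inv_eq_iff_eq] at h
          simp [h])
      exact ⟨Sum.inl (Quotient.mk'' τ), by rw [hr (swap 0 i) 1, ← hτ]; rfl⟩
    · obtain ⟨τ, hτ⟩ := exists_extendPerm (optionRight (p + 1) q)
        (σ := swap (Sum.inl 0) (Sum.inr 0) * (σ * Perm.sumCongrHom _ _ (1, swap 0 j))) (by
          rw [Perm.inv_eq_iff_eq] at h
          simp [← h])
      refine ⟨Sum.inr (Quotient.mk'' τ), ?_⟩
      rw [hr 1 (swap 0 j)]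
      change Quotient.mk'' (swap (Sum.inl 0) (Sum.inr 0) * extendPerm (optionRight (p + 1) q) τ) = _
      rw [hτ, swap_mul_self_mul]

end Shuffles

/-! ### Contraction of cup products -/

section Cup

variable {F : Type*} [Field F] {L : Type*} [LieRing L] [LieAlgebra F L]
  {V W U : Type*} [AddCommGroup V] [Module F V] [AddCommGroup W] [Module F W]
  [AddCommGroup U] [Module F U]

theorem domCoprod_summand_apply {α β : Type*} [Fintype α] [Fintype β] [DecidableEq α]
    [DecidableEq β] (a : L [⋀^α]→ₗ[F] V) (b : L [⋀^β]→ₗ[F] W) (σ : Equiv.Perm (α ⊕ β))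
    (v : α ⊕ β → L) :
    AlternatingMap.domCoprod.summand a b (Quotient.mk'' σ) v =
      Equiv.Perm.sign σ • (a (v ∘ σ ∘ Sum.inl) ⊗ₜ[F] b (v ∘ σ ∘ Sum.inr)) := rfl

theorem domCoprod_apply_eq_sum {α β : Type*} [Fintype α] [Fintype β] [DecidableEq α]
    [DecidableEq β] (a : L [⋀^α]→ₗ[F] V) (b : L [⋀^β]→ₗ[F] W) (v : α ⊕ β → L) :
    a.domCoprod b v =
      ∑ σ : Equiv.Perm.ModSumCongr α β, AlternatingMap.domCoprod.summand a b σ v := by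
  rw [AlternatingMap.domCoprod_apply, sum_apply]

/-- The sum over shuffles splits along `shuffle_bijective`. The minus sign is the sign of the swap
in `shuffleRight`; the left block of the second term is not yet in increasing order, which
`cup_curryLeft` repairs. -/
theorem domCoprod_succ_succ {p q : ℕ} (a : L [⋀^Fin (p + 1)]→ₗ[F] V) (b : L [⋀^Fin (q + 1)]→ₗ[F] W)
    (v : Fin (p + 1) ⊕ Fin (q + 1) → L) :
    a.domCoprod b v =
      (a.curryLeft (v (Sum.inl 0))).domCoprod b (v ∘ Sum.map Fin.succ id) -
        a.domCoprod (b.curryLeft (v (Sum.inl 0)))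
          ((v ∘ Equiv.swap (Sum.inl 0) (Sum.inr 0)) ∘ Sum.map id Fin.succ) := by
  rw [domCoprod_apply_eq_sum, domCoprod_apply_eq_sum, domCoprod_apply_eq_sum,
    ← (shuffle_bijective p q).sum_comp, Fintype.sum_sum_type, sub_eq_add_neg,
    ← Finset.sum_neg_distrib]
  congr 1
  · refine Finset.sum_congr rfl fun σ _ => ?_
    induction σ using Quotient.inductionOn' with | _ σ
    change AlternatingMap.domCoprod.summand a b (Quotient.mk'' (extendPerm _ σ)) v = _
    rw [domCoprod_summand_apply, domCoprod_summand_apply, sign_extendPerm,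
      AlternatingMap.curryLeft_apply_apply]
    congr 1
    refine congrArg₂ (· ⊗ₜ[F] ·) (congrArg a (funext fun i => ?_)) (congrArg b (funext fun j => ?_))
    · induction i using Fin.cases with
      | zero =>
        have := extendPerm_none (optionLeft p (q + 1)) σ
        rw [optionLeft_none] at this
        simp [this]
      | succ i =>
        have := extendPerm_some (optionLeft p (q + 1)) σ (Sum.inl i)
        simp only [optionLeft_some, Sum.map_inl] at this
        simp [this]
    · have := extendPerm_some (optionLeft p (q + 1)) σ (Sum.inr j)
      simp only [optionLeft_some, Sum.map_inr, id] at this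
      simp [this]
  · refine Finset.sum_congr rfl fun σ _ => ?_
    induction σ using Quotient.inductionOn' with | _ σ
    change AlternatingMap.domCoprod.summand a b (Quotient.mk''
      (Equiv.swap (Sum.inl 0) (Sum.inr 0) * extendPerm _ σ)) v = _
    rw [domCoprod_summand_apply, domCoprod_summand_apply, map_mul, sign_extendPerm,
      Equiv.Perm.sign_swap (by simp), AlternatingMap.curryLeft_apply_apply, neg_one_mul,
      Units.neg_smul]
    congr 2
    refine congrArg₂ (· ⊗ₜ[F] ·) (congrArg a (funext fun i => ?_)) (congrArg b (funext fun i => ?_))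
    · have := extendPerm_some (optionRight (p + 1) q) σ (Sum.inl i)
      simp only [optionRight_some, Sum.map_inl, id] at this
      simp [this]
    · induction i using Fin.cases with
      | zero =>
        have := extendPerm_none (optionRight (p + 1) q) σ
        simp only [optionRight_none] at this
        simp [this]
      | succ i =>
        have := extendPerm_some (optionRight (p + 1) q) σ (Sum.inr i)
        simp only [optionRight_some, Sum.map_inr] at this
        simp [this]

theorem domCoprod_zero_left {q : ℕ} (a : L [⋀^Fin 0]→ₗ[F] V) (b : L [⋀^Fin q]→ₗ[F] W)
    (v : Fin 0 ⊕ Fin q → L) : a.domCoprod b v = a ![] ⊗ₜ b (v ∘ Sum.inr) := by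
  have : ∀ σ : Equiv.Perm.ModSumCongr (Fin 0) (Fin q), σ = Quotient.mk'' 1 := by
    intro σ
    induction σ using Quotient.inductionOn' with | _ σ
    refine (modSumCongr_mk_eq_iff _ _).2 fun x => ?_
    cases σ⁻¹ x <;> cases (1 : Equiv.Perm (Fin 0 ⊕ Fin q))⁻¹ x <;> first | rfl | exact Fin.elim0 ‹_›
  rw [domCoprod_apply_eq_sum, Fintype.sum_eq_single _ fun σ h => absurd (this σ) h,
    domCoprod_summand_apply, map_one, one_smul]
  congr 2
  ext i
  exact i.elim0

theorem domCoprod_zero_right {p : ℕ} (a : L [⋀^Fin p]→ₗ[F] V) (b : L [⋀^Fin 0]→ₗ[F] W)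
    (v : Fin p ⊕ Fin 0 → L) : a.domCoprod b v = a (v ∘ Sum.inl) ⊗ₜ b ![] := by
  have : ∀ σ : Equiv.Perm.ModSumCongr (Fin p) (Fin 0), σ = Quotient.mk'' 1 := by
    intro σ
    induction σ using Quotient.inductionOn' with | _ σ
    refine (modSumCongr_mk_eq_iff _ _).2 fun x => ?_
    cases σ⁻¹ x <;> cases (1 : Equiv.Perm (Fin p ⊕ Fin 0))⁻¹ x <;> first | rfl | exact Fin.elim0 ‹_›
  rw [domCoprod_apply_eq_sum, Fintype.sum_eq_single _ fun σ h => absurd (this σ) h,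
    domCoprod_summand_apply, map_one, one_smul]
  congr 2
  ext i
  exact i.elim0

variable (τ : V ⊗[F] W →ₗ[F] U)

theorem cup_apply {p q n : ℕ} (h : p + q = n) (a : L [⋀^Fin p]→ₗ[F] V) (b : L [⋀^Fin q]→ₗ[F] W)
    (v : Fin n → L) :
    cup τ h a b v = τ (a.domCoprod b (v ∘ Fin.cast h ∘ finSumFinEquiv)) := rfl

theorem cup_zero_left {q n : ℕ} (h : 0 + q = n) (a : L [⋀^Fin 0]→ₗ[F] V) (b : L [⋀^Fin q]→ₗ[F] W)
    (v : Fin n → L) : cup τ h a b v = τ (a ![] ⊗ₜ b (v ∘ Fin.cast (by omega))) := by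
  rw [cup_apply, domCoprod_zero_left]
  congr 3
  ext i
  simp only [Function.comp_apply]
  congr 1
  ext
  simp

theorem cup_zero_right {p n : ℕ} (h : p + 0 = n) (a : L [⋀^Fin p]→ₗ[F] V) (b : L [⋀^Fin 0]→ₗ[F] W)
    (v : Fin n → L) : cup τ h a b v = τ (a (v ∘ Fin.cast h) ⊗ₜ b ![]) := by
  rw [cup_apply, domCoprod_zero_right]
  rfl

/-- Contraction is an antiderivation: the sign has exponent p + 1, the degree of `a`. A factor of
degree 0 has no contraction, which is why the two boundary cases are separate. -/
theorem cup_curryLeft {p q n : ℕ} (h : p + 1 + (q + 1) = n + 1) (a : L [⋀^Fin (p + 1)]→ₗ[F] V)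
    (b : L [⋀^Fin (q + 1)]→ₗ[F] W) (x : L) :
    (cup τ h a b).curryLeft x = cup τ (by omega) (a.curryLeft x) b +
      (-1 : ℤ) ^ (p + 1) • cup τ (by omega) a (b.curryLeft x) := by
  ext w
  rw [AlternatingMap.curryLeft_apply_apply, AlternatingMap.add_apply, AlternatingMap.smul_apply,
    cup_apply, cup_apply, cup_apply, domCoprod_succ_succ, map_sub, sub_eq_add_neg]
  have h0 : (Matrix.vecCons x w ∘ Fin.cast h ∘ finSumFinEquiv) (Sum.inl 0) = x := by
    have : Fin.cast h (finSumFinEquiv (Sum.inl 0)) = 0 := by ext; simp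
    rw [Function.comp_apply, Function.comp_apply, this]
    rfl
  rw [h0]
  congr 1
  · congr 2
    ext i
    have : ∀ j : Fin p ⊕ Fin (q + 1), Fin.cast h (finSumFinEquiv (Sum.map Fin.succ id j)) =
        Fin.succ (Fin.cast (by omega) (finSumFinEquiv j)) := by
      rintro (j | j) <;> ext <;> simp <;> omega
    simp [this]
  -- After the swap the left block reads (w_p, w_0, …, w_{p-1}). Rotating its p + 1 entries into
  -- order costs (-1)^p, which with the minus sign of `domCoprod_succ_succ` gives (-1)^{p+1}.
  · have hc : ((Matrix.vecCons x w ∘ Fin.cast h ∘ finSumFinEquiv) ∘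
        Equiv.swap (Sum.inl 0) (Sum.inr 0)) ∘ Sum.map id Fin.succ ∘
          (Equiv.sumCongr (finRotate (p + 1)) (Equiv.refl (Fin q))) =
        w ∘ Fin.cast (by omega) ∘ finSumFinEquiv := by
      have e : ∀ (u : Fin (n + 1)) (j : Fin n), (u : ℕ) = j + 1 →
          Matrix.vecCons x w u = w j := by
        intro u j hu
        rw [show u = j.succ from Fin.ext hu]
        rfl
      ext i
      rcases i with i | i
      · induction i using Fin.lastCases with
        | last =>
          simp only [Function.comp_apply, Equiv.sumCongr_apply, Sum.map_inl, finRotate_last, id,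
            Equiv.swap_apply_left]
          exact e _ _ (by simp)
        | cast i =>
          have h1 : (finRotate (p + 1)) i.castSucc = i.succ := by
            rw [finRotate_apply]; simp
          simp only [Function.comp_apply, Equiv.sumCongr_apply, Sum.map_inl, h1, id]
          rw [Equiv.swap_apply_of_ne_of_ne (by simp [Fin.succ_ne_zero]) (by simp)]
          exact e _ _ (by simp)
      · simp only [Function.comp_apply, Equiv.sumCongr_apply, Sum.map_inr, Equiv.refl_apply]
        rw [Equiv.swap_apply_of_ne_of_ne (by simp) (by simp [Fin.succ_ne_zero])]
        exact e _ _ (by simp; omega)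
    rw [← hc, ← Function.comp_assoc _ (Sum.map id Fin.succ), AlternatingMap.map_perm, Equiv.Perm.sign_sumCongr,
      sign_finRotate, Equiv.Perm.sign_refl, mul_one, Nat.add_sub_cancel]
    rcases Nat.even_or_odd p with hp | hp <;> simp [hp.neg_one_pow, pow_succ]

theorem cup_curryLeft_zero_left {q n : ℕ} (h : 0 + (q + 1) = n + 1) (a : L [⋀^Fin 0]→ₗ[F] V)
    (b : L [⋀^Fin (q + 1)]→ₗ[F] W) (x : L) :
    (cup τ h a b).curryLeft x = cup τ (by omega) a (b.curryLeft x) := by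
  ext w
  simp only [AlternatingMap.curryLeft_apply_apply, cup_zero_left]
  congr 3
  ext i
  induction i using Fin.cases <;> simp

theorem cup_curryLeft_zero_right {p n : ℕ} (h : p + 1 + 0 = n + 1) (a : L [⋀^Fin (p + 1)]→ₗ[F] V)
    (b : L [⋀^Fin 0]→ₗ[F] W) (x : L) :
    (cup τ h a b).curryLeft x = cup τ (by omega) (a.curryLeft x) b := by
  ext w
  simp only [AlternatingMap.curryLeft_apply_apply, cup_zero_right]
  congr 3
  ext i
  induction i using Fin.cases <;> simp

end Cup

theorem succ_add_eq {p q n : ℕ} (h : p + q = n) : p + 1 + q = n + 1 := by omega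

theorem add_succ_eq {p q n : ℕ} (h : p + q = n) : p + (q + 1) = n + 1 := by omega

/-! ### Derivations and the Leibniz rule -/

section CupCalculus

variable {F : Type*} [Field F] {L : Type*} [LieRing L] [LieAlgebra F L]
  {V W U : Type*} [AddCommGroup V] [Module F V] [AddCommGroup W] [Module F W]
  [AddCommGroup U] [Module F U] (τ : V ⊗[F] W →ₗ[F] U)

/-- The cup product of alternating maps as a bilinear map. -/
noncomputable def cupLin {p q n : ℕ} (h : p + q = n) :
    (L [⋀^Fin p]→ₗ[F] V) →ₗ[F] (L [⋀^Fin q]→ₗ[F] W) →ₗ[F] (L [⋀^Fin n]→ₗ[F] U) :=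
  LinearMap.mk₂ F (cup τ h)
    (fun a a' b => by
      ext v
      simp only [AlternatingMap.add_apply, cup_apply, ← AlternatingMap.domCoprod'_apply,
        TensorProduct.add_tmul, map_add])
    (fun c a b => by
      ext v
      simp only [AlternatingMap.smul_apply, cup_apply, ← AlternatingMap.domCoprod'_apply,
        ← TensorProduct.smul_tmul', map_smul])
    (fun a b b' => by
      ext v
      simp only [AlternatingMap.add_apply, cup_apply, ← AlternatingMap.domCoprod'_apply,
        TensorProduct.tmul_add, map_add])
    (fun c a b => by
      ext v
      simp only [AlternatingMap.smul_apply, cup_apply, ← AlternatingMap.domCoprod'_apply,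
        TensorProduct.tmul_smul, map_smul])

section Linearity

variable {p q n : ℕ} (h : p + q = n) (a a' : L [⋀^Fin p]→ₗ[F] V) (b b' : L [⋀^Fin q]→ₗ[F] W)

theorem cup_add_left : cup τ h (a + a') b = cup τ h a b + cup τ h a' b :=
  LinearMap.map_add₂ (cupLin τ h) a a' b

theorem cup_add_right : cup τ h a (b + b') = cup τ h a b + cup τ h a b' :=
  map_add (cupLin τ h a) b b'

theorem cup_sub_left : cup τ h (a - a') b = cup τ h a b - cup τ h a' b :=
  LinearMap.map_sub₂ (cupLin τ h) a a' b

theorem cup_sub_right : cup τ h a (b - b') = cup τ h a b - cup τ h a b' :=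
  map_sub (cupLin τ h a) b b'

@[simp] theorem cup_left_zero : cup τ h (0 : L [⋀^Fin p]→ₗ[F] V) b = 0 :=
  LinearMap.map_zero₂ (cupLin τ h) b

@[simp] theorem cup_right_zero : cup τ h a (0 : L [⋀^Fin q]→ₗ[F] W) = 0 :=
  map_zero (cupLin τ h a)

end Linearity

/-- The cup product commutes with maps of the coefficients. -/
theorem compAlternatingMap_cup {V' W' U' : Type*} [AddCommGroup V'] [Module F V'] [AddCommGroup W']
    [Module F W'] [AddCommGroup U'] [Module F U'] {τ : V ⊗[F] W →ₗ[F] U} {τ' : V' ⊗[F] W' →ₗ[F] U'}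
    {f₁ : V →ₗ[F] V'} {f₂ : W →ₗ[F] W'} {f₃ : U →ₗ[F] U'}
    (hf : ∀ v w, f₃ (τ (v ⊗ₜ w)) = τ' (f₁ v ⊗ₜ f₂ w)) {p q n : ℕ} (h : p + q = n)
    (a : L [⋀^Fin p]→ₗ[F] V) (b : L [⋀^Fin q]→ₗ[F] W) :
    f₃.compAlternatingMap (cup τ h a b) =
      cup τ' h (f₁.compAlternatingMap a) (f₂.compAlternatingMap b) := by
  ext v
  rw [LinearMap.compAlternatingMap_apply, cup_apply, cup_apply, domCoprod_apply_eq_sum,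
    domCoprod_apply_eq_sum, map_sum, map_sum, map_sum]
  refine Finset.sum_congr rfl fun σ _ => ?_
  induction σ using Quotient.inductionOn' with | _ σ
  rw [domCoprod_summand_apply, domCoprod_summand_apply]
  rcases Int.units_eq_one_or (Equiv.Perm.sign σ) with h | h <;> simp [h, hf]

/-- The cup product commutes with pullback along linear maps. -/
theorem cup_compLinearMap {L' : Type*} [LieRing L'] [LieAlgebra F L'] (s : L' →ₗ[F] L) {p q n : ℕ}
    (h : p + q = n) (a : L [⋀^Fin p]→ₗ[F] V) (b : L [⋀^Fin q]→ₗ[F] W) :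
    (cup τ h a b).compLinearMap s = cup τ h (a.compLinearMap s) (b.compLinearMap s) := by
  ext v
  rw [AlternatingMap.compLinearMap_apply, cup_apply, cup_apply, domCoprod_apply_eq_sum,
    domCoprod_apply_eq_sum]
  refine congrArg τ (Finset.sum_congr rfl fun σ _ => ?_)
  induction σ using Quotient.inductionOn' with | _ σ
  rfl

theorem curryLeft_add_apply {n : ℕ} (f f' : L [⋀^Fin (n + 1)]→ₗ[F] V) (y : L) :
    (f + f').curryLeft y = f.curryLeft y + f'.curryLeft y := rfl

theorem curryLeft_zsmul_apply {n : ℕ} (c : ℤ) (f : L [⋀^Fin (n + 1)]→ₗ[F] V) (y : L) :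
    (c • f).curryLeft y = c • f.curryLeft y := by
  ext v
  simp

/-- The operators `twist` act on cup products as derivations. -/
theorem twist_cup {D : L →ₗ[F] L} {A : V →ₗ[F] V} {B : W →ₗ[F] W} {C : U →ₗ[F] U}
    (hτ : ∀ v w, C (τ (v ⊗ₜ w)) = τ (A v ⊗ₜ w) + τ (v ⊗ₜ B w)) {p q n : ℕ} (h : p + q = n)
    (a : L [⋀^Fin p]→ₗ[F] V) (b : L [⋀^Fin q]→ₗ[F] W) :
    twist D C (cup τ h a b) = cup τ h (twist D A a) b + cup τ h a (twist D B b) := by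
  induction n generalizing p q with
  | zero =>
    obtain ⟨rfl, rfl⟩ : p = 0 ∧ q = 0 := by omega
    ext v
    simp only [twist_apply, AlternatingMap.add_apply, cup_zero_left, hτ]
    simp
  | succ n ih =>
    refine curryLeft_ext fun x => ?_
    rw [twist_cons, curryLeft_add_apply]
    rcases p with _ | p <;> rcases q with _ | q
    · omega
    · simp only [cup_curryLeft_zero_left, ih, twist_cons, cup_sub_right]
      abel
    · simp only [cup_curryLeft_zero_right, ih, twist_cons, cup_sub_left]
      abel
    · simp only [cup_curryLeft, ih, twist_cons, cup_sub_left, cup_sub_right, map_add,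
        map_zsmul]
      module

/-- The Leibniz rule. -/
theorem d_cup {ρV : L →ₗ[F] Module.End F V} {ρW : L →ₗ[F] Module.End F W}
    {ρU : L →ₗ[F] Module.End F U}
    (hτ : ∀ x v w, ρU x (τ (v ⊗ₜ w)) = τ (ρV x v ⊗ₜ w) + τ (v ⊗ₜ ρW x w)) {p q n : ℕ}
    (h : p + q = n) (a : L [⋀^Fin p]→ₗ[F] V) (b : L [⋀^Fin q]→ₗ[F] W) :
    d ρU (cup τ h a b) = cup τ (succ_add_eq h) (d ρV a) b +
      (-1 : ℤ) ^ p • cup τ (add_succ_eq h) a (d ρW b) := by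
  have hθ : ∀ (x : L) {p q n : ℕ} (h : p + q = n) (a : L [⋀^Fin p]→ₗ[F] V)
      (b : L [⋀^Fin q]→ₗ[F] W),
      theta ρU x (cup τ h a b) = cup τ h (theta ρV x a) b + cup τ h a (theta ρW x b) :=
    fun x => twist_cup τ (hτ x)
  induction n generalizing p q with
  | zero =>
    obtain ⟨rfl, rfl⟩ : p = 0 ∧ q = 0 := by omega
    refine curryLeft_ext fun x => ?_
    rw [curryLeft_add_apply, curryLeft_zsmul_apply, d_zero_cons, hθ, cup_curryLeft_zero_left,
      cup_curryLeft_zero_right, d_zero_cons, d_zero_cons, pow_zero, one_smul]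
  | succ n ih =>
    refine curryLeft_ext fun x => ?_
    rw [curryLeft_add_apply, curryLeft_zsmul_apply, d_cons, hθ]
    rcases p with _ | p <;> rcases q with _ | q
    · omega
    · simp only [cup_curryLeft_zero_left, cup_curryLeft, ih, d_cons, d_zero_cons, cup_sub_right]
      module
    · simp only [cup_curryLeft_zero_right, cup_curryLeft, ih, d_cons, d_zero_cons, cup_sub_left]
      -- Some terms match only through (-1)^p (-1)^p = 1, so the two values of the sign are treated
      -- separately.
      rcases neg_one_pow_eq_or ℤ p with hs | hs <;> simp only [pow_succ, hs] <;> module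
    · simp only [cup_curryLeft, ih, d_cons, cup_sub_left, cup_sub_right, map_add, map_zsmul]
      rcases neg_one_pow_eq_or ℤ p with hs | hs <;> simp only [pow_succ, hs] <;> module

end CupCalculus

/-! ### The filtration by the number of arguments in a subspace -/

section Filtration

variable {F : Type*} [Field F] {L : Type*} [LieRing L] [LieAlgebra F L]
  {V W U : Type*} [AddCommGroup V] [Module F V] [AddCommGroup W] [Module F W]
  [AddCommGroup U] [Module F U] (J : Submodule F L)

/-- The alternating `n`-linear maps that vanish when `n - p + 1` of the arguments are in `J`. -/
def filt (V : Type*) [AddCommGroup V] [Module F V] (p : ℤ) (n : ℕ) :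
    Submodule F (L [⋀^Fin n]→ₗ[F] V) where
  carrier := {f | ∀ (v : Fin n → L) (s : Finset (Fin n)), (∀ i ∈ s, v i ∈ J) →
    (n : ℤ) - p + 1 ≤ s.card → f v = 0}
  add_mem' {f f'} hf hf' v s hs hc := by simp [hf v s hs hc, hf' v s hs hc]
  zero_mem' _ _ _ _ := rfl
  smul_mem' c f hf v s hs hc := by simp [hf v s hs hc]

variable {J}

theorem filt_anti {p p' : ℤ} (h : p ≤ p') (n : ℕ) : filt J V p' n ≤ filt J V p n :=
  fun _ hf v s hs hc => hf v s hs (by omega)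

theorem mem_filt_of_nonpos {p : ℤ} (h : p ≤ 0) {n : ℕ} (f : L [⋀^Fin n]→ₗ[F] V) :
    f ∈ filt J V p n := fun v s _ hc => by
  have := s.card_le_univ
  rw [Fintype.card_fin] at this
  omega

theorem eq_zero_of_mem_filt {p : ℤ} {n : ℕ} (h : (n : ℤ) < p) {f : L [⋀^Fin n]→ₗ[F] V}
    (hf : f ∈ filt J V p n) : f = 0 := by
  ext v
  exact hf v ∅ (by simp) (by simp; omega)

/-- Contracting with an arbitrary vector loses one filtration step, contracting with a vector of `J`
loses none. For the converse, the chosen set of arguments either contains the first argument, which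
then lies in `J`, or it does not. -/
theorem mem_filt_succ {p : ℤ} {n : ℕ} {f : L [⋀^Fin (n + 1)]→ₗ[F] V} :
    f ∈ filt J V p (n + 1) ↔
      (∀ x, f.curryLeft x ∈ filt J V (p - 1) n) ∧ ∀ y ∈ J, f.curryLeft y ∈ filt J V p n := by
  constructor
  · refine fun hf => ⟨fun x v s hs hc => ?_, fun y hy v s hs hc => ?_⟩
    · refine hf _ (s.map (Fin.succEmb n)) ?_ (by rw [Finset.card_map]; push_cast; omega)
      simpa using hs
    · refine hf _ (Finset.cons 0 (s.map (Fin.succEmb n)) (by simp)) ?_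
        (by rw [Finset.card_cons, Finset.card_map]; push_cast; omega)
      simpa [hy] using hs
  · rintro ⟨h1, h2⟩ v s hs hc
    let t := Finset.univ.filter fun i : Fin n => i.succ ∈ s
    have ht : ∀ i ∈ t, Fin.tail v i ∈ J := fun i hi => hs _ (Finset.mem_filter.1 hi).2
    have hst : s ⊆ insert 0 (t.map (Fin.succEmb n)) := by
      intro i hi
      induction i using Fin.cases with
      | zero => simp
      | succ i => simp [t, hi]
    rw [← Fin.cons_self_tail v]
    by_cases h0 : (0 : Fin (n + 1)) ∈ s
    · refine h2 (v 0) (hs 0 h0) _ t ht ?_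
      have := (Finset.card_le_card hst).trans (Finset.card_insert_le _ _)
      rw [Finset.card_map] at this
      push_cast at hc
      omega
    · refine h1 (v 0) _ t ht ?_
      have := Finset.card_le_card ((Finset.subset_insert_iff_of_notMem h0).1 hst)
      rw [Finset.card_map] at this
      push_cast at hc
      omega

/-- By `mem_filt_succ` and the antiderivation rule, each contraction of a cup product is a sum of
cup products of lower total degree and of the right filtration, so induction applies. -/
theorem cup_mem_filt (τ : V ⊗[F] W →ₗ[F] U) {p q n : ℕ} (h : p + q = n) {i j k : ℤ}
    (hk : i + j = k) {a : L [⋀^Fin p]→ₗ[F] V} {b : L [⋀^Fin q]→ₗ[F] W} (ha : a ∈ filt J V i p)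
    (hb : b ∈ filt J W j q) : cup τ h a b ∈ filt J U k n := by
  induction n generalizing p q i j k with
  | zero =>
    obtain ⟨rfl, rfl⟩ : p = 0 ∧ q = 0 := by omega
    -- In degree 0 the filtration is everything for k ≤ 0. If k > 0, then i or j is positive and
    -- that factor vanishes.
    rcases le_or_gt k 0 with hk0 | hk0
    · exact mem_filt_of_nonpos hk0 _
    rcases le_or_gt i 0 with hi | hi
    · rw [eq_zero_of_mem_filt (by simp; omega) hb, cup_right_zero]
      exact zero_mem _
    · rw [eq_zero_of_mem_filt (by simpa using hi) ha, cup_left_zero]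
      exact zero_mem _
  | succ n ih =>
    rw [mem_filt_succ]
    rcases p with _ | p <;> rcases q with _ | q
    · omega
    · rw [mem_filt_succ] at hb
      simp only [cup_curryLeft_zero_left]
      exact ⟨fun x => ih _ (by omega) ha (hb.1 x), fun y hy => ih _ hk ha (hb.2 y hy)⟩
    · rw [mem_filt_succ] at ha
      simp only [cup_curryLeft_zero_right]
      exact ⟨fun x => ih _ (by omega) (ha.1 x) hb, fun y hy => ih _ hk (ha.2 y hy) hb⟩
    · have ha' := mem_filt_succ.1 ha
      have hb' := mem_filt_succ.1 hb
      simp only [cup_curryLeft]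
      exact ⟨fun x => add_mem (ih _ (by omega) (ha'.1 x) hb)
          (zsmul_mem (ih _ (by omega) ha (hb'.1 x)) _),
        fun y hy => add_mem (ih _ hk (ha'.2 y hy) hb) (zsmul_mem (ih _ hk ha (hb'.2 y hy)) _)⟩

end Filtration

/-! ### Relative cochains as the cochains killed by contractions and θ -/

section Relative

variable {F : Type*} [Field F] {L : Type*} [LieRing L] [LieAlgebra F L]
  {V W U : Type*} [AddCommGroup V] [Module F V] [AddCommGroup W] [Module F W]
  [AddCommGroup U] [Module F U]

theorem map_eq_zero_of_curryLeft {n : ℕ} {f : L [⋀^Fin (n + 1)]→ₗ[F] V} {v : Fin (n + 1) → L}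
    {i : Fin (n + 1)} (h : f.curryLeft (v i) = 0) : f v = 0 := by
  have h1 := map_update_eq f v i (v i)
  rw [Function.update_eq_self] at h1
  rw [h1, ← AlternatingMap.curryLeft_apply_apply, h]
  simp

theorem curryLeft_eq_zero_of_mem {K : LieSubalgebra F L} {ρ : L →ₗ[F] Module.End F V} {n : ℕ}
    {f : L [⋀^Fin (n + 1)]→ₗ[F] V} (hf : f ∈ relCochains K ρ (n + 1)) {x : L} (hx : x ∈ K) :
    f.curryLeft x = 0 := by
  ext v
  exact hf.1 _ 0 (by simpa using hx)

/-- An argument can be moved to the front up to sign, so only contractions need to be tested. In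
this form the condition interacts well with the cup product and with `d`. -/
theorem mem_relCochains_succ {K : LieSubalgebra F L} {ρ : L →ₗ[F] Module.End F V} {n : ℕ}
    {f : L [⋀^Fin (n + 1)]→ₗ[F] V} :
    f ∈ relCochains K ρ (n + 1) ↔ ∀ x ∈ K, f.curryLeft x = 0 ∧ theta ρ x f = 0 :=
  ⟨fun hf x hx => ⟨curryLeft_eq_zero_of_mem hf hx, hf.2 x hx⟩, fun h =>
    ⟨fun _ _ hi => map_eq_zero_of_curryLeft (h _ hi).1, fun x hx => (h x hx).2⟩⟩

theorem mem_relCochains_zero {K : LieSubalgebra F L} {ρ : L →ₗ[F] Module.End F V}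
    {f : L [⋀^Fin 0]→ₗ[F] V} : f ∈ relCochains K ρ 0 ↔ ∀ x ∈ K, theta ρ x f = 0 :=
  ⟨fun hf => hf.2, fun h => ⟨fun _ i => i.elim0, h⟩⟩

theorem cup_mem_relCochains {K : LieSubalgebra F L} {ρV : L →ₗ[F] Module.End F V}
    {ρW : L →ₗ[F] Module.End F W} {ρU : L →ₗ[F] Module.End F U} (τ : V ⊗[F] W →ₗ[F] U)
    (hτ : ∀ x ∈ K, ∀ v w, ρU x (τ (v ⊗ₜ w)) = τ (ρV x v ⊗ₜ w) + τ (v ⊗ₜ ρW x w)) {p q n : ℕ}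
    (h : p + q = n) {a : L [⋀^Fin p]→ₗ[F] V} {b : L [⋀^Fin q]→ₗ[F] W}
    (ha : a ∈ relCochains K ρV p) (hb : b ∈ relCochains K ρW q) :
    cup τ h a b ∈ relCochains K ρU n := by
  have hθ : ∀ x ∈ K, theta ρU x (cup τ h a b) = 0 := by
    intro x hx
    have := twist_cup τ (D := (LieAlgebra.ad F L x : L →ₗ[F] L)) (hτ x hx) h a b
    change theta ρU x _ = cup τ h (theta ρV x a) b + cup τ h a (theta ρW x b) at this
    rw [this, ha.2 x hx, hb.2 x hx, cup_left_zero, cup_right_zero, add_zero]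
  cases n with
  | zero => exact mem_relCochains_zero.2 hθ
  | succ n =>
    refine mem_relCochains_succ.2 fun x hx => ⟨?_, hθ x hx⟩
    rcases p with _ | p <;> rcases q with _ | q
    · omega
    · rw [cup_curryLeft_zero_left, curryLeft_eq_zero_of_mem hb hx, cup_right_zero]
    · rw [cup_curryLeft_zero_right, curryLeft_eq_zero_of_mem ha hx, cup_left_zero]
    · rw [cup_curryLeft, curryLeft_eq_zero_of_mem hb hx, curryLeft_eq_zero_of_mem ha hx,
        cup_right_zero, cup_left_zero, smul_zero, add_zero]

/-- `d` preserves relative cochains if the operators `ρ y` with `y` in `K` are compatible with `ρ`. -/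
theorem d_mem_relCochains {K : LieSubalgebra F L} {ρ : L →ₗ[F] Module.End F V}
    (hρ : ∀ y ∈ K, IsCompatible ρ (LieAlgebra.ad F L y : L →ₗ[F] L) (ρ y)) {n : ℕ}
    {f : L [⋀^Fin n]→ₗ[F] V} (hf : f ∈ relCochains K ρ n) : d ρ f ∈ relCochains K ρ (n + 1) := by
  refine mem_relCochains_succ.2 fun x hx => ⟨?_, ?_⟩
  · cases n with
    | zero => rw [d_zero_cons, hf.2 x hx]
    | succ n => rw [d_cons, hf.2 x hx, curryLeft_eq_zero_of_mem hf hx, map_zero, sub_zero]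
  · rw [theta, twist_d (hρ x hx)]
    exact (congrArg (d ρ) (hf.2 x hx)).trans (map_zero _)

/-- The operators `twist` commute with maps of the coefficients. -/
theorem compAlternatingMap_twist {D : L →ₗ[F] L} {A : V →ₗ[F] V} {B : W →ₗ[F] W} {f : V →ₗ[F] W}
    (hf : ∀ v, f (A v) = B (f v)) {n : ℕ} (a : L [⋀^Fin n]→ₗ[F] V) :
    f.compAlternatingMap (twist D A a) = twist D B (f.compAlternatingMap a) := by
  ext v
  simp [twist_apply, hf]

/-- The differential commutes with maps of the coefficients. -/
theorem compAlternatingMap_d {ρV : L →ₗ[F] Module.End F V} {ρW : L →ₗ[F] Module.End F W}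
    {f : V →ₗ[F] W} (hf : ∀ x v, f (ρV x v) = ρW x (f v)) {n : ℕ} (a : L [⋀^Fin n]→ₗ[F] V) :
    f.compAlternatingMap (d ρV a) = d ρW (f.compAlternatingMap a) := by
  have hθ : ∀ (x : L) {n : ℕ} (a : L [⋀^Fin n]→ₗ[F] V),
      f.compAlternatingMap (theta ρV x a) = theta ρW x (f.compAlternatingMap a) :=
    fun x {n} a => compAlternatingMap_twist (hf x) a
  induction n with
  | zero =>
    refine curryLeft_ext fun x => ?_
    rw [AlternatingMap.curryLeft_compAlternatingMap, d_zero_cons, d_zero_cons, hθ]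
  | succ n ih =>
    refine curryLeft_ext fun x => ?_
    rw [AlternatingMap.curryLeft_compAlternatingMap, d_cons, d_cons, ← hθ,
      AlternatingMap.curryLeft_compAlternatingMap, ← ih]
    ext v
    simp

/-- Equivariance is required for `K` alone, because the sections furnished by semisimplicity are
only equivariant under k/I_k. -/
theorem compAlternatingMap_mem_relCochains {K : LieSubalgebra F L} {ρV : L →ₗ[F] Module.End F V}
    {ρW : L →ₗ[F] Module.End F W} {f : V →ₗ[F] W} (hf : ∀ x ∈ K, ∀ v, f (ρV x v) = ρW x (f v))
    {n : ℕ} {a : L [⋀^Fin n]→ₗ[F] V} (ha : a ∈ relCochains K ρV n) :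
    f.compAlternatingMap a ∈ relCochains K ρW n := by
  refine ⟨fun v i hi => by simp [ha.1 v i hi], fun x hx => ?_⟩
  rw [theta, ← compAlternatingMap_twist (hf x hx)]
  change f.compAlternatingMap (theta ρV x a) = 0
  rw [ha.2 x hx]
  ext v
  simp

/-- An alternating map is a relative cochain if its composite with an injective map of the
coefficients is one. -/
theorem mem_relCochains_of_comp {K : LieSubalgebra F L} {ρV : L →ₗ[F] Module.End F V}
    {ρW : L →ₗ[F] Module.End F W} {f : V →ₗ[F] W} (hf : ∀ x ∈ K, ∀ v, f (ρV x v) = ρW x (f v))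
    (hi : Function.Injective f) {n : ℕ} {a : L [⋀^Fin n]→ₗ[F] V}
    (ha : f.compAlternatingMap a ∈ relCochains K ρW n) : a ∈ relCochains K ρV n := by
  refine ⟨fun v i h => hi ((ha.1 v i h).trans (map_zero f).symm), fun x hx => ?_⟩
  have := ha.2 x hx
  rw [theta, ← compAlternatingMap_twist (hf x hx)] at this
  ext v
  exact hi ((congrArg (fun b => b v) this).trans (map_zero f).symm)

end Relative

/-! ### Splitting off the last arguments -/

section Bicurry

theorem append_update_left {α : Type*} {p q : ℕ} (x : Fin p → α) (y : Fin q → α) (i : Fin p)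
    (a : α) : Fin.append (Function.update x i a) y =
      Function.update (Fin.append x y) (Fin.castAdd q i) a := by
  ext l
  refine Fin.addCases (fun l => ?_) (fun l => ?_) l
  · by_cases h : l = i
    · subst h; simp
    · simp [h]
  · rw [Function.update_of_ne (by simp [Fin.ext_iff]; omega)]
    simp

theorem append_update_right {α : Type*} {p q : ℕ} (x : Fin p → α) (y : Fin q → α) (i : Fin q)
    (a : α) : Fin.append x (Function.update y i a) =
      Function.update (Fin.append x y) (Fin.natAdd p i) a := by
  ext l
  refine Fin.addCases (fun l => ?_) (fun l => ?_) l
  · rw [Function.update_of_ne (by simp [Fin.ext_iff]; omega)]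
    simp
  · by_cases h : l = i
    · subst h; simp
    · simp [h]

variable {F : Type*} [Field F] {L : Type*} [LieRing L] [LieAlgebra F L] {A : Type*} [LieRing A]
  [LieAlgebra F A] {V W U : Type*} [AddCommGroup V] [Module F V] [AddCommGroup W] [Module F W]
  [AddCommGroup U] [Module F U]

/-- An alternating `(p + q)`-linear map on `L`, as an alternating `p`-linear map on `L` with values
in the alternating `q`-linear maps on `A`, where the last `q` arguments come from `A` through `j`. -/
def bicurry (j : A →ₗ[F] L) {p q n : ℕ} (h : p + q = n) :
    (L [⋀^Fin n]→ₗ[F] V) →ₗ[F] (L [⋀^Fin p]→ₗ[F] (A [⋀^Fin q]→ₗ[F] V)) where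
  toFun c :=
    { toFun := fun x =>
        { toFun := fun y => c.domDomCongr (finCongr h.symm) (Fin.append x (j ∘ y))
          map_update_add' := by
            intro inst y i a b
            cases Subsingleton.elim inst (instDecidableEqFin q)
            simp only [Function.comp_update, append_update_right, map_add,
              AlternatingMap.map_update_add]
          map_update_smul' := by
            intro inst y i a b
            cases Subsingleton.elim inst (instDecidableEqFin q)
            simp only [Function.comp_update, append_update_right, map_smul,
              AlternatingMap.map_update_smul]
          map_eq_zero_of_eq' := fun y i l hy hil =>
            AlternatingMap.map_eq_zero_of_eq _ _ (i := Fin.natAdd p i) (j := Fin.natAdd p l)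
              (by simp [hy]) (by simpa [Fin.ext_iff] using hil) }
      map_update_add' := by
        intro inst x i a b
        cases Subsingleton.elim inst (instDecidableEqFin p)
        ext y
        simp only [append_update_left, AlternatingMap.map_update_add, AlternatingMap.add_apply,
          AlternatingMap.coe_mk, MultilinearMap.coe_mk]
      map_update_smul' := by
        intro inst x i a b
        cases Subsingleton.elim inst (instDecidableEqFin p)
        ext y
        simp only [append_update_left, AlternatingMap.map_update_smul, AlternatingMap.smul_apply,
          AlternatingMap.coe_mk, MultilinearMap.coe_mk]
      map_eq_zero_of_eq' := fun x i l hx hil => by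
        ext y
        exact AlternatingMap.map_eq_zero_of_eq (c.domDomCongr (finCongr h.symm)) _
          (i := Fin.castAdd q i) (j := Fin.castAdd q l)
          (by simp only [Fin.append_left, hx]) (by simpa [Fin.ext_iff] using hil) }
  map_add' _ _ := rfl
  map_smul' _ _ := rfl

variable (j : A →ₗ[F] L)

theorem bicurry_apply {p q n : ℕ} (h : p + q = n) (c : L [⋀^Fin n]→ₗ[F] V) (x : Fin p → L)
    (y : Fin q → A) :
    bicurry j h c x y = c (Fin.append x (j ∘ y) ∘ Fin.cast h.symm) := rfl

theorem bicurry_zero_apply {q n : ℕ} (h : 0 + q = n) (c : L [⋀^Fin n]→ₗ[F] V) (x : Fin 0 → L)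
    (y : Fin q → A) : bicurry j h c x y = c (j ∘ y ∘ Fin.cast (by omega)) := by
  rw [bicurry_apply, Fin.append_left_nil _ _ rfl]
  rfl

theorem bicurry_zero {q : ℕ} (h : 0 + q = q) (c : L [⋀^Fin q]→ₗ[F] V) (x : Fin 0 → L) :
    bicurry j h c x = c.compLinearMap j := by
  ext y
  rw [bicurry_zero_apply]
  rfl

theorem bicurry_curryLeft {p q n : ℕ} (h : p + 1 + q = n + 1) (c : L [⋀^Fin (n + 1)]→ₗ[F] V)
    (x : L) :
    (bicurry j h c).curryLeft x = bicurry j (by omega) (c.curryLeft x) := by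
  ext v y
  rw [AlternatingMap.curryLeft_apply_apply, bicurry_apply, bicurry_apply,
    AlternatingMap.curryLeft_apply_apply, Matrix.vecCons, Fin.append_cons]
  congr 1
  ext i
  induction i using Fin.cases <;> simp [Matrix.vecCons]

theorem curryLeft_comm {n : ℕ} (c : L [⋀^Fin (n + 2)]→ₗ[F] V) (x y : L) :
    (c.curryLeft x).curryLeft y = -(c.curryLeft y).curryLeft x := by
  have h : ∀ z, (c.curryLeft z).curryLeft z = 0 := fun z => AlternatingMap.curryLeft_same c z
  have := h (x + y)
  rw [map_add c.curryLeft, curryLeft_add_apply, map_add, map_add, h, h, zero_add, add_zero] at this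
  exact eq_neg_of_add_eq_zero_left this

/-- The inner argument passes the p outer ones on its way to the front, which accounts for the sign.
-/
theorem bicurry_apply_curryLeft {p q n : ℕ} (h : p + (q + 1) = n + 1)
    (c : L [⋀^Fin (n + 1)]→ₗ[F] V) (x : Fin p → L) (y : A) :
    (bicurry j h c x).curryLeft y =
      (-1 : ℤ) ^ p • bicurry j (by omega) (c.curryLeft (j y)) x := by
  induction p generalizing n with
  | zero =>
    ext v
    rw [pow_zero, one_smul, AlternatingMap.curryLeft_apply_apply, bicurry_zero_apply,
      bicurry_zero_apply, AlternatingMap.curryLeft_apply_apply]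
    congr 1
    ext i
    induction i using Fin.cases <;> simp
  | succ p ih =>
    obtain ⟨n, rfl⟩ : ∃ m, n = m + 1 := ⟨p + q, by omega⟩
    obtain ⟨x₀, x, rfl⟩ : ∃ x₀ x', x = Matrix.vecCons x₀ x' :=
      ⟨x 0, Fin.tail x, (Fin.cons_self_tail x).symm⟩
    rw [← AlternatingMap.curryLeft_apply_apply, ← AlternatingMap.curryLeft_apply_apply,
      bicurry_curryLeft, bicurry_curryLeft, ih, curryLeft_comm, map_neg,
      AlternatingMap.neg_apply, pow_succ]
    module

/-- `bicurry` is equivariant. -/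
theorem bicurry_twist {D : L →ₗ[F] L} {D' : A →ₗ[F] A} (hD : ∀ y, j (D' y) = D (j y))
    (B : V →ₗ[F] V) {p q n : ℕ} (h : p + q = n) (c : L [⋀^Fin n]→ₗ[F] V) :
    bicurry j h (twist D B c) = twist D (twist D' B) (bicurry j h c) := by
  induction p generalizing n with
  | zero =>
    subst h
    ext x y
    rw [bicurry_zero_apply, twist_apply, twist_apply (n := 0),
      Finset.univ_eq_empty (α := Fin 0), Finset.sum_empty, sub_zero, twist_apply,
      bicurry_zero_apply]
    congr 1
    refine Fintype.sum_equiv (finCongr (Nat.zero_add q)) _ _ fun i => ?_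
    rw [bicurry_zero_apply]
    congr 1
    ext l
    rcases eq_or_ne l i with rfl | hl
    · simp [hD]
    · rw [Function.update_of_ne hl, Function.comp_apply, Function.comp_apply, Function.comp_apply,
        Function.comp_apply, Function.update_of_ne]
      simpa [Fin.ext_iff] using hl
  | succ p ih =>
    obtain ⟨n, rfl⟩ : ∃ m, n = m + 1 := ⟨p + q, by omega⟩
    refine curryLeft_ext fun x => ?_
    rw [bicurry_curryLeft, twist_cons, twist_cons, map_sub, ih, bicurry_curryLeft,
      bicurry_curryLeft]

/-- An element of `F_i` vanishes if fewer than `i` of its arguments are not from `A`. -/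
theorem bicurry_eq_zero {J : Submodule F L} (hj : ∀ y, j y ∈ J) {p q n : ℕ} (h : p + q = n) {i : ℤ}
    (hi : (p : ℤ) < i) {c : L [⋀^Fin n]→ₗ[F] V} (hc : c ∈ filt J V i n) : bicurry j h c = 0 := by
  induction p generalizing n i with
  | zero =>
    ext x y
    rw [bicurry_zero_apply]
    refine hc _ Finset.univ (fun l _ => hj _) ?_
    rw [Finset.card_univ, Fintype.card_fin]
    push_cast at hi
    omega
  | succ p ih =>
    obtain ⟨n, rfl⟩ : ∃ m, n = m + 1 := ⟨p + q, by omega⟩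
    refine curryLeft_ext fun x => ?_
    rw [bicurry_curryLeft, ih _ (by push_cast at hi; omega) ((mem_filt_succ.1 hc).1 x)]
    rfl

/-- An outer argument from `J`, together with the q inner ones, makes q + 1 arguments in `J`, too
many for F_{p+1} in degree p + 1 + q. So the leading term of an element of the filtration descends
to the quotient by `J`. -/
theorem bicurry_curryLeft_eq_zero {J : Submodule F L} (hj : ∀ y, j y ∈ J) {p q n : ℕ}
    (h : p + 1 + q = n) {c : L [⋀^Fin n]→ₗ[F] V} (hc : c ∈ filt J V (p + 1) n) {z : L}
    (hz : z ∈ J) : (bicurry j h c).curryLeft z = 0 := by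
  obtain ⟨n, rfl⟩ : ∃ m, n = m + 1 := ⟨p + q, by omega⟩
  rw [bicurry_curryLeft]
  exact bicurry_eq_zero j hj _ (by omega) ((mem_filt_succ.1 hc).2 z hz)

/-- Since n - (p + 1) + 1 = q, membership in F_{p+1} means vanishing once q arguments lie in `J`.
The outer arguments here are arbitrary, so the hypothesis says this for the last q positions;
induction over contractions gives all positions. -/
theorem mem_filt_of_bicurry_eq_zero {J : Submodule F L} (hj : ∀ z ∈ J, ∃ y, j y = z) {p q n : ℕ}
    (h : p + q = n) {c : L [⋀^Fin n]→ₗ[F] V} (hc : bicurry j h c = 0) :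
    c ∈ filt J V (p + 1) n := by
  induction n generalizing p q with
  | zero =>
    obtain ⟨rfl, rfl⟩ : p = 0 ∧ q = 0 := by omega
    have : c = 0 := by
      ext v
      have := congrArg (fun f => f v ![]) hc
      simp only [bicurry_zero_apply, AlternatingMap.zero_apply] at this
      rw [AlternatingMap.zero_apply, ← this]
      congr 1
      ext i
      exact i.elim0
    rw [this]
    exact zero_mem _
  | succ n ih =>
    rw [mem_filt_succ]
    constructor
    · intro x
      cases p with
      | zero => exact mem_filt_of_nonpos (by simp) _
      | succ p =>
        have := ih (p := p) (q := q) (by omega) (c := c.curryLeft x) (by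
          rw [← bicurry_curryLeft j h, hc]; rfl)
        simpa using this
    · intro z hz
      obtain ⟨y, rfl⟩ := hj z hz
      cases q with
      | zero =>
        have : c = 0 := by
          ext v
          have := congrArg (fun f => f (v ∘ Fin.cast h) ![]) hc
          simp only [bicurry_apply, AlternatingMap.zero_apply] at this
          rw [AlternatingMap.zero_apply, ← this]
          congr 1
          rw [Fin.append_right_nil _ _ rfl]
          rfl
        rw [this]
        exact zero_mem _
      | succ q =>
        refine ih (p := p) (q := q) (by omega) ?_
        ext1 x
        have := bicurry_apply_curryLeft j h c x y
        rw [hc] at this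
        rcases neg_one_pow_eq_or ℤ p with hs | hs <;> rw [hs] at this
        · simpa using this.symm
        · simpa [eq_comm] using this

/-- The cup product of alternating maps on `A` as a pairing of coefficients. -/
noncomputable def cupPairing (τ : V ⊗[F] W →ₗ[F] U) (p q : ℕ) :
    (A [⋀^Fin p]→ₗ[F] V) ⊗[F] (A [⋀^Fin q]→ₗ[F] W) →ₗ[F] (A [⋀^Fin (p + q)]→ₗ[F] U) :=
  TensorProduct.lift (cupLin τ rfl)

@[simp] theorem cupPairing_tmul (τ : V ⊗[F] W →ₗ[F] U) {p q : ℕ} (a : A [⋀^Fin p]→ₗ[F] V)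
    (b : A [⋀^Fin q]→ₗ[F] W) : cupPairing τ p q (a ⊗ₜ b) = cup τ rfl a b := rfl

/-- The leading term of a cup product. -/
theorem bicurry_cup {J : Submodule F L} (hj : ∀ y, j y ∈ J) (τ : V ⊗[F] W →ₗ[F] U)
    {p₁ q₁ n₁ p₂ q₂ n₂ p n : ℕ} (h₁ : p₁ + q₁ = n₁) (h₂ : p₂ + q₂ = n₂) (hp : p₁ + p₂ = p)
    (hn : n₁ + n₂ = n) (h : p + (q₁ + q₂) = n) {a : L [⋀^Fin n₁]→ₗ[F] V} {b : L [⋀^Fin n₂]→ₗ[F] W}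
    (ha : a ∈ filt J V p₁ n₁) (hb : b ∈ filt J W p₂ n₂) :
    bicurry j h (cup τ hn a b) = (-1 : ℤ) ^ (p₂ * q₁) •
      cup (cupPairing τ q₁ q₂) hp (bicurry j h₁ a) (bicurry j h₂ b) := by
  induction p generalizing p₁ p₂ n₁ n₂ n with
  | zero =>
    obtain ⟨rfl, rfl⟩ : p₁ = 0 ∧ p₂ = 0 := by omega
    obtain rfl : q₁ = n₁ := by omega
    obtain rfl : q₂ = n₂ := by omega
    subst hn
    ext x y
    rw [zero_mul, pow_zero, one_smul, cup_zero_left, cupPairing_tmul, bicurry_zero_apply, cup_apply,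
      cup_apply]
    rw [bicurry_zero, bicurry_zero]
    exact congrArg (fun f => f y) (cup_compLinearMap (τ := τ) j rfl a b)
  | succ p ih =>
    obtain ⟨n, rfl⟩ : ∃ m, n = m + 1 := ⟨p + (q₁ + q₂), by omega⟩
    refine curryLeft_ext fun x => ?_
    rw [bicurry_curryLeft, curryLeft_zsmul_apply]
    rcases p₁ with _ | p₁ <;> rcases p₂ with _ | p₂
    · omega
    · obtain ⟨n₂, rfl⟩ : ∃ m, n₂ = m + 1 := ⟨p₂ + q₂, by omega⟩
      have hb' := (mem_filt_succ.1 hb).1 x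
      rw [cup_curryLeft_zero_left, bicurry_curryLeft]
      have key : bicurry j (by omega : p + (q₁ + q₂) = n) (cup τ (by omega) a (b.curryLeft x)) = _ :=
        ih h₁ (by omega : p₂ + q₂ = n₂) (by omega) (by omega) (by omega) ha (by simpa using hb')
      obtain rfl : q₁ = n₁ := by omega
      rcases q₁ with _ | q₁
      · rw [cup_curryLeft_zero_left, key]
        simp
      -- The term i_x a ∪ b lies in F_{p₂+1} but keeps only p₂ outer arguments, so it has no
      -- component here.
      · rw [cup_curryLeft, map_add, map_zsmul, key,
          bicurry_eq_zero j hj (i := (p₂ + 1 : ℕ)) _ (by push_cast; omega)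
            (cup_mem_filt τ _ (zero_add _) (mem_filt_of_nonpos le_rfl _) hb), zero_add]
        rw [smul_smul, ← pow_add]
        congr 2
        ring
    · obtain ⟨n₁, rfl⟩ : ∃ m, n₁ = m + 1 := ⟨p₁ + q₁, by omega⟩
      have ha' := (mem_filt_succ.1 ha).1 x
      rw [cup_curryLeft_zero_right, bicurry_curryLeft]
      have key : bicurry j (by omega : p + (q₁ + q₂) = n) (cup τ (by omega) (a.curryLeft x) b) = _ :=
        ih (by omega : p₁ + q₁ = n₁) h₂ (by omega) (by omega) (by omega) (by simpa using ha') hb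
      obtain rfl : q₂ = n₂ := by omega
      rcases q₂ with _ | q₂
      · rw [cup_curryLeft_zero_right, key]
      -- Symmetrically, a ∪ i_x b lies in F_{p₁+1} with only p₁ outer arguments, and drops out.
      · rw [cup_curryLeft, map_add, map_zsmul, key,
          bicurry_eq_zero j hj (i := (p₁ + 1 : ℕ)) _ (by push_cast; omega)
            (cup_mem_filt τ _ (add_zero _) ha (mem_filt_of_nonpos le_rfl _)), smul_zero, add_zero]
    · obtain ⟨n₁, rfl⟩ : ∃ m, n₁ = m + 1 := ⟨p₁ + q₁, by omega⟩
      obtain ⟨n₂, rfl⟩ : ∃ m, n₂ = m + 1 := ⟨p₂ + q₂, by omega⟩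
      have ha' := (mem_filt_succ.1 ha).1 x
      have hb' := (mem_filt_succ.1 hb).1 x
      rw [cup_curryLeft, cup_curryLeft, map_add, map_zsmul, bicurry_curryLeft, bicurry_curryLeft,
        ih (by omega : p₁ + q₁ = n₁) h₂ (by omega) (by omega) (by omega) (by simpa using ha') hb,
        ih h₁ (by omega : p₂ + q₂ = n₂) (by omega) (by omega) (by omega) ha (by simpa using hb'),
        smul_add, smul_smul, smul_smul, ← pow_add, ← pow_add]
      -- On the left the second term carries the total degree n₁ + 1 of `a`, on the right only its
      -- outer degree p₁ + 1. The difference q₁ is what raises p₂ q₁ to (p₂ + 1) q₁.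
      congr 2
      obtain rfl : n₁ = p₁ + q₁ := by omega
      ring

end Bicurry

section

variable {F : Type*} [Field F] {g : Type*} [LieRing g] [LieAlgebra F g]

/-! ### The differential on g in terms of outer and inner arguments -/

section Ideal

variable (M : Type*) [AddCommGroup M] [Module F M] [LieRingModule g M] [LieModule F g M]
  (I : LieIdeal F g)

/-- The inclusion of an ideal, as a linear map. -/
abbrev inclI : I →ₗ[F] g := I.toSubmodule.subtype

/-- The action of `g` on `C^n(I; M)` through the operators `θ_x`. -/
def thetaIHom (n : ℕ) : g →ₗ[F] Module.End F (I [⋀^Fin n]→ₗ[F] M) where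
  toFun x := thetaI M I x
  map_add' x y := LinearMap.ext fun f => thetaI_add M I x y f
  map_smul' c x := LinearMap.ext fun f => thetaI_smul M I c x f

theorem thetaI_coe (y : I) {n : ℕ} (f : I [⋀^Fin n]→ₗ[F] M) :
    thetaI M I (y : g) f = theta (rep F I M) y f := by
  ext v
  rw [thetaI, twist_apply, theta_apply]
  rfl

variable {M I}

theorem bicurry_theta {p q n : ℕ} (h : p + q = n) (x : g) (c : g [⋀^Fin n]→ₗ[F] M) :
    bicurry (inclI I) h (theta (rep F g M) x c) =
      theta (thetaIHom M I q) x (bicurry (inclI I) h c) :=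
  bicurry_twist (inclI I) (D := (LieAlgebra.ad F g x : g →ₗ[F] g))
    (D' := (LieModule.toEnd F g I x : I →ₗ[F] I)) (fun _ => rfl) _ h c

theorem compLinearMap_d {n : ℕ} (c : g [⋀^Fin n]→ₗ[F] M) :
    (d (rep F g M) c).compLinearMap (inclI I) = d (rep F I M) (c.compLinearMap (inclI I)) := by
  have hθ : ∀ (y : I) {n : ℕ} (c : g [⋀^Fin n]→ₗ[F] M),
      (theta (rep F g M) (y : g) c).compLinearMap (inclI I) =
        theta (rep F I M) y (c.compLinearMap (inclI I)) := by
    intro y n c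
    ext v
    rw [AlternatingMap.compLinearMap_apply, theta_apply, theta_apply]
    refine congrArg₂ (· - ·) rfl (Finset.sum_congr rfl fun i _ => ?_)
    rw [AlternatingMap.compLinearMap_apply]
    refine congrArg c (funext fun l => ?_)
    rcases eq_or_ne l i with rfl | hl
    · rw [Function.update_self, Function.update_self]
      rfl
    · rw [Function.update_of_ne hl, Function.update_of_ne hl]
  induction n with
  | zero =>
    refine curryLeft_ext fun y => ?_
    rw [AlternatingMap.curryLeft_compLinearMap, d_zero_cons, d_zero_cons]
    exact hθ y c
  | succ n ih =>
    refine curryLeft_ext fun y => ?_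
    rw [AlternatingMap.curryLeft_compLinearMap, d_cons, d_cons, ← hθ,
      AlternatingMap.curryLeft_compLinearMap, ← ih]
    rfl

theorem bicurry_d_zero_left {q n : ℕ} (h : 0 + q = n) (c : g [⋀^Fin n]→ₗ[F] M) :
    bicurry (inclI I) (by omega : 0 + (q + 1) = n + 1) (d (rep F g M) c) =
      (d (rep F I M)).compAlternatingMap (bicurry (inclI I) h c) := by
  obtain rfl : q = n := by omega
  ext1 x
  rw [LinearMap.compAlternatingMap_apply, bicurry_zero, bicurry_zero, compLinearMap_d]

theorem bicurry_d_zero_right {p n : ℕ} (h : p + 0 = n) (c : g [⋀^Fin n]→ₗ[F] M) :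
    bicurry (inclI I) (by omega : p + 1 + 0 = n + 1) (d (rep F g M) c) =
      d (thetaIHom M I 0) (bicurry (inclI I) h c) := by
  induction p generalizing n with
  | zero =>
    subst h
    refine curryLeft_ext fun x => ?_
    rw [bicurry_curryLeft, d_zero_cons, d_zero_cons, bicurry_theta]
  | succ p ih =>
    obtain ⟨n, rfl⟩ : ∃ m, n = m + 1 := ⟨p, by omega⟩
    refine curryLeft_ext fun x => ?_
    rw [bicurry_curryLeft, d_cons, d_cons, map_sub, bicurry_theta, bicurry_curryLeft, ih]

/-- Brackets of two outer arguments and the outer actions belong to the first summand, as do mixed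
brackets, which stay in `I` and enter through θ. The remaining terms are the differential of `I`.
There is no correction term because the outer arguments still range over all of g. -/
theorem bicurry_d {p q n : ℕ} (h : p + (q + 1) = n) (c : g [⋀^Fin n]→ₗ[F] M) :
    bicurry (inclI I) (by omega : p + 1 + (q + 1) = n + 1) (d (rep F g M) c) =
      d (thetaIHom M I (q + 1)) (bicurry (inclI I) h c) + (-1 : ℤ) ^ (p + 1) •
        (d (rep F I M)).compAlternatingMap
          (bicurry (inclI I) (by omega : p + 1 + q = n) c) := by
  obtain ⟨n, rfl⟩ : ∃ m, n = m + 1 := ⟨p + q, by omega⟩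
  induction p generalizing n with
  | zero =>
    refine curryLeft_ext fun x => ?_
    rw [bicurry_curryLeft, d_cons, curryLeft_add_apply, curryLeft_zsmul_apply, d_zero_cons, map_sub,
      bicurry_theta, AlternatingMap.curryLeft_compAlternatingMap, bicurry_curryLeft,
      bicurry_d_zero_left (by omega)]
    simp [sub_eq_add_neg]
  | succ p ih =>
    obtain ⟨n, rfl⟩ : ∃ m, n = m + 1 := ⟨p + q, by omega⟩
    refine curryLeft_ext fun x => ?_
    rw [bicurry_curryLeft, d_cons, curryLeft_add_apply, curryLeft_zsmul_apply, d_cons, map_sub,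
      bicurry_theta, AlternatingMap.curryLeft_compAlternatingMap, bicurry_curryLeft,
      bicurry_curryLeft, ih _ (by omega)]
    module

end Ideal

/-! ### The section of g → g/I with image J -/

section Section

variable {I : LieIdeal F g} {k : LieSubalgebra F g} (S : Splitting I k)
  {V : Type*} [AddCommGroup V] [Module F V]

/-- The section `x ↦ x^+` of `g → g/I` with image `J`. -/
noncomputable def Splitting.sec : (g ⧸ I) →ₗ[F] g := S.J.toSubmodule.subtype ∘ₗ S.plus

theorem Splitting.sec_mem (x : g ⧸ I) : S.sec x ∈ S.J := (S.plus x).2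

theorem quotHom_eq_zero_iff {x : g} : quotHom I x = 0 ↔ x ∈ I :=
  Submodule.Quotient.mk_eq_zero I.toSubmodule

theorem Splitting.quotHom_sec (x : g ⧸ I) : quotHom I (S.sec x) = x :=
  Submodule.mk_quotientEquivOfIsCompl_apply S.isCompl x

theorem Splitting.sec_quotHom {x : g} (hx : x ∈ S.J) : S.sec (quotHom I x) = x :=
  congrArg Subtype.val (Submodule.quotientEquivOfIsCompl_apply_mk_right S.isCompl ⟨x, hx⟩)

theorem Splitting.sub_sec_mem (x : g) : x - S.sec (quotHom I x) ∈ I := by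
  rw [← quotHom_eq_zero_iff, map_sub, S.quotHom_sec, sub_self]

/-- This is where k = I_k ⊕ (J ∩ k) enters: the part of x in `I` is killed by the quotient and the
part in `J` is x^+ itself. -/
theorem Splitting.sec_mem_of_mem {x : g} (hx : x ∈ k) : S.sec (quotHom I x) ∈ k := by
  obtain ⟨a, ha, b, hb, rfl⟩ := Submodule.mem_sup.1 (S.le_sup hx)
  rw [map_add, quotHom_eq_zero_iff.2 ha.1, zero_add, S.sec_quotHom hb.1]
  exact hb.2

theorem Splitting.sec_lie {x : g} (hx : x ∈ k) (y : g ⧸ I) :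
    S.sec ⁅quotHom I x, y⁆ = ⁅x, S.sec y⁆ := by
  have h : ⁅x, S.sec y⁆ ∈ S.J := S.J.lie_mem (x := (⟨x, hx⟩ : k)) (S.sec_mem y)
  rw [← S.sec_quotHom h, LieHom.map_lie, S.quotHom_sec]

theorem Splitting.sec_lie_sub_mem (x y : g ⧸ I) : ⁅S.sec x, S.sec y⁆ - S.sec ⁅x, y⁆ ∈ I := by
  rw [← quotHom_eq_zero_iff, map_sub, LieHom.map_lie, S.quotHom_sec, S.quotHom_sec, S.quotHom_sec,
    sub_self]

theorem Splitting.apply_eq_apply_sec {n : ℕ} {T : g [⋀^Fin n]→ₗ[F] V}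
    (hT : ∀ v i, v i ∈ I → T v = 0) (v : Fin n → g) :
    T v = T fun i => S.sec (quotHom I (v i)) := by
  induction n with
  | zero =>
    congr 1
    ext i
    exact i.elim0
  | succ n ih =>
    have h1 : ∀ x w i, w i ∈ I → T.curryLeft x w = 0 := fun x w i hi =>
      hT (Matrix.vecCons x w) i.succ hi
    have h2 : T.curryLeft (v 0) = T.curryLeft (S.sec (quotHom I (v 0))) := by
      rw [← sub_eq_zero, ← map_sub]
      ext w
      exact hT (Matrix.vecCons _ w) 0 (S.sub_sec_mem _)
    calc T v = T.curryLeft (v 0) (Fin.tail v) := by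
          rw [AlternatingMap.curryLeft_apply_apply, Matrix.vecCons, Fin.cons_self_tail]
      _ = _ := by
          rw [ih (h1 (v 0)), h2, AlternatingMap.curryLeft_apply_apply]
          congr 1
          ext i
          induction i using Fin.cases <;> rfl

theorem Splitting.compLinearMap_theta {n : ℕ} {T : g [⋀^Fin n]→ₗ[F] V}
    (hT : ∀ v i, v i ∈ I → T v = 0) (ρ : g →ₗ[F] Module.End F V) (x : g ⧸ I) :
    (theta ρ (S.sec x) T).compLinearMap S.sec =
      theta (ρ ∘ₗ S.sec) x (T.compLinearMap S.sec) := by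
  ext v
  rw [AlternatingMap.compLinearMap_apply, theta_apply, theta_apply]
  refine congrArg₂ (· - ·) rfl (Finset.sum_congr rfl fun i _ => ?_)
  rw [AlternatingMap.compLinearMap_apply]
  change T _ = T (S.sec ∘ Function.update v i _)
  rw [Function.comp_update, ← sub_eq_zero]
  change T (Function.update (S.sec ∘ v) i _) - _ = 0
  rw [← AlternatingMap.map_update_sub]
  exact hT _ i (by simpa using S.sec_lie_sub_mem x (v i))

/-- The section need not be a Lie homomorphism, but [x^+, y^+] - [x, y]^+ lies in `I`, where `T`
vanishes. Hence pulling back along it still commutes with θ, and by contraction with `d`. -/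
theorem Splitting.compLinearMap_d {n : ℕ} {T : g [⋀^Fin n]→ₗ[F] V}
    (hT : ∀ v i, v i ∈ I → T v = 0) (ρ : g →ₗ[F] Module.End F V) :
    (d ρ T).compLinearMap S.sec = d (ρ ∘ₗ S.sec) (T.compLinearMap S.sec) := by
  induction n with
  | zero =>
    refine curryLeft_ext fun x => ?_
    rw [AlternatingMap.curryLeft_compLinearMap, d_zero_cons, d_zero_cons, S.compLinearMap_theta hT]
  | succ n ih =>
    refine curryLeft_ext fun x => ?_
    have h1 : ∀ w i, w i ∈ I → T.curryLeft (S.sec x) w = 0 := fun w i hi =>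
      hT (Matrix.vecCons _ w) i.succ hi
    rw [AlternatingMap.curryLeft_compLinearMap, d_cons, d_cons, ← S.compLinearMap_theta hT,
      AlternatingMap.curryLeft_compLinearMap, ← ih h1]
    rfl

end Section

/-! ### Components in C^p(g/I; C^q(I; M)) -/

section Components

variable {I : LieIdeal F g} {k : LieSubalgebra F g} (S : Splitting I k)
  (M : Type*) [AddCommGroup M] [Module F M]

/-- The component of `c` in `C^p(g/I; C^q(I; M))`. -/
noncomputable def Splitting.comp {p q n : ℕ} (h : p + q = n) :
    (g [⋀^Fin n]→ₗ[F] M) →ₗ[F] ((g ⧸ I) [⋀^Fin p]→ₗ[F] (I [⋀^Fin q]→ₗ[F] M)) where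
  toFun c := (bicurry (inclI I) h c).compLinearMap S.sec
  map_add' _ _ := by rw [map_add]; rfl
  map_smul' _ _ := by rw [map_smul]; rfl

section

variable {M}

theorem Splitting.comp_apply {p q n : ℕ} (h : p + q = n) (c : g [⋀^Fin n]→ₗ[F] M)
    (v : Fin p → g ⧸ I) : S.comp M h c v = bicurry (inclI I) h c (S.sec ∘ v) := rfl

theorem bicurry_apply_eq_zero {p q n : ℕ} (h : p + q = n) {c : g [⋀^Fin n]→ₗ[F] M}
    (hc : c ∈ fil M I p n) (v : Fin p → g) (i : Fin p) (hi : v i ∈ I) :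
    bicurry (inclI I) h c v = 0 := by
  cases p with
  | zero => exact i.elim0
  | succ p =>
    refine map_eq_zero_of_curryLeft (i := i) ?_
    push_cast at hc
    exact bicurry_curryLeft_eq_zero (J := I.toSubmodule) (inclI I) (fun y => y.2) h hc hi

/-- On F_p the component does not depend on the representatives of its arguments in g. This
identifies it with the map in the description of ψ, which uses arbitrary representatives. -/
theorem Splitting.comp_quotHom {p q n : ℕ} (h : p + q = n) {c : g [⋀^Fin n]→ₗ[F] M}
    (hc : c ∈ fil M I p n) (v : Fin p → g) :
    S.comp M h c (fun i => quotHom I (v i)) = bicurry (inclI I) h c v :=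
  (S.apply_eq_apply_sec (bicurry_apply_eq_zero h hc) v).symm

theorem Splitting.comp_eq_zero {p q n : ℕ} (h : p + q = n) {i : ℤ} (hi : (p : ℤ) < i)
    {c : g [⋀^Fin n]→ₗ[F] M} (hc : c ∈ fil M I i n) : S.comp M h c = 0 := by
  have := bicurry_eq_zero (J := I.toSubmodule) (inclI I) (fun y => y.2) h hi hc
  ext1 v
  rw [S.comp_apply, this]
  rfl

/-- The leading term is determined by its values on `J`, so if the component vanishes then so does
`bicurry`, which is the criterion for the next filtration step. With `Splitting.comp_eq_zero`,
F_{p+1} is the kernel of the leading term on F_p. -/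
theorem Splitting.mem_fil_succ {p q n : ℕ} (h : p + q = n) {c : g [⋀^Fin n]→ₗ[F] M}
    (hc : c ∈ fil M I p n) (h0 : S.comp M h c = 0) : c ∈ fil M I (p + 1) n := by
  refine mem_filt_of_bicurry_eq_zero (J := I.toSubmodule) (inclI I) (fun z hz => ⟨⟨z, hz⟩, rfl⟩) h ?_
  ext1 v
  rw [← S.comp_quotHom h hc, h0]
  rfl

end

variable [LieRingModule g M] [LieModule F g M]

/-- The operators `θ_{x^+}` on `C^q(I; M)`. -/
noncomputable def Splitting.actI (q : ℕ) : (g ⧸ I) →ₗ[F] Module.End F (I [⋀^Fin q]→ₗ[F] M) :=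
  thetaIHom M I q ∘ₗ S.sec

variable {M}

theorem Splitting.comp_d_zero_right {p n : ℕ} (h : p + 0 = n) {c : g [⋀^Fin n]→ₗ[F] M}
    (hc : c ∈ fil M I p n) :
    S.comp M (by omega : p + 1 + 0 = n + 1) (d (rep F g M) c) =
      d (S.actI M 0) (S.comp M h c) := by
  refine Eq.trans ?_ (S.compLinearMap_d (bicurry_apply_eq_zero h hc) (thetaIHom M I 0))
  rw [← bicurry_d_zero_right]
  rfl

theorem Splitting.comp_d {p q n : ℕ} (h : p + (q + 1) = n) {c : g [⋀^Fin n]→ₗ[F] M}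
    (hc : c ∈ fil M I p n) :
    S.comp M (by omega : p + 1 + (q + 1) = n + 1) (d (rep F g M) c) =
      d (S.actI M (q + 1)) (S.comp M h c) + (-1 : ℤ) ^ (p + 1) •
        (d (rep F I M)).compAlternatingMap (S.comp M (by omega : p + 1 + q = n) c) := by
  have h1 := S.compLinearMap_d (bicurry_apply_eq_zero h hc) (thetaIHom M I (q + 1))
  have h2 := congrArg (AlternatingMap.compLinearMap · S.sec) (bicurry_d (I := I) h c)
  ext1 v
  have h3 := congrArg (fun f => f v) h2
  have h4 := congrArg (fun f => f v) h1
  exact h3.trans (congrArg₂ (· + ·) h4 rfl)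

/-- In the formula for the differential, the part along g/I involves the component with one outer
argument fewer, and this is zero on F_p. Only the differential of `I` survives; this is the
differential of the page E_0. -/
theorem Splitting.comp_d_leading {p q n : ℕ} (h : p + q = n) {c : g [⋀^Fin n]→ₗ[F] M}
    (hc : c ∈ fil M I p n) :
    S.comp M (add_succ_eq h) (d (rep F g M) c) = (-1 : ℤ) ^ p •
      (d (rep F I M)).compAlternatingMap (S.comp M h c) := by
  cases p with
  | zero =>
    ext1 v
    rw [pow_zero, one_smul]
    exact congrArg (fun f => f (S.sec ∘ v)) (bicurry_d_zero_left (I := I) h c)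
  | succ p =>
    -- After the case split p stands for the predecessor; the cochain is viewed one filtration step
    -- lower so that `comp_d` applies.
    have hc' : c ∈ fil M I p n := filt_anti (by simp) n hc
    rw [S.comp_d (by omega) hc', S.comp_eq_zero (by omega) (by simp) hc, map_zero, zero_add]

section Relative

variable {p q n : ℕ} (h : p + q = n) {c : g [⋀^Fin n]→ₗ[F] M}

theorem Splitting.theta_comp {x : g} (hx : x ∈ k) :
    theta (S.actI M q) (quotHom I x) (S.comp M h c) =
      S.comp M h (theta (rep F g M) (S.sec (quotHom I x)) c) := by
  ext1 v
  rw [S.comp_apply, bicurry_theta, theta_apply, theta_apply]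
  refine congrArg₂ (· - ·) rfl (Finset.sum_congr rfl fun i _ => ?_)
  rw [S.comp_apply, Function.comp_update, S.sec_lie hx]
  congr 2
  -- The elements x and x^+ have the same class and both lie in k, so their brackets with an element
  -- of `J` agree.
  have := S.sec_lie (S.sec_mem_of_mem hx) (v i)
  rw [S.quotHom_sec, S.sec_lie hx] at this
  exact this

theorem Splitting.comp_mem_relCochains (hc : c ∈ relCochains k (rep F g M) n) :
    S.comp M h c ∈ relCochains (subQuot I k) (S.actI M q) p := by
  constructor
  · rintro v i ⟨x, hx, hxv⟩
    ext y
    rw [S.comp_apply, bicurry_apply]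
    refine hc.1 _ (Fin.cast h (Fin.castAdd q i)) ?_
    have : v i = quotHom I x := hxv.symm
    simpa [this] using S.sec_mem_of_mem hx
  · rintro _ ⟨x, hx, rfl⟩
    refine (S.theta_comp h hx).trans ?_
    rw [hc.2 _ (S.sec_mem_of_mem hx), map_zero]

/-- For y in I_k, the identity θ_y c = 0 involves brackets of y with outer and inner arguments. The
outer ones vanish because [J, I_k] ⊆ J ∩ I = 0, which leaves θ_y of the inner form. -/
theorem Splitting.comp_apply_mem (hc : c ∈ relCochains k (rep F g M) n) (v : Fin p → g ⧸ I) :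
    S.comp M h c v ∈ relCochains (subI I k) (rep F I M) q := by
  constructor
  · intro y i hi
    rw [S.comp_apply, bicurry_apply]
    refine hc.1 _ (Fin.cast h (Fin.natAdd p i)) ?_
    rw [Function.comp_apply, Fin.cast_cast, Fin.cast_eq_self, Fin.append_right]
    exact hi
  · intro y hy
    have h1 := bicurry_theta (I := I) h (y : g) c
    rw [hc.2 (y : g) hy, map_zero] at h1
    have h2 := congrArg (fun f => f (S.sec ∘ v)) h1
    simp only [theta_apply, AlternatingMap.zero_apply] at h2
    rw [Finset.sum_eq_zero, sub_zero] at h2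
    · rw [← thetaI_coe]
      exact h2.symm
    · intro i _
      have h3 : ⁅(y : g), (S.sec ∘ v) i⁆ = 0 := by
        rw [← lie_skew, Function.comp_apply, S.lie_eq_zero (S.sec_mem _) y.2 hy, neg_zero]
      rw [h3]
      exact AlternatingMap.map_update_zero _ _ _

end Relative

end Components

end

section

section Twist

variable {F : Type*} [Field F] {L : Type*} [LieRing L] [LieAlgebra F L]
  {V : Type*} [AddCommGroup V] [Module F V]

/-- The restriction of an action to an invariant subspace. -/
def subrep (ρ : L →ₗ[F] Module.End F V) (W : Submodule F V) (h : ∀ x, ∀ w ∈ W, ρ x w ∈ W) :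
    L →ₗ[F] Module.End F W where
  toFun x := (ρ x).restrict (h x)
  map_add' x y := by
    ext w
    simp
  map_smul' c x := by
    ext w
    simp

end Twist

/-! ### Cohomology classes of leading terms and the map ψ -/

section Classes

variable {F : Type*} [Field F] {g : Type*} [LieRing g] [LieAlgebra F g] {I : LieIdeal F g}
  {k : LieSubalgebra F g} (S : Splitting I k) (M : Type*) [AddCommGroup M] [Module F M]
  [LieRingModule g M] [LieModule F g M]

/-- The action of `g/I` on the cocycles. -/
noncomputable def Splitting.actZ (q : ℕ) :
    (g ⧸ I) →ₗ[F] Module.End F (cocycles (subI I k) (rep F I M) q) :=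
  subrep (S.actI M q) _ fun x _ hf => S.thetaI_mem_cocycles M (S.sec_mem x) hf

/-- The projection of the cocycles onto the cohomology. -/
abbrev classMap (I : LieIdeal F g) (k : LieSubalgebra F g) (q : ℕ) :
    cocycles (subI I k) (rep F I M) q →ₗ[F] Cohomology (subI I k) (rep F I M) q :=
  Submodule.mkQ _

theorem Splitting.classMap_actZ {q : ℕ} (x : g ⧸ I) (z : cocycles (subI I k) (rep F I M) q) :
    classMap M I k q (S.actZ M q x z) = S.action M q x (classMap M I k q z) := rfl

theorem Splitting.subtype_actZ {q : ℕ} (x : g ⧸ I) (z : cocycles (subI I k) (rep F I M) q) :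
    (cocycles (subI I k) (rep F I M) q).subtype (S.actZ M q x z) =
      S.actI M q x ((cocycles (subI I k) (rep F I M) q).subtype z) := rfl

variable {M}

/-- The class of a map with values in the cocycles. -/
noncomputable def classOf {p q : ℕ} (φ : (g ⧸ I) [⋀^Fin p]→ₗ[F] (I [⋀^Fin q]→ₗ[F] M))
    (hφ : ∀ v, φ v ∈ cocycles (subI I k) (rep F I M) q) :
    (g ⧸ I) [⋀^Fin p]→ₗ[F] Cohomology (subI I k) (rep F I M) q :=
  (classMap M I k q).compAlternatingMap (φ.codRestrict _ hφ)

theorem comp_classMap_eq_zero {p q : ℕ}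
    {ζ : (g ⧸ I) [⋀^Fin p]→ₗ[F] cocycles (subI I k) (rep F I M) q}
    (hζ : ∀ v, (ζ v : I [⋀^Fin q]→ₗ[F] M) ∈ coboundaries (subI I k) (rep F I M) q) :
    (classMap M I k q).compAlternatingMap ζ = 0 := by
  ext v
  exact (Submodule.Quotient.mk_eq_zero _).2 (hζ v)

theorem mem_coboundaries_of_comp_classMap_eq_zero {p q : ℕ}
    {ζ : (g ⧸ I) [⋀^Fin p]→ₗ[F] cocycles (subI I k) (rep F I M) q}
    (h : (classMap M I k q).compAlternatingMap ζ = 0) (v : Fin p → g ⧸ I) :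
    (ζ v : I [⋀^Fin q]→ₗ[F] M) ∈ coboundaries (subI I k) (rep F I M) q := by
  have h1 : classMap M I k q (ζ v) = 0 := congrArg (fun f => f v) h
  exact (Submodule.Quotient.mk_eq_zero ((coboundaries (subI I k) (rep F I M) q).submoduleOf
    (cocycles (subI I k) (rep F I M) q))).1 h1

section

variable {p q : ℕ} {φ : (g ⧸ I) [⋀^Fin p]→ₗ[F] (I [⋀^Fin q]→ₗ[F] M)}
  (hφ : ∀ v, φ v ∈ cocycles (subI I k) (rep F I M) q)

theorem classOf_eq_zero (h : ∀ v, φ v ∈ coboundaries (subI I k) (rep F I M) q) :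
    classOf φ hφ = 0 :=
  comp_classMap_eq_zero h

theorem Splitting.classOf_mem_relCochains (h : φ ∈ relCochains (subQuot I k) (S.actI M q) p) :
    classOf φ hφ ∈ relCochains (subQuot I k) (S.action M q) p :=
  compAlternatingMap_mem_relCochains (fun x _ z => S.classMap_actZ M x z)
    (mem_relCochains_of_comp (fun x _ z => S.subtype_actZ M x z) Subtype.val_injective h)

theorem Splitting.subtype_comp_d_codRestrict :
    (cocycles (subI I k) (rep F I M) q).subtype.compAlternatingMap
      (d (S.actZ M q) (φ.codRestrict _ hφ)) = d (S.actI M q) φ :=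
  compAlternatingMap_d (fun x z => S.subtype_actZ M x z) _

/-- The projection from cocycles to cohomology intertwines the actions, so `d` commutes with taking
classes. Allowing an error with values in the coboundaries fits `Splitting.d_comp_sub_mem`. -/
theorem Splitting.d_classOf {φ' : (g ⧸ I) [⋀^Fin (p + 1)]→ₗ[F] (I [⋀^Fin q]→ₗ[F] M)}
    (hφ' : ∀ v, φ' v ∈ cocycles (subI I k) (rep F I M) q)
    (h : ∀ v, d (S.actI M q) φ v - φ' v ∈ coboundaries (subI I k) (rep F I M) q) :
    d (S.action M q) (classOf φ hφ) = classOf φ' hφ' := by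
  rw [classOf, ← compAlternatingMap_d (fun x z => S.classMap_actZ M x z), ← sub_eq_zero, classOf]
  refine Eq.trans ?_ (comp_classMap_eq_zero (ζ := d (S.actZ M q) (φ.codRestrict _ hφ) -
    φ'.codRestrict _ hφ') fun v => ?_)
  · ext v
    simp
  · have := congrArg (fun f => f v) (S.subtype_comp_d_codRestrict hφ)
    simp only [LinearMap.compAlternatingMap_apply, Submodule.subtype_apply] at this
    rw [AlternatingMap.sub_apply, Submodule.coe_sub, this]
    exact h v

end

theorem coboundaries_le_cocycles {q : ℕ} : coboundaries (subI I k) (rep F I M) q ≤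
    cocycles (subI I k) (rep F I M) q := by
  cases q with
  | zero => exact bot_le
  | succ q =>
    rintro _ ⟨e, he, rfl⟩
    have hr : ∀ (x y : I) (m : M),
        rep F I M ⁅x, y⁆ m = rep F I M x (rep F I M y m) - rep F I M y (rep F I M x m) :=
      fun x y m => by simp
    exact ⟨d_mem_relCochains (fun y _ => ⟨fun x z => by simp, fun x m => by simp⟩) he,
      d_d _ hr e⟩

section Leading

variable {p q n : ℕ} (h : p + q = n) {c : g [⋀^Fin n]→ₗ[F] M}

/-- If dc lies in F_{p+1}, its component of bidegree (p, q+1) vanishes, and up to sign this is d_I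
of the leading term of c. -/
theorem Splitting.comp_mem_cocycles (hc : c ∈ filRel M I k p n)
    (hd : d (rep F g M) c ∈ fil M I (p + 1) (n + 1)) (v : Fin p → g ⧸ I) :
    S.comp M h c v ∈ cocycles (subI I k) (rep F I M) q := by
  refine ⟨S.comp_apply_mem h hc.1 v, ?_⟩
  have h1 := S.comp_d_leading h hc.2
  rw [S.comp_eq_zero _ (by simp) hd] at h1
  have h2 := congrArg (fun f => f v) h1
  rcases neg_one_pow_eq_or ℤ p with hs | hs
  · simpa [hs] using h2.symm
  · simpa [hs, eq_comm] using h2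

/-- The error is, up to sign, d_I of the component of c of bidegree (p+1, q-1). For q = 0 there is
no such component and the error is zero. -/
theorem Splitting.d_comp_sub_mem (hc : c ∈ filRel M I k p n) (v : Fin (p + 1) → g ⧸ I) :
    d (S.actI M q) (S.comp M h c) v -
        S.comp M (succ_add_eq h) (d (rep F g M) c) v ∈
      coboundaries (subI I k) (rep F I M) q := by
  cases q with
  | zero =>
    rw [S.comp_d_zero_right h hc.2, sub_self]
    exact zero_mem _
  | succ q =>
    rw [S.comp_d h hc.2, AlternatingMap.add_apply, sub_add_cancel_left]
    have : d (rep F I M) (S.comp M (by omega : p + 1 + q = n) c v) ∈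
        coboundaries (subI I k) (rep F I M) (q + 1) :=
      ⟨_, S.comp_apply_mem _ hc.1 v, rfl⟩
    exact neg_mem (zsmul_mem this _)

end Leading

theorem Splitting.comp_d_mem_coboundaries {q n : ℕ} (h : 0 + q = n + 1) {c : g [⋀^Fin n]→ₗ[F] M}
    (hc : c ∈ filRel M I k 0 n) (v : Fin 0 → g ⧸ I) :
    S.comp M h (d (rep F g M) c) v ∈ coboundaries (subI I k) (rep F I M) q := by
  obtain ⟨q, rfl⟩ : ∃ m, q = m + 1 := ⟨n, by omega⟩
  rw [S.comp_d_leading (p := 0) (by omega) hc.2]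
  exact ⟨S.comp M (by omega) c v, S.comp_apply_mem _ hc.1 v, by simp⟩

/-- For b = de with e in F_{p-1} and de in F_p, the leading term of e has cocycle values, and the
differential of its class is the class of the leading term of b. The indices r and i are variables
so that the expressions in `pageDenom` fit after arithmetic. -/
theorem Splitting.classOf_comp_mem_coboundaries {p q n : ℕ} (h : p + q = n) {r i : ℤ} (hr : r = 1)
    (hi : i = p - 1) {b : g [⋀^Fin n]→ₗ[F] M} (hb : b ∈ filRelB M I k r i n)
    (hZ : ∀ v, S.comp M h b v ∈ cocycles (subI I k) (rep F I M) q) :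
    classOf (S.comp M h b) hZ ∈ coboundaries (subQuot I k) (S.action M q) p := by
  subst hr hi
  cases n with
  | zero =>
    have hb0 : b = 0 := hb
    subst hb0
    rw [classOf_eq_zero _ fun v => by rw [map_zero]; exact zero_mem _]
    exact zero_mem _
  | succ n =>
    obtain ⟨e, ⟨he, he'⟩, rfl⟩ := hb
    cases p with
    | zero =>
      -- Here e lies in F_{-1}, which is everything and hence equal to F_0; the leading term of de
      -- is then d_I of that of e.
      rw [classOf_eq_zero _ (S.comp_d_mem_coboundaries h
        ⟨he.1, mem_filt_of_nonpos (J := I.toSubmodule) le_rfl e⟩)]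
      exact zero_mem _
    | succ p =>
      have hp : ((p + 1 : ℕ) : ℤ) - 1 = p := by push_cast; ring
      rw [hp] at he he'
      exact ⟨classOf (S.comp M (by omega) e) (S.comp_mem_cocycles _ he he'.2),
        S.classOf_mem_relCochains _ (S.comp_mem_relCochains _ he.1),
        S.d_classOf _ _ (S.d_comp_sub_mem _ he)⟩

variable (M)

theorem Splitting.comp_mem_cocycles_of_filRelD {p q : ℕ}
    (c : filRelD M I k (2 : ℕ) p (p + q)) (v : Fin p → g ⧸ I) :
    S.comp M rfl c.1 v ∈ cocycles (subI I k) (rep F I M) q := by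
  obtain ⟨c, hc, hc'⟩ := c
  exact S.comp_mem_cocycles rfl hc (filt_anti (J := I.toSubmodule) (by simp) _ hc'.2) v

theorem Splitting.classOf_comp_mem_cocycles {p q : ℕ} (c : filRelD M I k (2 : ℕ) p (p + q)) :
    classOf (S.comp M rfl c.1) (S.comp_mem_cocycles_of_filRelD M c) ∈
      cocycles (subQuot I k) (S.action M q) p := by
  have h := S.comp_mem_cocycles_of_filRelD M c
  obtain ⟨c, hc, hc'⟩ := c
  refine ⟨S.classOf_mem_relCochains h (S.comp_mem_relCochains rfl hc.1), LinearMap.mem_ker.2 ?_⟩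
  rw [S.d_classOf h (φ' := 0) (fun v => zero_mem _) fun v => ?_, classOf_eq_zero]
  · exact fun v => zero_mem _
  · have := S.d_comp_sub_mem rfl hc v
    rwa [S.comp_eq_zero _ (by push_cast; omega) hc'.2] at this

/-- The class of the leading term of an element of `F_p C^{p+q}(2)`, as a cocycle. -/
noncomputable def Splitting.psiCochain (p q : ℕ) :
    filRelD M I k (2 : ℕ) p (p + q) →ₗ[F] cocycles (subQuot I k) (S.action M q) p where
  toFun c := ⟨classOf (S.comp M rfl c.1) (S.comp_mem_cocycles_of_filRelD M c),
    S.classOf_comp_mem_cocycles M c⟩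
  map_add' c c' := by
    ext v
    rfl
  map_smul' a c := by
    ext v
    rfl

/-- The canonical map from the second page. -/
noncomputable def Splitting.psi (p q : ℕ) :
    Page M I k 2 p (p + q) →ₗ[F] S.IterCohomology M p q :=
  Submodule.mapQ _ _ (S.psiCochain M p q) fun c hc => by
    have hZ := S.comp_mem_cocycles_of_filRelD M c
    change classOf (S.comp M rfl c.1) hZ ∈ coboundaries (subQuot I k) (S.action M q) p
    obtain ⟨a, ha, b, hb, hab⟩ :=
      Submodule.mem_sup.1 (show c.1 ∈ pageDenom M I k 2 p (p + q) from hc)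
    -- The summand in F_{p+1} has no leading term, so only the summand d F_{p-1}(1) is left.
    have e : S.comp M (rfl : p + q = p + q) c.1 = S.comp M rfl b := by
      rw [← hab, map_add, S.comp_eq_zero _ (by simp) ha.1.2, zero_add]
    simp only [e] at hZ ⊢
    exact S.classOf_comp_mem_coboundaries rfl (by norm_num) (by ring) hb hZ

theorem Splitting.psi_mk {p q : ℕ} (c : filRelD M I k (2 : ℕ) p (p + q)) :
    S.psi M p q (Page.mk M I k c) =
      Cohomology.mk (subQuot I k) (S.action M q) (S.psiCochain M p q c) := rfl

theorem Splitting.isPsi_psi : S.IsPsi M (S.psi M) := by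
  refine fun p q c => ⟨S.psiCochain M p q c, fun x => ⟨⟨_, S.comp_mem_cocycles_of_filRelD M c _⟩,
    fun y => ?_, rfl⟩, rfl⟩
  exact congrArg (fun f => f y) (S.comp_quotHom rfl c.2.1.2 x)

end Classes

end

/-! ### Equivariant sections, and cochains with a prescribed component -/

section

theorem Cohomology.mk_eq_zero_iff {F : Type*} [Field F] {L : Type*} [LieRing L] [LieAlgebra F L]
    {V : Type*} [AddCommGroup V] [Module F V] (K : LieSubalgebra F L)
    (ρ : L →ₗ[F] Module.End F V) {n : ℕ} (c : cocycles K ρ n) : Cohomology.mk K ρ c = 0 ↔ c.1 ∈ coboundaries K ρ n :=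
  Submodule.Quotient.mk_eq_zero _

theorem Page.mk_eq_zero_iff {F : Type*} [Field F] {g : Type*} [LieRing g] [LieAlgebra F g]
    {M : Type*} [AddCommGroup M] [Module F M] [LieRingModule g M] [LieModule F g M]
    (I : LieIdeal F g) (k : LieSubalgebra F g) {r : ℕ} {p : ℤ} {n : ℕ} (c : filRelD M I k r p n) :
    Page.mk M I k c = 0 ↔ c.1 ∈ pageDenom M I k r p n :=
  Submodule.Quotient.mk_eq_zero _

variable {F : Type*} [Field F]

/-- A complement of the kernel of a surjective linear map provides a section that commutes with all
endomorphisms that preserve the complement. -/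
theorem exists_equivariant_section {V W : Type*} [AddCommGroup V] [Module F V] [AddCommGroup W]
    [Module F W] {f : V →ₗ[F] W} (hf : Function.Surjective f) {U : Submodule F V}
    (hd : Disjoint (LinearMap.ker f) U) (hc : Codisjoint (LinearMap.ker f) U) :
    ∃ s : W →ₗ[F] V, (∀ w, f (s w) = w) ∧ ∀ (A : V →ₗ[F] V) (A' : W →ₗ[F] W),
      (∀ v, f (A v) = A' (f v)) → (∀ u ∈ U, A u ∈ U) → ∀ w, s (A' w) = A (s w) := by
  have hinj : ∀ u ∈ U, f u = 0 → u = 0 := fun u hu h => Submodule.disjoint_def.1 hd u h hu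
  have hb : Function.Bijective (f.domRestrict U) := by
    constructor
    · rw [← LinearMap.ker_eq_bot, LinearMap.ker_eq_bot']
      exact fun u hu => Subtype.ext (hinj u u.2 hu)
    · intro w
      obtain ⟨v, rfl⟩ := hf w
      obtain ⟨a, ha, u, hu, rfl⟩ := Submodule.mem_sup.1
        (show v ∈ LinearMap.ker f ⊔ U from hc.eq_top ▸ Submodule.mem_top)
      exact ⟨⟨u, hu⟩, by simp [LinearMap.mem_ker.1 ha]⟩
  let e := LinearEquiv.ofBijective _ hb
  have hs : ∀ w, f (e.symm w) = w := fun w => e.apply_symm_apply w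
  refine ⟨U.subtype ∘ₗ e.symm.toLinearMap, hs, fun A A' hA hU w => ?_⟩
  change (e.symm (A' w) : V) = A (e.symm w)
  rw [← sub_eq_zero]
  refine hinj _ (sub_mem (e.symm _).2 (hU _ (e.symm _).2)) ?_
  rw [map_sub, hs, hA, hs, sub_self]

variable {g : Type*} [LieRing g] [LieAlgebra F g] {I : LieIdeal F g} {k : LieSubalgebra F g}
  (S : Splitting I k)

section Lift

variable (M : Type*) [AddCommGroup M] [Module F M] [LieRingModule g M] [LieModule F g M]

/-- The projection of `g` onto `I` along `J`. -/
noncomputable def Splitting.projI : g →ₗ[F] I :=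
  (LinearMap.id - S.sec ∘ₗ (quotHom I : g →ₗ[F] g ⧸ I)).codRestrict I.toSubmodule S.sub_sec_mem

theorem Splitting.coe_projI (x : g) : (S.projI x : g) = x - S.sec (quotHom I x) := rfl

theorem Splitting.projI_coe (y : I) : S.projI y = y := by
  ext
  rw [S.coe_projI, quotHom_eq_zero_iff.2 y.2, map_zero, sub_zero]

theorem Splitting.projI_mem {x : g} (hx : x ∈ k) : S.projI x ∈ subI I k :=
  sub_mem hx (S.sec_mem_of_mem hx)

theorem Splitting.projI_lie {x : g} (hx : x ∈ k) (y : g) : S.projI ⁅x, y⁆ = ⁅x, S.projI y⁆ := by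
  ext
  rw [LieSubmodule.coe_bracket, S.coe_projI, S.coe_projI, LieHom.map_lie, S.sec_lie hx, lie_sub]

variable {M}

/-- The part of x in `I` lies in I_k and acts by zero on relative cochains. So k acts through k/I_k,
and semisimplicity over k gives complements stable under k/I_k. -/
theorem Splitting.thetaI_eq {x : g} (hx : x ∈ k) {q : ℕ} {f : I [⋀^Fin q]→ₗ[F] M}
    (hf : f ∈ relCochains (subI I k) (rep F I M) q) :
    thetaI M I x f = S.actI M q (quotHom I x) f := by
  have h : x = (S.projI x : g) + S.sec (quotHom I x) := by
    rw [S.coe_projI, sub_add_cancel]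
  conv_lhs => rw [h]
  rw [thetaI_add, thetaI_coe, hf.2 _ (S.projI_mem hx), zero_add]
  rfl

variable (M)

/-- The action of `g/I` on the relative cochains. -/
noncomputable def Splitting.actC (q : ℕ) :
    (g ⧸ I) →ₗ[F] Module.End F (relCochains (subI I k) (rep F I M) q) :=
  subrep (S.actI M q) _ fun x _ hf => S.thetaI_mem_relCochains M (S.sec_mem x) hf

/-- The map `(y₁, …, y_q) ↦ (ω ↦ ω(y₁, …, y_q))`, precomposed with the projection onto `I`. -/
noncomputable def Splitting.evalCochain (q : ℕ) :
    g [⋀^Fin q]→ₗ[F] (relCochains (subI I k) (rep F I M) q →ₗ[F] M) where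
  toFun v :=
    { toFun := fun ω => ω.1 (S.projI ∘ v)
      map_add' := fun _ _ => rfl
      map_smul' := fun _ _ => rfl }
  map_update_add' := by
    intro inst v i a b
    cases Subsingleton.elim inst (instDecidableEqFin q)
    ext ω
    simp [Function.comp_update, AlternatingMap.map_update_add]
  map_update_smul' := by
    intro inst v i a b
    cases Subsingleton.elim inst (instDecidableEqFin q)
    ext ω
    simp [Function.comp_update, AlternatingMap.map_update_smul]
  map_eq_zero_of_eq' v i j hv hij := by
    ext ω
    exact ω.1.map_eq_zero_of_eq _ (by simp [hv]) hij

/-- The action of `g` on the space of linear maps from a space on which it acts to `M`. -/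
def homAction {V : Type*} [AddCommGroup V] [Module F V] (ρ : g →ₗ[F] Module.End F V) :
    g →ₗ[F] Module.End F (V →ₗ[F] M) where
  toFun x :=
    { toFun := fun l => rep F g M x ∘ₗ l - l ∘ₗ ρ x
      map_add' := fun l l' => by
        ext v
        simp
        abel
      map_smul' := fun c l => by
        ext v
        simp [smul_sub] }
  map_add' x y := by
    ext l v
    simp
    abel
  map_smul' c x := by
    ext l v
    simp [smul_sub]

theorem homAction_apply {V : Type*} [AddCommGroup V] [Module F V] (ρ : g →ₗ[F] Module.End F V)
    (x : g) (l : V →ₗ[F] M) (v : V) : homAction M ρ x l v = rep F g M x (l v) - l (ρ x v) := rfl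

/-- Evaluation is tautologically invariant when k acts on all three of arguments, cochains and
values; the projection onto `I` is k-equivariant and maps k into I_k. -/
theorem Splitting.evalCochain_mem_relCochains (q : ℕ) :
    S.evalCochain M q ∈ relCochains k
      (homAction M (S.actC M q ∘ₗ (quotHom I : g →ₗ[F] g ⧸ I))) q := by
  constructor
  · intro v i hi
    ext ω
    exact ω.2.1 _ i (S.projI_mem hi)
  · intro x hx
    ext v ω
    rw [theta_apply, LinearMap.sub_apply, LinearMap.sum_apply, homAction_apply]
    change rep F g M x (ω.1 (S.projI ∘ v)) - S.actI M q (quotHom I x) ω.1 (S.projI ∘ v) -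
      ∑ i, ω.1 (S.projI ∘ Function.update v i ⁅x, v i⁆) = 0
    rw [← S.thetaI_eq hx ω.2, thetaI, twist_apply, sub_sub, sub_eq_zero]
    simp only [Function.comp_update, S.projI_lie hx]
    exact (sub_add_cancel _ _).symm

variable {M}

section

variable {p q n : ℕ} (h : p + q = n) {φ : (g ⧸ I) [⋀^Fin p]→ₗ[F] (I [⋀^Fin q]→ₗ[F] M)}
  (hφ : ∀ v, φ v ∈ relCochains (subI I k) (rep F I M) q)

/-- The cochain on `g` whose only component is `φ`. -/
noncomputable def Splitting.lift : g [⋀^Fin n]→ₗ[F] M :=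
  -- The pairing is ω ⊗ l ↦ l(ω). Written as a cup product, the lift inherits alternation,
  -- relativity and filtration degree from the general results on cup products.
  cup (TensorProduct.lift LinearMap.applyₗ) h
    ((φ.codRestrict _ hφ).compLinearMap (quotHom I : g →ₗ[F] g ⧸ I)) (S.evalCochain M q)

theorem compLinearMap_quotHom_mem_filt {V : Type*} [AddCommGroup V] [Module F V]
    (a : (g ⧸ I) [⋀^Fin p]→ₗ[F] V) :
    a.compLinearMap (quotHom I : g →ₗ[F] g ⧸ I) ∈ filt I.toSubmodule V p p := by
  intro v s hs hc
  have : s.Nonempty := by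
    rw [← Finset.card_pos]
    omega
  obtain ⟨i, hi⟩ := this
  exact a.map_coord_zero i (quotHom_eq_zero_iff.2 (hs i hi))

theorem Splitting.lift_mem_fil : S.lift h hφ ∈ fil M I p n :=
  cup_mem_filt _ h (add_zero _) (compLinearMap_quotHom_mem_filt _) (mem_filt_of_nonpos le_rfl _)

theorem Splitting.lift_mem_relCochains (hr : φ ∈ relCochains (subQuot I k) (S.actI M q) p) :
    S.lift h hφ ∈ relCochains k (rep F g M) n := by
  refine cup_mem_relCochains (ρV := S.actC M q ∘ₗ (quotHom I : g →ₗ[F] g ⧸ I))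
    (ρW := homAction M (S.actC M q ∘ₗ (quotHom I : g →ₗ[F] g ⧸ I))) _ ?_ h ?_
    (S.evalCochain_mem_relCochains M q)
  · intro x _ ω l
    exact (add_sub_cancel _ _).symm
  · have hr' : φ.codRestrict _ hφ ∈ relCochains (subQuot I k) (S.actC M q) p :=
      mem_relCochains_of_comp (f := (relCochains (subI I k) (rep F I M) q).subtype)
        (fun _ _ _ => rfl) Subtype.val_injective hr
    refine ⟨fun v i hi => hr'.1 _ i ⟨_, hi, rfl⟩, fun x hx => ?_⟩
    ext1 v
    have := congrArg (fun f => f fun i => quotHom I (v i)) (hr'.2 _ ⟨x, hx, rfl⟩)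
    simp only [theta_apply] at this
    rw [theta_apply]
    refine Eq.trans ?_ this
    refine congrArg₂ (· - ·) rfl (Finset.sum_congr rfl fun i _ => ?_)
    refine congrArg (φ.codRestrict _ hφ) (funext fun l => ?_)
    rcases eq_or_ne l i with rfl | hl
    · simp
    · simp [hl]

theorem bicurry_cup_apply {A : Type*} [LieRing A] [LieAlgebra F A] {V W U : Type*} [AddCommGroup V]
    [Module F V] [AddCommGroup W] [Module F W] [AddCommGroup U] [Module F U] (j : A →ₗ[F] g)
    {J : Submodule F g} (hj : ∀ y, j y ∈ J) (τ : V ⊗[F] W →ₗ[F] U) {a : g [⋀^Fin p]→ₗ[F] V}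
    (ha : a ∈ filt J V p p) (b : g [⋀^Fin q]→ₗ[F] W) (x : Fin p → g) (y : Fin q → A) :
    bicurry j h (cup τ h a b) x y = τ (a x ⊗ₜ b (j ∘ y)) := by
  -- The leading-term formula with q₁ = 0 and p₂ = 0: no inner argument is passed, so there is no
  -- sign, and the rest is a cast along 0 + q = q.
  have h1 := bicurry_cup j hj τ (add_zero p) (zero_add q) (add_zero p) h (by omega) ha
    (mem_filt_of_nonpos (J := J) (by simp) b)
  have h2 := congrArg (fun f => f x (y ∘ Fin.cast (zero_add q))) h1
  rw [zero_mul, pow_zero, one_smul, cup_zero_right, cupPairing_tmul, cup_zero_left] at h2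
  refine Eq.trans ?_ (h2.trans ?_)
  · rw [bicurry_apply, bicurry_apply]
    congr 1
    ext i
    obtain ⟨i, rfl⟩ := (finCongr h).surjective i
    refine Fin.addCases (fun i => ?_) (fun i => ?_) i
    · have e : ∀ m (hm : n = p + m),
        Fin.cast hm (finCongr h (Fin.castAdd q i)) = Fin.castAdd m i := fun _ _ => rfl
      simp only [Function.comp_apply, e, Fin.append_left]
    · have e : Fin.cast (by omega : n = p + (0 + q)) (finCongr h (Fin.natAdd p i)) =
        Fin.natAdd p (Fin.cast (zero_add q).symm i) := rfl
      have e' : Fin.cast h.symm (finCongr h (Fin.natAdd p i)) = Fin.natAdd p i := rfl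
      simp only [Function.comp_apply, e, e', Fin.append_right]
      rfl
  · rw [bicurry_zero, bicurry_apply, Fin.append_right_nil _ _ rfl]
    rfl

theorem Splitting.comp_lift : S.comp M h (S.lift h hφ) = φ := by
  ext v y
  rw [S.comp_apply, Splitting.lift, bicurry_cup_apply h (inclI I) (J := I.toSubmodule) (fun y => y.2)
    _ (compLinearMap_quotHom_mem_filt _)]
  change φ (fun i => quotHom I (S.sec (v i))) (fun i => S.projI (y i)) = φ v y
  simp only [S.quotHom_sec, S.projI_coe]

end

end Lift

/-! ### Bijectivity of ψ under semisimplicity -/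

section Semisimple

variable {M : Type*} [AddCommGroup M] [Module F M] [LieRingModule g M] [LieModule F g M]

theorem d_mem_relCochains_rep {n : ℕ} {c : g [⋀^Fin n]→ₗ[F] M}
    (hc : c ∈ relCochains k (rep F g M) n) :
    d (rep F g M) c ∈ relCochains k (rep F g M) (n + 1) :=
  d_mem_relCochains (fun _ _ => ⟨fun x z => by simp, fun x m => by simp⟩) hc

theorem theta_mem_fil {i : ℤ} {n : ℕ} (x : g) {c : g [⋀^Fin n]→ₗ[F] M} (hc : c ∈ fil M I i n) :
    theta (rep F g M) x c ∈ fil M I i n := by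
  intro v s hs hn
  rw [theta_apply, hc v s hs hn, map_zero, zero_sub, neg_eq_zero]
  refine Finset.sum_eq_zero fun l _ => hc _ s (fun i hi => ?_) hn
  rcases eq_or_ne i l with rfl | hl
  · rw [Function.update_self]
    exact lie_mem_right F g I x _ (hs i hi)
  · rw [Function.update_of_ne hl]
    exact hs i hi

/-- The differential preserves the filtration. -/
theorem d_mem_fil {i : ℤ} {n : ℕ} {c : g [⋀^Fin n]→ₗ[F] M} (hc : c ∈ fil M I i n) :
    d (rep F g M) c ∈ fil M I i (n + 1) := by
  have h1 : ∀ {i : ℤ} {n : ℕ}, fil M I i n ≤ fil M I (i - 1) n :=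
    fun {i n} => filt_anti (J := I.toSubmodule) (by simp) n
  induction n generalizing i with
  | zero =>
    refine (mem_filt_succ (J := I.toSubmodule)).2 ⟨fun x => ?_, fun y _ => ?_⟩ <;> rw [d_zero_cons]
    exacts [h1 (theta_mem_fil x hc), theta_mem_fil y hc]
  | succ n ih =>
    have hc' := (mem_filt_succ (J := I.toSubmodule)).1 hc
    refine (mem_filt_succ (J := I.toSubmodule)).2 ⟨fun x => ?_, fun y hy => ?_⟩ <;> rw [d_cons]
    · exact sub_mem (h1 (theta_mem_fil x hc)) (ih (hc'.1 x))
    · exact sub_mem (theta_mem_fil y hc) (ih (hc'.2 y hy))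

-- By the modular law, intersecting with Z a complement of B in all relative cochains gives a
-- complement of B in Z. It is used for coboundaries in cocycles and for cocycles in cochains.
include S in
theorem Splitting.exists_complement (hM : CochainsSemisimple M I k) {q : ℕ}
    {B Z : Submodule F (I [⋀^Fin q]→ₗ[F] M)} (hBZ : B ≤ Z)
    (hZ : Z ≤ relCochains (subI I k) (rep F I M) q)
    (hB : ∀ x, ∀ f ∈ B, S.actI M q x f ∈ B) :
    ∃ U : Submodule F Z, Disjoint (B.submoduleOf Z) U ∧ Codisjoint (B.submoduleOf Z) U ∧
      ∀ x ∈ subQuot I k, ∀ f f' : Z, S.actI M q x f = f' → f ∈ U → f' ∈ U := by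
  obtain ⟨U, hU, h1, h2⟩ := hM q B (hBZ.trans hZ) fun x hx f hf => by
    rw [S.thetaI_eq hx (hZ (hBZ hf))]
    exact hB _ f hf
  refine ⟨U.submoduleOf Z, ?_, ?_, ?_⟩
  · rw [Submodule.disjoint_def]
    intro x hx hx'
    have : x.1 ∈ B ⊓ U := ⟨hx, hx'⟩
    rw [h1] at this
    exact Subtype.ext this
  · rw [codisjoint_iff, eq_top_iff]
    intro x _
    obtain ⟨b, hb, u, hu, hbu⟩ := Submodule.mem_sup.1 (show x.1 ∈ B ⊔ U from h2 ▸ hZ x.2)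
    have hu' : u ∈ Z := by
      rw [← add_sub_cancel_left b u, hbu]
      exact sub_mem x.2 (hBZ hb)
    exact Submodule.mem_sup.2 ⟨⟨b, hBZ hb⟩, hb, ⟨u, hu'⟩, hu, Subtype.ext hbu⟩
  · rintro _ ⟨x, hx, rfl⟩ f f' hff hf
    change f'.1 ∈ U
    rw [← hff]
    exact hU _ (S.sec_mem_of_mem hx) _ hf

/-- A complement of the coboundaries in the cocycles gives a section of Z^q → H^q equivariant under
k/I_k; composing z with it keeps z relative. -/
theorem Splitting.exists_classOf_eq (hM : CochainsSemisimple M I k) {p q : ℕ}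
    {z : (g ⧸ I) [⋀^Fin p]→ₗ[F] Cohomology (subI I k) (rep F I M) q}
    (hz : z ∈ relCochains (subQuot I k) (S.action M q) p) :
    ∃ φ ∈ relCochains (subQuot I k) (S.actI M q) p,
      ∃ hφ : ∀ v, φ v ∈ cocycles (subI I k) (rep F I M) q, classOf φ hφ = z := by
  obtain ⟨U, hd, hc, hU⟩ := S.exists_complement hM (q := q) coboundaries_le_cocycles inf_le_left
    fun x f hf => S.thetaI_mem_coboundaries M (S.sec_mem x) hf
  have hker : LinearMap.ker (classMap M I k q) = (coboundaries (subI I k) (rep F I M) q).submoduleOf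
    (cocycles (subI I k) (rep F I M) q) := Submodule.ker_mkQ _
  obtain ⟨s, hs, hs'⟩ := exists_equivariant_section (f := classMap M I k q)
    (Submodule.mkQ_surjective _) (by rwa [hker]) (by rwa [hker])
  have hr := compAlternatingMap_mem_relCochains (ρW := S.actZ M q) (f := s) (fun x hx v =>
    hs' (S.actZ M q x) (S.action M q x) (S.classMap_actZ M x) (fun u hu => hU x hx u _ rfl hu) v) hz
  refine ⟨(cocycles (subI I k) (rep F I M) q).subtype.compAlternatingMap (s.compAlternatingMap z),
    compAlternatingMap_mem_relCochains (fun x _ => S.subtype_actZ M x) hr, fun v => (s (z v)).2, ?_⟩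
  ext1 v
  exact hs (z v)

/-- The same argument for d : C^q → B^{q+1}, whose kernel is the cocycles: an equivariant section
turns coboundary values into values of primitives, relative over g/I. -/
theorem Splitting.exists_comp_d_eq (hM : CochainsSemisimple M I k) {p q : ℕ}
    {φ : (g ⧸ I) [⋀^Fin p]→ₗ[F] (I [⋀^Fin (q + 1)]→ₗ[F] M)}
    (hr : φ ∈ relCochains (subQuot I k) (S.actI M (q + 1)) p)
    (hφ : ∀ v, φ v ∈ coboundaries (subI I k) (rep F I M) (q + 1)) :
    ∃ ω ∈ relCochains (subQuot I k) (S.actI M q) p,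
      (∀ v, ω v ∈ relCochains (subI I k) (rep F I M) q) ∧
      (d (rep F I M)).compAlternatingMap ω = φ := by
  obtain ⟨U, hd, hc, hU⟩ := S.exists_complement hM (q := q) (B := cocycles _ _ q) inf_le_left le_rfl
    fun x f hf => S.thetaI_mem_cocycles M (S.sec_mem x) hf
  let f : relCochains (subI I k) (rep F I M) q →ₗ[F] coboundaries (subI I k) (rep F I M) (q + 1) :=
    (d (rep F I M)).restrict fun e he => ⟨e, he, rfl⟩
  let actB : (g ⧸ I) →ₗ[F] Module.End F (coboundaries (subI I k) (rep F I M) (q + 1)) :=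
    subrep (S.actI M (q + 1)) _ fun x _ hf => S.thetaI_mem_coboundaries M (S.sec_mem x) hf
  have hker : LinearMap.ker f = (cocycles (subI I k) (rep F I M) q).submoduleOf
      (relCochains (subI I k) (rep F I M) q) := by
    ext e
    exact ⟨fun he => ⟨e.2, congrArg Subtype.val he⟩, fun he => Subtype.ext he.2⟩
  obtain ⟨s, hs, hs'⟩ := exists_equivariant_section (f := f)
    (by rintro ⟨_, e, he, rfl⟩; exact ⟨⟨e, he⟩, rfl⟩) (by rwa [hker])
      (by rwa [hker])
  have hr1 : φ.codRestrict _ hφ ∈ relCochains (subQuot I k) actB p :=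
    mem_relCochains_of_comp (f := (coboundaries (subI I k) (rep F I M) (q + 1)).subtype)
      (fun _ _ _ => rfl) Subtype.val_injective hr
  have hr2 := compAlternatingMap_mem_relCochains (ρW := S.actC M q) (f := s) (fun x hx v =>
    hs' (S.actC M q x) (actB x)
      (fun e => Subtype.ext (twist_d (isCompatible_I M I (S.sec x)) e.1).symm)
      (fun u hu => hU x hx u _ rfl hu) v) hr1
  refine ⟨(relCochains (subI I k) (rep F I M) q).subtype.compAlternatingMap
    (s.compAlternatingMap (φ.codRestrict _ hφ)),
    compAlternatingMap_mem_relCochains (fun x _ _ => rfl) hr2, fun v => (s _).2, ?_⟩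
  ext1 v
  exact congrArg Subtype.val (hs ⟨φ v, hφ v⟩)

/-- An element of `F_i` whose leading term takes values in the coboundaries lies in `F_{i+1} + d F_i`. -/
theorem Splitting.exists_sub_d_mem (hM : CochainsSemisimple M I k) {i q n : ℕ} (h : i + q = n + 1)
    {e : g [⋀^Fin (n + 1)]→ₗ[F] M} (he : e ∈ filRel M I k i (n + 1))
    (hB : ∀ v, S.comp M h e v ∈ coboundaries (subI I k) (rep F I M) q) :
    ∃ ω ∈ filRel M I k i n, e - d (rep F g M) ω ∈ filRel M I k (i + 1) (n + 1) := by
  cases q with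
  | zero =>
    refine ⟨0, zero_mem _, ?_⟩
    rw [map_zero, sub_zero]
    refine ⟨he.1, S.mem_fil_succ h he.2 ?_⟩
    ext1 v
    exact hB v
  | succ q =>
    obtain ⟨ω, hω, hω', hd⟩ := S.exists_comp_d_eq hM (S.comp_mem_relCochains h he.1) hB
    have hl : S.lift (by omega : i + q = n) hω' ∈ filRel M I k i n :=
      ⟨S.lift_mem_relCochains _ hω' hω, S.lift_mem_fil _ hω'⟩
    have hlead := S.comp_d_leading (by omega : i + q = n) hl.2
    rw [S.comp_lift, hd] at hlead
    have hdl := d_mem_fil hl.2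
    -- The factor (-1)^i cancels the sign in `comp_d_leading`, so that `e` and the differential of
    -- the correction have the same leading term.
    refine ⟨(-1 : ℤ) ^ i • S.lift (by omega : i + q = n) hω', zsmul_mem hl _, ?_⟩
    refine ⟨sub_mem he.1 (d_mem_relCochains_rep (zsmul_mem hl.1 _)), S.mem_fil_succ h ?_ ?_⟩
    · rw [map_zsmul]
      exact sub_mem he.2 (zsmul_mem hdl _)
    · rw [map_zsmul, map_sub, map_zsmul, hlead, smul_smul, ← mul_pow]
      simp

theorem mem_filRelD {r i : ℤ} {n : ℕ} {c : g [⋀^Fin n]→ₗ[F] M} :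
    c ∈ filRelD M I k r i n ↔
      c ∈ filRel M I k i n ∧ d (rep F g M) c ∈ filRel M I k (i + r) (n + 1) := Iff.rfl

/-- Lift a cocycle z to a cocycle-valued form φ and then to e in F_p with leading term φ. The next
component of de is dφ up to coboundaries, hence has coboundary values since dz = 0. A correction ω
in F_{p+1} then puts d(e - ω) into F_{p+2} and leaves the leading term unchanged. -/
theorem Splitting.psi_surjective (hM : CochainsSemisimple M I k) (p q : ℕ) :
    Function.Surjective (S.psi M p q) := by
  intro ζ
  obtain ⟨⟨z, hz, hdz⟩, rfl⟩ := Submodule.Quotient.mk_surjective _ ζ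
  obtain ⟨φ, hφ, hφZ, rfl⟩ := S.exists_classOf_eq hM hz
  have hφC := fun v => (hφZ v).1
  set e := S.lift (rfl : p + q = p + q) hφC with he
  have hcomp : S.comp M rfl e = φ := S.comp_lift rfl hφC
  have hel : e ∈ filRel M I k p (p + q) := ⟨S.lift_mem_relCochains _ hφC hφ, S.lift_mem_fil _ hφC⟩
  have hde : d (rep F g M) e ∈ filRel M I k (p + 1 : ℕ) (p + q + 1) := by
    refine ⟨d_mem_relCochains_rep hel.1, ?_⟩
    refine S.mem_fil_succ (by omega : p + (q + 1) = p + q + 1) (d_mem_fil hel.2) ?_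
    rw [S.comp_d_leading rfl hel.2, hcomp]
    ext1 v
    rw [AlternatingMap.smul_apply, LinearMap.compAlternatingMap_apply, (hφZ v).2]
    simp
  -- The component of de of bidegree (p+1, q) has coboundary values: it differs from dφ by
  -- coboundaries, and the class of dφ is dz = 0.
  obtain ⟨ω, hω, hdω⟩ := S.exists_sub_d_mem hM (by omega : p + 1 + q = p + q + 1) hde (fun v => by
    have h1 := S.d_comp_sub_mem rfl hel v
    rw [hcomp] at h1
    have h2 := mem_coboundaries_of_comp_classMap_eq_zero (ζ := d (S.actZ M q) (φ.codRestrict _ hφZ))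
      (by rw [compAlternatingMap_d fun x z => S.classMap_actZ M x z]; exact hdz) v
    have h3 := congrArg (fun f => f v) (S.subtype_comp_d_codRestrict hφZ)
    have h4 : d (S.actI M q) φ v ∈ coboundaries (subI I k) (rep F I M) q := by
      rw [← h3]
      exact h2
    simpa using sub_mem h4 h1)
  have hω' : ω ∈ filRel M I k p (p + q) :=
    ⟨hω.1, filt_anti (J := I.toSubmodule) (by simp) _ hω.2⟩
  refine ⟨Page.mk M I k ⟨e - ω, mem_filRelD.2 ⟨sub_mem hel hω', ?_⟩⟩, ?_⟩
  · rw [map_sub]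
    have : ((p + 1 : ℕ) : ℤ) + 1 = p + (2 : ℕ) := by push_cast; ring
    rwa [this] at hdω
  · rw [S.psi_mk]
    congr 1
    ext1
    change classOf (S.comp M rfl (e - ω)) _ = classOf φ hφZ
    have : S.comp M (rfl : p + q = p + q) (e - ω) = φ := by
      rw [map_sub, hcomp, S.comp_eq_zero _ (by simp) hω.2, sub_zero]
    simp only [this]

/-- If the class of the leading term of c is dη, lift η to a cochain e in F_{p-1}; then c and de
have leading terms of the same class. For p = 0 the class itself is zero and e = 0 suffices. -/
theorem Splitting.exists_comp_sub_d_mem (hM : CochainsSemisimple M I k) {p q n : ℕ}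
    (h : p + q = n + 1) {c : g [⋀^Fin (n + 1)]→ₗ[F] M}
    (hZ : ∀ v, S.comp M h c v ∈ cocycles (subI I k) (rep F I M) q)
    (h0 : classOf (S.comp M h c) hZ ∈ coboundaries (subQuot I k) (S.action M q) p) :
    ∃ e ∈ filRel M I k (p - 1) n, d (rep F g M) e ∈ filRel M I k p (n + 1) ∧
      ∀ v, S.comp M h (c - d (rep F g M) e) v ∈ coboundaries (subI I k) (rep F I M) q := by
  cases p with
  | zero =>
    refine ⟨0, zero_mem _, by rw [map_zero]; exact zero_mem _, fun v => ?_⟩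
    rw [map_zero, sub_zero]
    exact mem_coboundaries_of_comp_classMap_eq_zero (ζ := (S.comp M h c).codRestrict _ hZ) h0 v
  | succ p =>
    obtain ⟨η, hη, hdη⟩ := h0
    obtain ⟨φ, hφ, hφZ, rfl⟩ := S.exists_classOf_eq hM hη
    have hφC := fun v => (hφZ v).1
    have hpq : p + q = n := by omega
    have hp : ((p + 1 : ℕ) : ℤ) - 1 = p := by push_cast; ring
    set e := S.lift hpq hφC with he
    have hcomp : S.comp M hpq e = φ := S.comp_lift hpq hφC
    have hel : e ∈ filRel M I k p n := ⟨S.lift_mem_relCochains _ hφC hφ, S.lift_mem_fil _ hφC⟩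
    have hde : d (rep F g M) e ∈ filRel M I k (p + 1 : ℕ) (n + 1) := by
      refine ⟨d_mem_relCochains_rep hel.1, ?_⟩
      refine S.mem_fil_succ (by omega : p + (q + 1) = n + 1) (d_mem_fil hel.2) ?_
      rw [S.comp_d_leading hpq hel.2, hcomp]
      ext1 v
      rw [AlternatingMap.smul_apply, LinearMap.compAlternatingMap_apply, (hφZ v).2]
      simp
    refine ⟨e, by rwa [hp], hde, fun v => ?_⟩
    have hZ' : ∀ v, S.comp M h (d (rep F g M) e) v ∈ cocycles (subI I k) (rep F I M) q :=
      S.comp_mem_cocycles h hde (by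
        rw [d_d _ (rep_lie M)]
        exact zero_mem _)
    -- The leading term of de has class dη, which by hypothesis is the class of the leading term of
    -- c.
    rw [S.d_classOf hφZ hZ' (fun v => by rw [← hcomp]; exact S.d_comp_sub_mem hpq hel v)] at hdη
    refine mem_coboundaries_of_comp_classMap_eq_zero (ζ := (S.comp M h c).codRestrict _ hZ -
      (S.comp M h (d (rep F g M) e)).codRestrict _ hZ') ?_ v
    ext1 v
    have h1 := congrArg (fun f => f v) hdη
    exact (map_sub (classMap M I k q) _ _).trans (sub_eq_zero.2 h1.symm)

/-- Two corrections are subtracted: de, which makes the class of the leading term vanish, and dω,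
which then removes the leading term. So c - d(e + ω) lies in F_{p+1}, with the same differential as
c, and e + ω lies in F_{p-1}(1). -/
theorem Splitting.mem_pageDenom (hM : CochainsSemisimple M I k) {p q n : ℕ} (h : p + q = n)
    {c : g [⋀^Fin n]→ₗ[F] M} (hc : c ∈ filRelD M I k (2 : ℕ) p n)
    (hZ : ∀ v, S.comp M h c v ∈ cocycles (subI I k) (rep F I M) q)
    (h0 : classOf (S.comp M h c) hZ ∈ coboundaries (subQuot I k) (S.action M q) p) :
    c ∈ pageDenom M I k (2 : ℕ) p n := by
  obtain ⟨hc, hdc⟩ := mem_filRelD.1 hc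
  have h1 : (p : ℤ) + 1 + ((2 : ℕ) - 1) = p + (2 : ℕ) := by ring
  cases n with
  | zero =>
    obtain ⟨rfl, rfl⟩ : p = 0 ∧ q = 0 := by omega
    refine Submodule.mem_sup_left (mem_filRelD.2 ⟨⟨hc.1, S.mem_fil_succ h hc.2 ?_⟩, by rwa [h1]⟩)
    ext1 v
    exact mem_coboundaries_of_comp_classMap_eq_zero (ζ := (S.comp M h c).codRestrict _ hZ) h0 v
  | succ n =>
    obtain ⟨e, he, hde, hB⟩ := S.exists_comp_sub_d_mem hM h hZ h0
    obtain ⟨ω, hω, hsub⟩ := S.exists_sub_d_mem hM h (sub_mem hc hde) hB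
    have h2 : (p : ℤ) - (2 : ℕ) + 1 = p - 1 := by push_cast; ring
    have h3 : (p : ℤ) - 1 + ((2 : ℕ) - 1) = p := by push_cast; ring
    rw [sub_sub, ← map_add] at hsub
    refine Submodule.mem_sup.2 ⟨c - d (rep F g M) (e + ω), mem_filRelD.2 ⟨hsub, ?_⟩,
      d (rep F g M) (e + ω), ⟨e + ω, mem_filRelD.2 ⟨?_, ?_⟩, rfl⟩, sub_add_cancel _ _⟩
    · rwa [map_sub, d_d _ (rep_lie M), sub_zero, h1]
    · rw [h2]
      exact add_mem he ⟨hω.1, filt_anti (J := I.toSubmodule) (by simp) _ hω.2⟩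
    · rw [h2, h3, ← sub_sub_cancel c (d (rep F g M) (e + ω))]
      exact sub_mem hc ⟨hsub.1, filt_anti (J := I.toSubmodule) (by simp) _ hsub.2⟩

theorem Splitting.psi_injective (hM : CochainsSemisimple M I k) (p q : ℕ) :
    Function.Injective (S.psi M p q) := by
  rw [injective_iff_map_eq_zero]
  intro ζ hζ
  obtain ⟨c, rfl⟩ := Submodule.Quotient.mk_surjective _ ζ
  replace hζ : Cohomology.mk (subQuot I k) (S.action M q) (S.psiCochain M p q c) = 0 :=
    (S.psi_mk M c).symm.trans hζ
  rw [Cohomology.mk_eq_zero_iff] at hζ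
  refine (Page.mk_eq_zero_iff I k c).2 ?_
  exact S.mem_pageDenom hM rfl c.2 (S.comp_mem_cocycles_of_filRelD M c) hζ

theorem Splitting.psi_bijective (hM : CochainsSemisimple M I k) (p q : ℕ) :
    Function.Bijective (S.psi M p q) :=
  ⟨S.psi_injective hM p q, S.psi_surjective hM p q⟩

end Semisimple

end

/-! ### Pairings of subquotients and of relative cohomology -/

section

variable {F : Type*} [Field F]

/-- A bilinear map induces a pairing of subquotients. -/
theorem exists_pairing {A B C : Type*} [AddCommGroup A] [Module F A] [AddCommGroup B] [Module F B]
    [AddCommGroup C] [Module F C] (f : A →ₗ[F] B →ₗ[F] C) {ZA DA : Submodule F A}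
    {ZB DB : Submodule F B} {ZC DC : Submodule F C} (hZ : ∀ a ∈ ZA, ∀ b ∈ ZB, f a b ∈ ZC)
    (hl : ∀ a ∈ ZA, a ∈ DA → ∀ b ∈ ZB, f a b ∈ DC) (hr : ∀ a ∈ ZA, ∀ b ∈ ZB, b ∈ DB → f a b ∈ DC) :
    ∃ β : (ZA ⧸ DA.submoduleOf ZA) ⊗[F] (ZB ⧸ DB.submoduleOf ZB) →ₗ[F] ZC ⧸ DC.submoduleOf ZC,
      ∀ (a : ZA) (b : ZB), ∃ c : ZC, c.1 = f a.1 b.1 ∧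
        β ((Submodule.Quotient.mk a : ZA ⧸ DA.submoduleOf ZA) ⊗ₜ
          (Submodule.Quotient.mk b : ZB ⧸ DB.submoduleOf ZB)) = Submodule.Quotient.mk c := by
  let f₁ : ZA →ₗ[F] ZB →ₗ[F] ZC :=
    LinearMap.mk₂ F (fun a b => ⟨f a.1 b.1, hZ _ a.2 _ b.2⟩)
      (fun _ _ _ => Subtype.ext (by simp)) (fun _ _ _ => Subtype.ext (by simp))
      (fun _ _ _ => Subtype.ext (by simp)) (fun _ _ _ => Subtype.ext (by simp))
  let f₂ : ZA →ₗ[F] (ZB ⧸ DB.submoduleOf ZB) →ₗ[F] ZC ⧸ DC.submoduleOf ZC :=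
    { toFun := fun a => Submodule.mapQ _ _ (f₁ a) fun b hb => hr _ a.2 _ b.2 hb
      map_add' := fun a a' => Submodule.linearMap_qext _ (LinearMap.ext fun b =>
        congrArg (DC.submoduleOf ZC).mkQ (LinearMap.map_add₂ f₁ a a' b))
      map_smul' := fun c a => Submodule.linearMap_qext _ (LinearMap.ext fun b =>
        congrArg (DC.submoduleOf ZC).mkQ (LinearMap.map_smul₂ f₁ c a b)) }
  refine ⟨TensorProduct.lift (Submodule.liftQ _ f₂ fun a ha => ?_), fun a b => ⟨f₁ a b, rfl, rfl⟩⟩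
  refine LinearMap.mem_ker.2 (Submodule.linearMap_qext _ (LinearMap.ext fun b => ?_))
  exact (Submodule.Quotient.mk_eq_zero (DC.submoduleOf ZC)).2 (hl _ a.2 ha _ b.2)

section Cohomology

variable {L : Type*} [LieRing L] [LieAlgebra F L] {V W U : Type*} [AddCommGroup V] [Module F V]
  [AddCommGroup W] [Module F W] [AddCommGroup U] [Module F U] {K : LieSubalgebra F L}
  {ρV : L →ₗ[F] Module.End F V} {ρW : L →ₗ[F] Module.End F W} {ρU : L →ₗ[F] Module.End F U}
  {τ : V ⊗[F] W →ₗ[F] U}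

section

variable (hτ : ∀ x v w, ρU x (τ (v ⊗ₜ w)) = τ (ρV x v ⊗ₜ w) + τ (v ⊗ₜ ρW x w)) {p q n : ℕ}
  (h : p + q = n) {a : L [⋀^Fin p]→ₗ[F] V} {b : L [⋀^Fin q]→ₗ[F] W}

include hτ

theorem cup_mem_cocycles (ha : a ∈ cocycles K ρV p) (hb : b ∈ cocycles K ρW q) :
    cup τ h a b ∈ cocycles K ρU n := by
  refine ⟨cup_mem_relCochains τ (fun x _ => hτ x) h ha.1 hb.1, ?_⟩
  rw [SetLike.mem_coe, LinearMap.mem_ker, d_cup τ hτ, LinearMap.mem_ker.1 ha.2,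
    LinearMap.mem_ker.1 hb.2, cup_left_zero, cup_right_zero, smul_zero, add_zero]

theorem cup_mem_coboundaries_left (ha : a ∈ coboundaries K ρV p) (hb : b ∈ cocycles K ρW q) :
    cup τ h a b ∈ coboundaries K ρU n := by
  cases p with
  | zero =>
    rw [show a = 0 from ha, cup_left_zero]
    exact zero_mem _
  | succ p =>
    obtain ⟨n, rfl⟩ : ∃ m, n = m + 1 := ⟨p + q, by omega⟩
    obtain ⟨e, he, rfl⟩ := ha
    refine ⟨cup τ (by omega : p + q = n) e b,
      cup_mem_relCochains τ (fun x _ => hτ x) _ he hb.1, ?_⟩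
    rw [d_cup τ hτ, LinearMap.mem_ker.1 hb.2, cup_right_zero, smul_zero, add_zero]

theorem cup_mem_coboundaries_right (ha : a ∈ cocycles K ρV p) (hb : b ∈ coboundaries K ρW q) :
    cup τ h a b ∈ coboundaries K ρU n := by
  cases q with
  | zero =>
    rw [show b = 0 from hb, cup_right_zero]
    exact zero_mem _
  | succ q =>
    obtain ⟨n, rfl⟩ : ∃ m, n = m + 1 := ⟨p + q, by omega⟩
    obtain ⟨e, he, rfl⟩ := hb
    -- The sign undoes the one in d(a ∪ e) = (-1)^p a ∪ de, valid because da = 0.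
    refine ⟨(-1 : ℤ) ^ p • cup τ (by omega : p + q = n) a e,
      zsmul_mem (cup_mem_relCochains τ (fun x _ => hτ x) _ ha.1 he) _, ?_⟩
    rw [map_zsmul, d_cup τ hτ, LinearMap.mem_ker.1 ha.2, cup_left_zero, zero_add, smul_smul,
      ← mul_pow]
    simp

end

/-- The cup product of relative cohomology exists. -/
theorem exists_isCupProduct
    (hτ : ∀ x v w, ρU x (τ (v ⊗ₜ w)) = τ (ρV x v ⊗ₜ w) + τ (v ⊗ₜ ρW x w)) :
    ∃ β : ∀ p q, Cohomology K ρV p ⊗[F] Cohomology K ρW q →ₗ[F] Cohomology K ρU (p + q),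
      IsCupProduct K ρV ρW ρU τ β := by
  choose β hβ using fun p q : ℕ => exists_pairing (cupLin τ (rfl : p + q = p + q))
    (fun a ha b hb => cup_mem_cocycles hτ rfl ha hb)
    (fun a _ ha b hb => cup_mem_coboundaries_left hτ rfl ha hb)
    (fun a ha b _ hb => cup_mem_coboundaries_right hτ rfl ha hb)
  exact ⟨β, hβ⟩

end Cohomology

variable {g : Type*} [LieRing g] [LieAlgebra F g] {I : LieIdeal F g} {k : LieSubalgebra F g}
  {M N P : Type*} [AddCommGroup M] [Module F M] [LieRingModule g M] [LieModule F g M]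
  [AddCommGroup N] [Module F N] [LieRingModule g N] [LieModule F g N]
  [AddCommGroup P] [Module F P] [LieRingModule g P] [LieModule F g P]
  (μ : M ⊗[F] N →ₗ⁅F,g⁆ P)

omit [LieModule F g P] in
theorem map_lie_tmul (x : g) (m : M) (n : N) :
    ⁅x, μ (m ⊗ₜ n)⁆ = μ (⁅x, m⁆ ⊗ₜ n) + μ (m ⊗ₜ ⁅x, n⁆) := by
  rw [← LieModuleHom.map_lie, TensorProduct.LieModule.lie_tmul_right, map_add]

/-! ### Products on the pages of the spectral sequence -/

section Pages

theorem cup_mem_filRel {i₁ i₂ i : ℤ} (hi : i₁ + i₂ = i) {n₁ n₂ n : ℕ} (hn : n₁ + n₂ = n)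
    {a : g [⋀^Fin n₁]→ₗ[F] M} {b : g [⋀^Fin n₂]→ₗ[F] N} (ha : a ∈ filRel M I k i₁ n₁)
    (hb : b ∈ filRel N I k i₂ n₂) :
    cup (μ : M ⊗[F] N →ₗ[F] P) hn a b ∈ filRel P I k i n :=
  ⟨cup_mem_relCochains _ (fun x _ m n => map_lie_tmul μ x m n) hn ha.1 hb.1,
    cup_mem_filt (J := I.toSubmodule) _ hn hi ha.2 hb.2⟩

theorem filRel_anti {i i' : ℤ} (h : i ≤ i') (n : ℕ) : filRel M I k i' n ≤ filRel M I k i n :=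
  fun _ hc => ⟨hc.1, filt_anti (J := I.toSubmodule) h n hc.2⟩

theorem d_cup_rep {n₁ n₂ n : ℕ} (hn : n₁ + n₂ = n) (a : g [⋀^Fin n₁]→ₗ[F] M)
    (b : g [⋀^Fin n₂]→ₗ[F] N) :
    d (rep F g P) (cup (μ : M ⊗[F] N →ₗ[F] P) hn a b) =
      cup (μ : M ⊗[F] N →ₗ[F] P) (succ_add_eq hn) (d (rep F g M) a) b +
        (-1 : ℤ) ^ n₁ • cup (μ : M ⊗[F] N →ₗ[F] P) (add_succ_eq hn) a
          (d (rep F g N) b) :=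
  d_cup _ (fun x m n => map_lie_tmul μ x m n) hn a b

theorem cup_mem_filRelD {r i₁ i₂ i : ℤ} (hi : i₁ + i₂ = i) {n₁ n₂ n : ℕ} (hn : n₁ + n₂ = n)
    {a : g [⋀^Fin n₁]→ₗ[F] M} {b : g [⋀^Fin n₂]→ₗ[F] N} (ha : a ∈ filRelD M I k r i₁ n₁)
    (hb : b ∈ filRelD N I k r i₂ n₂) :
    cup (μ : M ⊗[F] N →ₗ[F] P) hn a b ∈ filRelD P I k r i n := by
  rw [mem_filRelD] at *
  refine ⟨cup_mem_filRel μ hi hn ha.1 hb.1, ?_⟩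
  rw [d_cup_rep]
  exact add_mem (cup_mem_filRel μ (by omega) _ ha.2 hb.1)
    (zsmul_mem (cup_mem_filRel μ (by omega) _ ha.1 hb.2) _)

/-- The summand of filtration i₁ + 1 is immediate. For a boundary, de ∪ b = d(e ∪ b) - (±1) e ∪ db
with e in F_{i₁-r+1} and db in F_{i₂+r}. So e ∪ db lies in F_{i+1}(r-1), and e ∪ b lies in
F_{i-r+1}(r-1). -/
theorem cup_mem_pageDenom_left {r i₁ i₂ i : ℤ} (hi : i₁ + i₂ = i) {n₁ n₂ n : ℕ} (hn : n₁ + n₂ = n)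
    {a : g [⋀^Fin n₁]→ₗ[F] M} {b : g [⋀^Fin n₂]→ₗ[F] N} (ha : a ∈ pageDenom M I k r i₁ n₁)
    (hb : b ∈ filRelD N I k r i₂ n₂) :
    cup (μ : M ⊗[F] N →ₗ[F] P) hn a b ∈ pageDenom P I k r i n := by
  rw [mem_filRelD] at hb
  obtain ⟨a, ha', e, he, rfl⟩ := Submodule.mem_sup.1 ha
  replace ha := mem_filRelD.1 ha'
  rw [cup_add_left]
  refine add_mem (Submodule.mem_sup_left (mem_filRelD.2
    ⟨cup_mem_filRel μ (by omega) hn ha.1 hb.1, ?_⟩)) ?_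
  · rw [d_cup_rep]
    -- The bound needed is i + r: da has index i₁ + 1 + (r - 1) = i₁ + r, while the other term even
    -- lies one step deeper.
    exact add_mem (cup_mem_filRel μ (by omega) _ ha.2 hb.1) (zsmul_mem (filRel_anti (by omega) _
      (cup_mem_filRel μ (rfl : i₁ + 1 + (i₂ + r) = _) _ ha.1 hb.2)) _)
  cases n₁ with
  | zero =>
    rw [show e = 0 from he, cup_left_zero]
    exact zero_mem _
  | succ n₁ =>
    obtain ⟨n, rfl⟩ : ∃ m, n = m + 1 := ⟨n₁ + n₂, by omega⟩
    obtain ⟨e, he, rfl⟩ := he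
    obtain ⟨he, hde⟩ := mem_filRelD.1 he
    have hn' : n₁ + n₂ = n := by omega
    have h1 := d_cup_rep μ hn' e b
    have h2 : cup (μ : M ⊗[F] N →ₗ[F] P) (by omega : n₁ + (n₂ + 1) = n + 1) e (d (rep F g N) b) ∈
        filRelD P I k (r - 1) (i + 1) (n + 1) := by
      refine mem_filRelD.2 ⟨cup_mem_filRel μ (by omega) _ he hb.2, ?_⟩
      rw [d_cup_rep, d_d _ (rep_lie N), cup_right_zero, smul_zero, add_zero]
      exact cup_mem_filRel μ (by omega) _ hde hb.2
    rw [eq_sub_of_add_eq h1.symm]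
    refine sub_mem (Submodule.mem_sup_right ⟨_, mem_filRelD.2
      ⟨cup_mem_filRel μ (by omega) hn' he hb.1, ?_⟩, rfl⟩)
      (zsmul_mem (Submodule.mem_sup_left h2) _)
    rw [d_cup_rep]
    exact add_mem (cup_mem_filRel μ (by omega) _ hde hb.1)
      (zsmul_mem (filRel_anti (by omega) _ (mem_filRelD.1 h2).1) _)

theorem cup_mem_pageDenom_right {r i₁ i₂ i : ℤ} (hi : i₁ + i₂ = i) {n₁ n₂ n : ℕ} (hn : n₁ + n₂ = n)
    {a : g [⋀^Fin n₁]→ₗ[F] M} {b : g [⋀^Fin n₂]→ₗ[F] N} (ha : a ∈ filRelD M I k r i₁ n₁)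
    (hb : b ∈ pageDenom N I k r i₂ n₂) :
    cup (μ : M ⊗[F] N →ₗ[F] P) hn a b ∈ pageDenom P I k r i n := by
  rw [mem_filRelD] at ha
  obtain ⟨b, hb', e, he, rfl⟩ := Submodule.mem_sup.1 hb
  replace hb := mem_filRelD.1 hb'
  rw [cup_add_right]
  refine add_mem (Submodule.mem_sup_left (mem_filRelD.2
    ⟨cup_mem_filRel μ (by omega) hn ha.1 hb.1, ?_⟩)) ?_
  · rw [d_cup_rep]
    exact add_mem (filRel_anti (by omega) _
      (cup_mem_filRel μ (rfl : i₁ + r + (i₂ + 1) = _) _ ha.2 hb.1))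
      (zsmul_mem (cup_mem_filRel μ (by omega) _ ha.1 hb.2) _)
  cases n₂ with
  | zero =>
    rw [show e = 0 from he, cup_right_zero]
    exact zero_mem _
  | succ n₂ =>
    obtain ⟨n, rfl⟩ : ∃ m, n = m + 1 := ⟨n₁ + n₂, by omega⟩
    obtain ⟨e, he, rfl⟩ := he
    obtain ⟨he, hde⟩ := mem_filRelD.1 he
    have hn' : n₁ + n₂ = n := by omega
    have h1 := d_cup_rep μ hn' a e
    have h2 : cup (μ : M ⊗[F] N →ₗ[F] P) (by omega : n₁ + 1 + n₂ = n + 1) (d (rep F g M) a) e ∈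
        filRelD P I k (r - 1) (i + 1) (n + 1) := by
      refine mem_filRelD.2 ⟨cup_mem_filRel μ (by omega) _ ha.2 he, ?_⟩
      rw [d_cup_rep, d_d _ (rep_lie M), cup_left_zero, zero_add]
      exact zsmul_mem (cup_mem_filRel μ (by omega) _ ha.2 hde) _
    -- The Leibniz rule solved for a ∪ de; the sign (-1)^{n₁} is its own inverse.
    have h3 : cup (μ : M ⊗[F] N →ₗ[F] P) hn a (d (rep F g N) e) = (-1 : ℤ) ^ n₁ •
        (d (rep F g P) (cup (μ : M ⊗[F] N →ₗ[F] P) hn' a e) -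
          cup (μ : M ⊗[F] N →ₗ[F] P) (by omega : n₁ + 1 + n₂ = n + 1) (d (rep F g M) a) e) := by
      rw [h1, add_sub_cancel_left, smul_smul, ← mul_pow]
      simp
    rw [h3]
    have h4 : d (rep F g P) (cup (μ : M ⊗[F] N →ₗ[F] P) hn' a e) ∈
        filRelB P I k (r - 1) (i - r + 1) (n + 1) := by
      refine ⟨_, mem_filRelD.2 ⟨cup_mem_filRel μ (by omega) hn' ha.1 he, ?_⟩, rfl⟩
      rw [d_cup_rep]
      exact add_mem (filRel_anti (by omega) _ (mem_filRelD.1 h2).1)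
        (zsmul_mem (cup_mem_filRel μ (by omega) _ ha.1 hde) _)
    exact zsmul_mem (sub_mem (Submodule.mem_sup_right h4) (Submodule.mem_sup_left h2)) _

variable (I k)

/-- The cup product of cochains induces pairings of the pages. -/
theorem exists_isPageCupProduct : ∃ β : PagePairing M I k N P, IsPageCupProduct I k μ β := by
  choose β hβ using fun (r : ℕ) (p₁ : ℤ) (n₁ : ℕ) (p₂ : ℤ) (n₂ : ℕ) (p : ℤ) (n : ℕ)
      (hp : p₁ + p₂ = p) (hn : n₁ + n₂ = n) =>
    exists_pairing (cupLin (μ : M ⊗[F] N →ₗ[F] P) hn) (ZA := filRelD M I k r p₁ n₁)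
      (ZB := filRelD N I k r p₂ n₂) (ZC := filRelD P I k r p n) (DA := pageDenom M I k r p₁ n₁)
      (DB := pageDenom N I k r p₂ n₂) (DC := pageDenom P I k r p n)
      (fun a ha b hb => cup_mem_filRelD μ hp hn ha hb)
      (fun a _ ha b hb => cup_mem_pageDenom_left μ hp hn ha hb)
      (fun a ha b _ hb => cup_mem_pageDenom_right μ hp hn ha hb)
  exact ⟨β, hβ⟩

variable {I k μ}

/-- The differentials of the pages are derivations. -/
theorem IsPageCupProduct.pageD_cup {β : PagePairing M I k N P} (hβ : IsPageCupProduct I k μ β)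
    (r : ℕ) (p₁ : ℤ) (n₁ : ℕ) (p₂ : ℤ) (n₂ : ℕ) (p : ℤ) (n : ℕ) (hp : p₁ + p₂ = p)
    (hn : n₁ + n₂ = n) (hp₁ : p₁ + r + p₂ = p + r) (hn₁ : n₁ + 1 + n₂ = n + 1)
    (hp₂ : p₁ + (p₂ + r) = p + r) (hn₂ : n₁ + (n₂ + 1) = n + 1) (e : Page M I k r p₁ n₁) (e' : Page N I k r p₂ n₂) :
    pageD P I k r p n (β r p₁ n₁ p₂ n₂ p n hp hn (e ⊗ₜ e')) =
      β r (p₁ + r) (n₁ + 1) p₂ n₂ (p + r) (n + 1) hp₁ hn₁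
          (pageD M I k r p₁ n₁ e ⊗ₜ e') +
        (-1 : ℤ) ^ n₁ • β r p₁ n₁ (p₂ + r) (n₂ + 1) (p + r) (n + 1) hp₂ hn₂
            (e ⊗ₜ pageD N I k r p₂ n₂ e') := by
  obtain ⟨a, rfl⟩ := Submodule.Quotient.mk_surjective _ e
  obtain ⟨b, rfl⟩ := Submodule.Quotient.mk_surjective _ e'
  have hda : d (rep F g M) a.1 ∈ filRelD M I k r (p₁ + r) (n₁ + 1) :=
    mem_filRelD.2 ⟨(mem_filRelD.1 a.2).2, by rw [d_d _ (rep_lie M)]; exact zero_mem _⟩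
  have hdb : d (rep F g N) b.1 ∈ filRelD N I k r (p₂ + r) (n₂ + 1) :=
    mem_filRelD.2 ⟨(mem_filRelD.1 b.2).2, by rw [d_d _ (rep_lie N)]; exact zero_mem _⟩
  obtain ⟨c, hc, hc'⟩ := hβ r p₁ n₁ p₂ n₂ p n hp hn a b
  obtain ⟨c₁, hc₁, hc₁'⟩ := hβ r (p₁ + r) (n₁ + 1) p₂ n₂ (p + r) (n + 1) hp₁ hn₁
    ⟨_, hda⟩ b
  obtain ⟨c₂, hc₂, hc₂'⟩ := hβ r p₁ n₁ (p₂ + r) (n₂ + 1) (p + r) (n + 1) hp₂ hn₂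
    a ⟨_, hdb⟩
  have hdc : d (rep F g P) c.1 ∈ filRelD P I k r (p + r) (n + 1) :=
    mem_filRelD.2 ⟨(mem_filRelD.1 c.2).2, by rw [d_d _ (rep_lie P)]; exact zero_mem _⟩
  have e1 : pageD M I k r p₁ n₁ (Page.mk M I k a) = Page.mk M I k ⟨_, hda⟩ := rfl
  have e2 : pageD N I k r p₂ n₂ (Page.mk N I k b) = Page.mk N I k ⟨_, hdb⟩ := rfl
  have e3 : pageD P I k r p n (Page.mk P I k c) = Page.mk P I k ⟨_, hdc⟩ := rfl
  have e4 : (⟨_, hdc⟩ : filRelD P I k r (p + r) (n + 1)) = c₁ + (-1 : ℤ) ^ n₁ • c₂ := by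
    apply Subtype.ext
    change d (rep F g P) c.1 = c₁.1 + (-1 : ℤ) ^ n₁ • c₂.1
    rw [hc, hc₁, hc₂, d_cup_rep]
  change pageD P I k r p n (β r p₁ n₁ p₂ n₂ p n hp hn (Page.mk M I k a ⊗ₜ Page.mk N I k b)) =
    β r (p₁ + r) (n₁ + 1) p₂ n₂ (p + r) (n + 1) hp₁ hn₁
      (pageD M I k r p₁ n₁ (Page.mk M I k a) ⊗ₜ Page.mk N I k b) +
    (-1 : ℤ) ^ n₁ • β r p₁ n₁ (p₂ + r) (n₂ + 1) (p + r) (n + 1) hp₂ hn₂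
      (Page.mk M I k a ⊗ₜ pageD N I k r p₂ n₂ (Page.mk N I k b))
  rw [e1, e2, hc', hc₁', hc₂', e3, e4]
  rfl

end Pages

/-! ### Comparison of the two products through ψ -/

section Comparison

variable (S : Splitting I k) {μ}

theorem thetaI_cup {q₁ q₂ n : ℕ} (h : q₁ + q₂ = n) (x : g) (a : I [⋀^Fin q₁]→ₗ[F] M)
    (b : I [⋀^Fin q₂]→ₗ[F] N) :
    thetaI P I x (cup (μ : M ⊗[F] N →ₗ[F] P) h a b) =
      cup (μ : M ⊗[F] N →ₗ[F] P) h (thetaI M I x a) b +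
        cup (μ : M ⊗[F] N →ₗ[F] P) h a (thetaI N I x b) :=
  twist_cup _ (fun m n => map_lie_tmul μ x m n) h a b

variable {cupI : ∀ q₁ q₂ : ℕ, Cohomology (subI I k) (rep F I M) q₁ ⊗[F]
    Cohomology (subI I k) (rep F I N) q₂ →ₗ[F] Cohomology (subI I k) (rep F I P) (q₁ + q₂)}
  (hI : IsCupProduct (subI I k) (rep F I M) (rep F I N) (rep F I P) (μ : M ⊗[F] N →ₗ[F] P) cupI)

include hI

/-- On representatives x acts through θ_{x^+}, a derivation of the cup product. This is all that the
pairing over g/I needs: its construction uses the Leibniz rule but not d ∘ d = 0. -/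
theorem IsCupProduct.action_cup (q₁ q₂ : ℕ) (x : g ⧸ I)
    (v : Cohomology (subI I k) (rep F I M) q₁) (w : Cohomology (subI I k) (rep F I N) q₂) :
    S.action P (q₁ + q₂) x (cupI q₁ q₂ (v ⊗ₜ w)) =
      cupI q₁ q₂ (S.action M q₁ x v ⊗ₜ w) + cupI q₁ q₂ (v ⊗ₜ S.action N q₂ x w) := by
  obtain ⟨a, rfl⟩ := Submodule.Quotient.mk_surjective _ v
  obtain ⟨b, rfl⟩ := Submodule.Quotient.mk_surjective _ w
  obtain ⟨c, hc, hc'⟩ := hI q₁ q₂ a b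
  obtain ⟨c₁, hc₁, hc₁'⟩ := hI q₁ q₂ (S.actZ M q₁ x a) b
  obtain ⟨c₂, hc₂, hc₂'⟩ := hI q₁ q₂ a (S.actZ N q₂ x b)
  have e : S.actZ P (q₁ + q₂) x c = c₁ + c₂ := by
    apply Subtype.ext
    change thetaI P I (S.sec x) c.1 = c₁.1 + c₂.1
    rw [hc, hc₁, hc₂]
    exact thetaI_cup rfl (S.sec x) a.1 b.1
  change S.action P (q₁ + q₂) x (cupI q₁ q₂ (classMap M I k q₁ a ⊗ₜ classMap N I k q₂ b)) =
    cupI q₁ q₂ (S.action M q₁ x (classMap M I k q₁ a) ⊗ₜ classMap N I k q₂ b) +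
      cupI q₁ q₂ (classMap M I k q₁ a ⊗ₜ S.action N q₂ x (classMap N I k q₂ b))
  rw [← S.classMap_actZ, ← S.classMap_actZ]
  refine (congrArg (S.action P (q₁ + q₂) x) hc').trans (Eq.trans ?_
    (congrArg₂ (· + ·) hc₁' hc₂').symm)
  refine Eq.trans (S.classMap_actZ P x c).symm ?_
  rw [e]
  rfl

/-- The cup product of leading terms with values in the cohomology of `I`. -/
theorem IsCupProduct.classOf_cup {p₁ q₁ p₂ q₂ p : ℕ} (hp : p₁ + p₂ = p)
    {φ : (g ⧸ I) [⋀^Fin p₁]→ₗ[F] (I [⋀^Fin q₁]→ₗ[F] M)}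
    {φ' : (g ⧸ I) [⋀^Fin p₂]→ₗ[F] (I [⋀^Fin q₂]→ₗ[F] N)}
    (hφ : ∀ v, φ v ∈ cocycles (subI I k) (rep F I M) q₁)
    (hφ' : ∀ v, φ' v ∈ cocycles (subI I k) (rep F I N) q₂)
    (hφφ' : ∀ v, cup (cupPairing (μ : M ⊗[F] N →ₗ[F] P) q₁ q₂) hp φ φ' v ∈
      cocycles (subI I k) (rep F I P) (q₁ + q₂)) :
    cup (cupI q₁ q₂) hp (classOf φ hφ) (classOf φ' hφ') =
      classOf (cup (cupPairing (μ : M ⊗[F] N →ₗ[F] P) q₁ q₂) hp φ φ') hφφ' := by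
  have hτ : ∀ (x : I) (m : M) (n : N), rep F I P x ((μ : M ⊗[F] N →ₗ[F] P) (m ⊗ₜ n)) =
      (μ : M ⊗[F] N →ₗ[F] P) (rep F I M x m ⊗ₜ n) + (μ : M ⊗[F] N →ₗ[F] P) (m ⊗ₜ rep F I N x n) :=
    fun x m n => map_lie_tmul μ (x : g) m n
  -- The cup product restricted to cocycles of I. It maps to the pairing of cochains by inclusion
  -- and to the pairing of cohomology by projection, so cup products with respect to the two can be
  -- compared through it.
  let τ : cocycles (subI I k) (rep F I M) q₁ ⊗[F] cocycles (subI I k) (rep F I N) q₂ →ₗ[F]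
      cocycles (subI I k) (rep F I P) (q₁ + q₂) :=
    TensorProduct.lift (LinearMap.mk₂ F
      (fun a b => ⟨cup (μ : M ⊗[F] N →ₗ[F] P) rfl a.1 b.1, cup_mem_cocycles hτ rfl a.2 b.2⟩)
      (fun a a' b => Subtype.ext (cup_add_left _ _ _ _ _))
      (fun c a b => Subtype.ext (LinearMap.map_smul₂ (cupLin _ rfl) c a.1 b.1))
      (fun a b b' => Subtype.ext (cup_add_right _ _ _ _ _))
      (fun c a b => Subtype.ext (map_smul (cupLin _ rfl a.1) c b.1)))
  have h1 := compAlternatingMap_cup (τ := τ) (τ' := cupI q₁ q₂) (f₁ := classMap M I k q₁)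
    (f₂ := classMap N I k q₂) (f₃ := classMap P I k (q₁ + q₂)) (fun a b => by
      obtain ⟨c, hc, hc'⟩ := hI q₁ q₂ a b
      have : τ (a ⊗ₜ b) = c := Subtype.ext hc.symm
      rw [this]
      exact hc'.symm) hp (φ.codRestrict _ hφ) (φ'.codRestrict _ hφ')
  have h2 := compAlternatingMap_cup (τ := τ) (τ' := cupPairing (μ : M ⊗[F] N →ₗ[F] P) q₁ q₂)
    (f₁ := Submodule.subtype _) (f₂ := Submodule.subtype _) (f₃ := Submodule.subtype _)
    (fun a b => rfl) hp (φ.codRestrict _ hφ) (φ'.codRestrict _ hφ')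
  refine h1.symm.trans ?_
  rw [classOf]
  congr 1
  ext1 v
  exact Subtype.ext (congrArg (fun f => f v) h2)

omit hI [LieModule F g P] in
/-- The leading term of a cup product on `g`. -/
theorem Splitting.comp_cup {p₁ q₁ p₂ q₂ n₁ n₂ n p : ℕ} (h₁ : p₁ + q₁ = n₁) (h₂ : p₂ + q₂ = n₂)
    (hp : p₁ + p₂ = p) (hn : n₁ + n₂ = n) (h : p + (q₁ + q₂) = n)
    {a : g [⋀^Fin n₁]→ₗ[F] M} {b : g [⋀^Fin n₂]→ₗ[F] N} (ha : a ∈ filRel M I k p₁ n₁)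
    (hb : b ∈ filRel N I k p₂ n₂) :
    S.comp P h (cup (μ : M ⊗[F] N →ₗ[F] P) hn a b) = (-1 : ℤ) ^ (p₂ * q₁) •
      cup (cupPairing (μ : M ⊗[F] N →ₗ[F] P) q₁ q₂) hp (S.comp M h₁ a) (S.comp N h₂ b) := by
  have h1 := bicurry_cup (J := I.toSubmodule) (j := inclI I) (fun y => y.2)
    (μ : M ⊗[F] N →ₗ[F] P) h₁ h₂ hp hn h ha.2 hb.2
  have h2 := cup_compLinearMap (cupPairing (μ : M ⊗[F] N →ₗ[F] P) q₁ q₂) S.sec hp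
    (bicurry (inclI I) h₁ a) (bicurry (inclI I) h₂ b)
  ext1 v
  refine (congrArg (fun f => f (S.sec ∘ v)) h1).trans ?_
  rw [AlternatingMap.smul_apply, AlternatingMap.smul_apply]
  exact congrArg _ (congrArg (fun f => f v) h2)

/-- The comparison already holds for cocycles over g/I: `Splitting.comp_cup` gives it for leading
terms, sign included, and `IsCupProduct.classOf_cup` passes to classes. -/
theorem IsCupProduct.psiCochain_cup {p₁ q₁ p₂ q₂ p : ℕ}
    (a : filRelD M I k (2 : ℕ) p₁ (p₁ + q₁)) (b : filRelD N I k (2 : ℕ) p₂ (p₂ + q₂))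
    (hp : p₁ + p₂ = p) (hn : p₁ + q₁ + (p₂ + q₂) = p + (q₁ + q₂))
    (c : filRelD P I k (2 : ℕ) p (p + (q₁ + q₂)))
    (hc : c.1 = cup (μ : M ⊗[F] N →ₗ[F] P) hn a.1 b.1) :
    (S.psiCochain P p (q₁ + q₂) c).1 = (-1 : ℤ) ^ (p₂ * q₁) • cup (cupI q₁ q₂) hp
      (S.psiCochain M p₁ q₁ a).1 (S.psiCochain N p₂ q₂ b).1 := by
  have hs : ((-1 : ℤ) ^ (p₂ * q₁)) * (-1) ^ (p₂ * q₁) = 1 := by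
    rw [← mul_pow]; simp
  have hlead : S.comp P rfl c.1 = (-1 : ℤ) ^ (p₂ * q₁) • cup (cupPairing (μ : M ⊗[F] N →ₗ[F] P) q₁ q₂)
      hp (S.comp M rfl a.1) (S.comp N rfl b.1) := by
    rw [hc]
    exact S.comp_cup rfl rfl hp hn rfl (mem_filRelD.1 a.2).1 (mem_filRelD.1 b.2).1
  -- The leading term of `c` is known to have cocycle values; multiplying by the same sign again
  -- recovers the cup product.
  have hcup : ∀ v, cup (cupPairing (μ : M ⊗[F] N →ₗ[F] P) q₁ q₂) hp (S.comp M rfl a.1)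
      (S.comp N rfl b.1) v ∈ cocycles (subI I k) (rep F I P) (q₁ + q₂) := fun v => by
    rw [← one_smul ℤ (cup _ _ _ _), ← hs, mul_smul, ← hlead]
    exact zsmul_mem (S.comp_mem_cocycles_of_filRelD P c v) _
  change classOf (S.comp P rfl c.1) _ = (-1 : ℤ) ^ (p₂ * q₁) • cup (cupI q₁ q₂) hp
    (classOf (S.comp M rfl a.1) (S.comp_mem_cocycles_of_filRelD M a))
    (classOf (S.comp N rfl b.1) (S.comp_mem_cocycles_of_filRelD N b))
  rw [hI.classOf_cup hp _ _ hcup]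
  simp only [hlead]
  ext1 v
  exact map_zsmul (classMap P I k (q₁ + q₂)) _
    (⟨_, hcup v⟩ : cocycles (subI I k) (rep F I P) (q₁ + q₂))

theorem IsCupProduct.psi_cup_mk {cupE : PagePairing M I k N P} (hE : IsPageCupProduct I k μ cupE)
    {q₁ q₂ : ℕ} {cupH : ∀ p₁ p₂ : ℕ, S.IterCohomology M p₁ q₁ ⊗[F] S.IterCohomology N p₂ q₂ →ₗ[F]
      S.IterCohomology P (p₁ + p₂) (q₁ + q₂)}
    (hH : IsCupProduct (subQuot I k) (S.action M q₁) (S.action N q₂) (S.action P (q₁ + q₂))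
      (cupI q₁ q₂) cupH) (p₁ p₂ : ℕ) (hp : (p₁ : ℤ) + p₂ = (p₁ + p₂ : ℕ))
    (hn : p₁ + q₁ + (p₂ + q₂) = p₁ + p₂ + (q₁ + q₂))
    (a : filRelD M I k (2 : ℕ) p₁ (p₁ + q₁)) (b : filRelD N I k (2 : ℕ) p₂ (p₂ + q₂)) :
    S.psi P (p₁ + p₂) (q₁ + q₂)
        (cupE 2 p₁ (p₁ + q₁) p₂ (p₂ + q₂) ((p₁ + p₂ : ℕ) : ℤ) (p₁ + p₂ + (q₁ + q₂)) hp hn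
          (Page.mk M I k a ⊗ₜ Page.mk N I k b)) =
      (-1 : ℤ) ^ (p₂ * q₁) •
        cupH p₁ p₂ (S.psi M p₁ q₁ (Page.mk M I k a) ⊗ₜ S.psi N p₂ q₂ (Page.mk N I k b)) := by
  obtain ⟨c, hc, hc'⟩ := hE 2 p₁ (p₁ + q₁) p₂ (p₂ + q₂) _ _ hp hn a b
  have h := hH p₁ p₂ (S.psiCochain M p₁ q₁ a)
  replace h := h (S.psiCochain N p₂ q₂ b)
  rcases h with ⟨z, hz⟩
  rcases hz with ⟨hz, hz'⟩
  have hzc : S.psiCochain P (p₁ + p₂) (q₁ + q₂) c = (-1 : ℤ) ^ (p₂ * q₁) • z :=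
    Subtype.ext ((hI.psiCochain_cup S a b rfl _ c hc).trans (congrArg _ hz.symm))
  refine (congrArg (S.psi P (p₁ + p₂) (q₁ + q₂)) hc').trans ?_
  refine Eq.trans ?_ (congrArg ((-1 : ℤ) ^ (p₂ * q₁) • ·) hz').symm
  exact congrArg (Cohomology.mk (subQuot I k) (S.action P (q₁ + q₂))) hzc

/-- The comparison map `psi` respects the pairings up to the sign `(-1) ^ (p₂ * q₁)`. -/
theorem IsCupProduct.psi_cup {cupE : PagePairing M I k N P} (hE : IsPageCupProduct I k μ cupE)
    {q₁ q₂ : ℕ} {cupH : ∀ p₁ p₂ : ℕ, S.IterCohomology M p₁ q₁ ⊗[F] S.IterCohomology N p₂ q₂ →ₗ[F]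
      S.IterCohomology P (p₁ + p₂) (q₁ + q₂)}
    (hH : IsCupProduct (subQuot I k) (S.action M q₁) (S.action N q₂) (S.action P (q₁ + q₂))
      (cupI q₁ q₂) cupH) (p₁ p₂ : ℕ) (hp : (p₁ : ℤ) + p₂ = (p₁ + p₂ : ℕ))
    (hn : p₁ + q₁ + (p₂ + q₂) = p₁ + p₂ + (q₁ + q₂)) (e : Page M I k 2 p₁ (p₁ + q₁))
    (e' : Page N I k 2 p₂ (p₂ + q₂)) :
    S.psi P (p₁ + p₂) (q₁ + q₂)
        (cupE 2 p₁ (p₁ + q₁) p₂ (p₂ + q₂) ((p₁ + p₂ : ℕ) : ℤ) (p₁ + p₂ + (q₁ + q₂)) hp hn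
          (e ⊗ₜ e')) =
      (-1 : ℤ) ^ (p₂ * q₁) • cupH p₁ p₂ (S.psi M p₁ q₁ e ⊗ₜ S.psi N p₂ q₂ e') := by
  refine Submodule.Quotient.induction_on _ e fun a => ?_
  refine Submodule.Quotient.induction_on _ e' fun b => ?_
  exact hI.psi_cup_mk S hE hH p₁ p₂ hp hn a b

end Comparison

end

section

/-- The cup product of `H^q(I, I_k; M)` and `H^q(I, I_k; N)` induces one of the cohomology of `g/I`. -/
theorem IsCupProduct.exists_iterCup {F : Type*} [Field F] {g : Type*} [LieRing g] [LieAlgebra F g]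
    {I : LieIdeal F g} {k : LieSubalgebra F g} {M N P : Type*}
    [AddCommGroup M] [Module F M] [LieRingModule g M] [LieModule F g M]
    [AddCommGroup N] [Module F N] [LieRingModule g N] [LieModule F g N]
    [AddCommGroup P] [Module F P] [LieRingModule g P] [LieModule F g P] {μ : M ⊗[F] N →ₗ⁅F,g⁆ P}
    {cupI : ∀ q₁ q₂ : ℕ, Cohomology (subI I k) (rep F I M) q₁ ⊗[F]
      Cohomology (subI I k) (rep F I N) q₂ →ₗ[F] Cohomology (subI I k) (rep F I P) (q₁ + q₂)}
    (hI : IsCupProduct (subI I k) (rep F I M) (rep F I N) (rep F I P) (μ : M ⊗[F] N →ₗ[F] P) cupI)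
    (S : Splitting I k) (q₁ q₂ : ℕ) :
    ∃ cupH : ∀ p₁ p₂ : ℕ, S.IterCohomology M p₁ q₁ ⊗[F] S.IterCohomology N p₂ q₂ →ₗ[F]
      S.IterCohomology P (p₁ + p₂) (q₁ + q₂),
      IsCupProduct (subQuot I k) (S.action M q₁) (S.action N q₂) (S.action P (q₁ + q₂))
        (cupI q₁ q₂) cupH :=
  exists_isCupProduct (K := subQuot I k) (hI.action_cup S q₁ q₂)

end

end RelLie

theorem propositionp {F : Type*} [Field F] {g : Type*} [LieRing g] [LieAlgebra F g]
    (I : LieIdeal F g) (k : LieSubalgebra F g) (hk : RelLie.IsReductiveIn k)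
    (S : RelLie.Splitting I k)
    {M N P : Type*} [AddCommGroup M] [Module F M] [LieRingModule g M] [LieModule F g M]
    [AddCommGroup N] [Module F N] [LieRingModule g N] [LieModule F g N]
    [AddCommGroup P] [Module F P] [LieRingModule g P] [LieModule F g P]
    (μ : M ⊗[F] N →ₗ⁅F,g⁆ P) :
    ∃ (cupE : RelLie.PagePairing M I k N P)
      (cupI : ∀ q₁ q₂ : ℕ,
        RelLie.Cohomology (RelLie.subI I k) (RelLie.rep F I M) q₁ ⊗[F]
          RelLie.Cohomology (RelLie.subI I k) (RelLie.rep F I N) q₂ →ₗ[F]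
            RelLie.Cohomology (RelLie.subI I k) (RelLie.rep F I P) (q₁ + q₂))
      (cupH : ∀ q₁ q₂ p₁ p₂ : ℕ,
        S.IterCohomology M p₁ q₁ ⊗[F] S.IterCohomology N p₂ q₂ →ₗ[F]
          S.IterCohomology P (p₁ + p₂) (q₁ + q₂))
      (ψM : ∀ p q : ℕ, RelLie.Page M I k 2 p (p + q) →ₗ[F] S.IterCohomology M p q)
      (ψN : ∀ p q : ℕ, RelLie.Page N I k 2 p (p + q) →ₗ[F] S.IterCohomology N p q)
      (ψP : ∀ p q : ℕ, RelLie.Page P I k 2 p (p + q) →ₗ[F] S.IterCohomology P p q),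
      -- the pairings of the pages, induced by the cup product of cochains
      RelLie.IsPageCupProduct I k μ cupE ∧
      -- compatibility with the differentials
      (∀ (r : ℕ) (p₁ : ℤ) (n₁ : ℕ) (p₂ : ℤ) (n₂ : ℕ) (p : ℤ) (n : ℕ)
        (hp : p₁ + p₂ = p) (hn : n₁ + n₂ = n)
        (e : RelLie.Page M I k r p₁ n₁) (e' : RelLie.Page N I k r p₂ n₂),
        RelLie.pageD P I k r p n (cupE r p₁ n₁ p₂ n₂ p n hp hn (e ⊗ₜ e')) =
          cupE r (p₁ + r) (n₁ + 1) p₂ n₂ (p + r) (n + 1) (by omega) (by omega)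
              (RelLie.pageD M I k r p₁ n₁ e ⊗ₜ e') +
            (-1 : ℤ) ^ n₁ •
              cupE r p₁ n₁ (p₂ + r) (n₂ + 1) (p + r) (n + 1) (by omega) (by omega)
                (e ⊗ₜ RelLie.pageD N I k r p₂ n₂ e')) ∧
      -- the cup product on the cohomology of `I` relative to `I_k`
      RelLie.IsCupProduct (RelLie.subI I k) (RelLie.rep F I M) (RelLie.rep F I N)
        (RelLie.rep F I P) (μ : M ⊗[F] N →ₗ[F] P) cupI ∧
      -- the cup product on the cohomology of `g/I` relative to `k/I_k` that it induces
      (∀ q₁ q₂ : ℕ, RelLie.IsCupProduct (RelLie.subQuot I k) (S.action M q₁) (S.action N q₂)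
        (S.action P (q₁ + q₂)) (cupI q₁ q₂) (cupH q₁ q₂)) ∧
      -- the canonical maps from the second pages, and when they are isomorphisms
      S.IsPsi M ψM ∧ S.IsPsi N ψN ∧ S.IsPsi P ψP ∧
      (RelLie.CochainsSemisimple M I k → ∀ p q : ℕ, Function.Bijective (ψM p q)) ∧
      (RelLie.CochainsSemisimple N I k → ∀ p q : ℕ, Function.Bijective (ψN p q)) ∧
      (RelLie.CochainsSemisimple P I k → ∀ p q : ℕ, Function.Bijective (ψP p q)) ∧
      -- the comparison of the pairings
      (∀ (p₁ q₁ p₂ q₂ : ℕ) (e : RelLie.Page M I k 2 p₁ (p₁ + q₁))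
        (e' : RelLie.Page N I k 2 p₂ (p₂ + q₂)),
        ψP (p₁ + p₂) (q₁ + q₂)
            (cupE 2 p₁ (p₁ + q₁) p₂ (p₂ + q₂) ((p₁ + p₂ : ℕ) : ℤ) (p₁ + p₂ + (q₁ + q₂))
              (by omega) (by omega) (e ⊗ₜ e')) =
          (-1 : ℤ) ^ (p₂ * q₁) • cupH q₁ q₂ p₁ p₂ (ψM p₁ q₁ e ⊗ₜ ψN p₂ q₂ e')) := by 
  have hτ (x : I) (m : M) (n : N) : RelLie.rep F I P x ((μ : M ⊗[F] N →ₗ[F] P) (m ⊗ₜ n)) =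
      (μ : M ⊗[F] N →ₗ[F] P) (RelLie.rep F I M x m ⊗ₜ n) +
        (μ : M ⊗[F] N →ₗ[F] P) (m ⊗ₜ RelLie.rep F I N x n) :=
    RelLie.map_lie_tmul μ (x : g) m n
  refine (RelLie.exists_isPageCupProduct I k μ).elim fun cupE hE => ?_
  refine (RelLie.exists_isCupProduct (K := RelLie.subI I k) hτ).elim fun cupI hI => ?_
  exact ⟨cupE, cupI, fun q₁ q₂ => (hI.exists_iterCup S q₁ q₂).choose, S.psi M, S.psi N, S.psi P, hE,
    fun r p₁ n₁ p₂ n₂ p n hp hn => hE.pageD_cup r p₁ n₁ p₂ n₂ p n hp hn _ _ _ _, hI,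
    fun q₁ q₂ => (hI.exists_iterCup S q₁ q₂).choose_spec, S.isPsi_psi M,
    S.isPsi_psi N, S.isPsi_psi P, fun h => S.psi_bijective h, fun h => S.psi_bijective h,
    fun h => S.psi_bijective h, fun p₁ q₁ p₂ q₂ e e' =>
      hI.psi_cup S hE (hI.exists_iterCup S q₁ q₂).choose_spec p₁ p₂ _ _ e e'⟩
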